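/- **Setting.** Fix real $\beta,h$. For $N\ge 1$ and $\sigma,\sigma'\in\{\pm1\}^N$ put $q_{\sigma,\sigma'}=\frac1N\sum_{i=1}^N\sigma_i\sigma'_i$. The Sherrington–Kirkpatrick model is given by $-H_N(\sigma)=K_N(\sigma)+h\sum_i\sigma_i$, with $K_N(\sigma)=\frac{1}{\sqrt{2N}}\sum_{i,j=1}^N J_{ij}\sigma_i\sigma_j$ and $J_{ij}$ i.i.d. $N(0,1)$; $Z_N=\sum_\sigma e^{-\beta H_N(\sigma)}$, and $P_N(\beta,h)=\frac1N\mathbb E\ln Z_N$ is the quenched pressure. A *random overlap structure* (ROSt) $\mu$ is a probability space carrying a nonincreasing random sequence $\{\xi_\alpha\}_{\alpha\in\mathbb N}$ and a random real matrix $\{q_{\alpha,\alpha'}\}_{\alpha,\alpha'\in\mathbb N}$ such that almost surely $\xi_\alpha\ge 0$, $0<\sum_\alpha\xi_\alpha<\infty$, $q$ is (symmetric) positive semidefinite, and $q_{\alpha,\alpha}=1$ for all $\alpha$. Given the ROSt, let $\{\eta^i_\alpha\}$ ($1\le i\le N$), $\{\kappa_\alpha\}$ and $\{K_N(\sigma)\}$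 be independent families of centered Gaussian variables, with $\mathbb E(\eta^i_\alpha\eta^j_{\alpha'})=\delta_{ij}\,q_{\alpha,\alpha'}$, $\mathbb E(\kappa_\alpha\kappa_{\alpha'})=\frac12q_{\alpha,\alpha'}^2$, and $K_N$ as above. Put $V_{\alpha,\sigma}=\sum_{i=1}^N\eta^i_\alpha\sigma_i$ and $$G_N(\beta,h;\mu)=\frac1N\,\mathbb E\ln\frac{\sum_{\alpha,\sigma}\xi_\alpha e^{\beta(V_{\alpha,\sigma}+h\sum_i\sigma_i)}}{\sum_\alpha\xi_\alpha e^{\beta\sqrt N\kappa_\alpha}}.$$ For $t\in[0,1]$ and $\gamma=(\alpha,\sigma)$ let $X_\gamma(t)=\sqrt{1-t}\,\bigl(K_N(\sigma)+\sqrt N\kappa_\alpha\bigr)+\sqrt t\,V_{\alpha,\sigma}$, let $\zeta_t(\gamma)$ be proportional to $\xi_\alpha e^{\beta(X_\gamma(t)+h\sum_i\sigma_i)}$ with $\sum_\gamma\zeta_t(\gamma)=1$, and set $\mathbb E^{(2)}_t(f)=\mathbb E\sum_{\gamma,\gamma'}f(\gamma,\gamma')\,\zeta_t(\gamma)\zeta_t(\gamma')$.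 **Theorem.** (1) For every $N\ge1$ and every ROSt $\mu$, all the expressions above are well defined (the sums converge almost surely and the expectations exist), $$\frac1N\mathbb E\ln Z_N\le G_N(\beta,h;\mu),$$ and the gap is exactly $$G_N(\beta,h;\mu)-\frac1N\mathbb E\ln Z_N=\frac{\beta^2}{4}\int_0^1\mathbb E^{(2)}_t\bigl((q_{\alpha,\alpha'}-q_{\sigma,\sigma'})^2\bigr)\,dt.$$ (2) The limit $P(\beta,h)=\lim_{N\to\infty}P_N(\beta,h)$ exists in $\mathbb R$, and $$P(\beta,h)=\lim_{M\to\infty}\ \inf_{\mu}\,G_M(\beta,h;\mu)=\sup_{M\ge1}\ \inf_{\mu}\,G_M(\beta,h;\mu),$$ where the infimum runs over all random overlap structures. -/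

import Mathlib

open MeasureTheory ProbabilityTheory Filter
open scoped Topology

universe u

namespace SpinGlass

noncomputable section

/-! ### Centered Gaussian sequences with a prescribed covariance -/

/-- Residual covariances: `residual C k` is what is left of the covariance `C` after
conditioning a centered Gaussian sequence with covariance `C` on its first `k` terms
(a null pivot is skipped, by the convention `x / 0 = 0`). -/
def residual (C : ℕ → ℕ → ℝ) : ℕ → ℕ → ℕ → ℝ
  | 0 => C
  | k + 1 => fun i j => residual C k i j - residual C k i k * residual C k j k / residual C k k k

/-- Lower triangular factor `L` of a positive semidefinite `C` (so that `C = L Lᵀ`, see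
`sum_gaussFactor_mul`). -/
def gaussFactor (C : ℕ → ℕ → ℝ) (n k : ℕ) : ℝ :=
  residual C k n k / √(residual C k k k)

/-- The `n`-th term of the centered Gaussian sequence with covariance `C`, as a function of a
sequence `g` of independent standard normal variables. -/
def gaussSeq (C : ℕ → ℕ → ℝ) (g : ℕ → ℝ) (n : ℕ) : ℝ :=
  ∑ k ∈ Finset.range (n + 1), gaussFactor C n k * g k

/-- The law of a sequence of independent standard normal variables. -/
def stdNormalSeq : Measure (ℕ → ℝ) := Measure.infinitePi fun _ => gaussianReal 0 1

instance : IsProbabilityMeasure stdNormalSeq := by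
  unfold stdNormalSeq; infer_instance

theorem residual_aux {C : ℕ → ℕ → ℝ} (hC : (Matrix.of C).PosSemidef) (k : ℕ) :
    (∀ i j, residual C k i j = residual C k j i) ∧
      ∀ (s : Finset ℕ) (c : ℕ → ℝ), 0 ≤ ∑ i ∈ s, ∑ j ∈ s, c i * c j * residual C k i j := by
  induction k with
  | zero =>
    refine ⟨fun i j => ?_, fun s c => ?_⟩
    · have := hC.1.apply i j
      simpa [residual] using this.symm
    · have h := hC.2 (Finsupp.onFinset s (fun i => if i ∈ s then c i else 0)
        (by intro a; simp; tauto))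
      rw [Finsupp.onFinset_sum _ (by simp)] at h
      refine h.trans_eq (Finset.sum_congr rfl fun i hi => ?_)
      rw [Finsupp.onFinset_sum _ (by simp)]
      refine Finset.sum_congr rfl fun j hj => ?_
      simp [residual, hi, hj]
      ring
  | succ k ih =>
    obtain ⟨hs, hp⟩ := ih
    refine ⟨fun i j => by simp only [residual]; rw [hs i j]; ring, fun s c => ?_⟩
    set R := residual C k with hR
    by_cases h0 : R k k = 0
    · simpa [residual, ← hR, h0] using hp s c
    set S := ∑ i ∈ s, c i * R i k with hS
    have key : ∑ i ∈ s, ∑ j ∈ s, c i * c j * residual C (k + 1) i j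
        = ∑ i ∈ s, ∑ j ∈ s, c i * c j * R i j - S * S / R k k := by
      rw [hS, Finset.sum_mul_sum, Finset.sum_div, ← Finset.sum_sub_distrib]
      refine Finset.sum_congr rfl fun i _ => ?_
      rw [Finset.sum_div, ← Finset.sum_sub_distrib]
      refine Finset.sum_congr rfl fun j _ => ?_
      simp only [residual, ← hR]
      ring
    rw [key]
    set e : ℕ → ℝ := fun i => if i = k then 1 else 0 with he
    set T := insert k s with hT
    set d : ℕ → ℝ := fun i => if i ∈ s then c i else 0 with hd
    have hsT : s ⊆ T := Finset.subset_insert _ _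
    have hkT : k ∈ T := Finset.mem_insert_self _ _
    have hdT : ∀ f : ℕ → ℝ, ∑ i ∈ T, d i * f i = ∑ i ∈ s, c i * f i := by
      intro f
      rw [← Finset.sum_subset hsT (fun i _ hi => by simp [hd, hi])]
      exact Finset.sum_congr rfl fun i hi => by simp [hd, hi]
    have heT : ∀ f : ℕ → ℝ, ∑ i ∈ T, e i * f i = f k := by
      intro f
      simp [he, hkT]
    have h := hp T (fun i => d i - S / R k k * e i)
    have expand : ∑ i ∈ T, ∑ j ∈ T,
        (d i - S / R k k * e i) * (d j - S / R k k * e j) * R i j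
        = ∑ i ∈ T, d i * (∑ j ∈ T, d j * R i j) - S / R k k * ∑ i ∈ T, d i * ∑ j ∈ T, e j * R i j
          - S / R k k * ∑ i ∈ T, e i * ∑ j ∈ T, d j * R i j
          + S / R k k * (S / R k k) * ∑ i ∈ T, e i * ∑ j ∈ T, e j * R i j := by
      simp only [Finset.mul_sum, ← Finset.sum_sub_distrib, ← Finset.sum_add_distrib]
      refine Finset.sum_congr rfl fun i _ => Finset.sum_congr rfl fun j _ => ?_
      ring
    rw [expand] at h
    simp only [hdT, heT] at h
    have h1 : ∑ j ∈ s, c j * R k j = S := Finset.sum_congr rfl fun j _ => by rw [hs k j]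
    rw [h1, ← hS] at h
    have h2 : ∑ i ∈ s, c i * ∑ j ∈ s, c j * R i j = ∑ i ∈ s, ∑ j ∈ s, c i * c j * R i j := by
      refine Finset.sum_congr rfl fun i _ => ?_
      rw [Finset.mul_sum]
      exact Finset.sum_congr rfl fun j _ => by ring
    rw [h2] at h
    refine h.trans_eq ?_
    field_simp
    ring

theorem residual_diag_nonneg {C : ℕ → ℕ → ℝ} (hC : (Matrix.of C).PosSemidef) (k i : ℕ) :
    0 ≤ residual C k i i := by
  simpa using (residual_aux hC k).2 {i} (fun _ => 1)

theorem residual_eq_zero {C : ℕ → ℕ → ℝ} (hC : (Matrix.of C).PosSemidef) {k i : ℕ}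
    (h0 : residual C k i i = 0) (j : ℕ) : residual C k i j = 0 := by
  rcases eq_or_ne i j with rfl | hij
  · exact h0
  obtain ⟨hs, hp⟩ := residual_aux hC k
  have hq : ∀ x : ℝ, 0 ≤ 2 * x * residual C k i j + residual C k j j := by
    intro x
    have h := hp {i, j} (fun l => if l = i then x else 1)
    rw [Finset.sum_pair hij, Finset.sum_pair hij, Finset.sum_pair hij, h0, hs j i] at h
    simp [hij.symm] at h
    linarith
  by_contra hne
  have h := hq (-(residual C k j j + 1) / (2 * residual C k i j))
  have : 2 * (-(residual C k j j + 1) / (2 * residual C k i j)) * residual C k i j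
      = -(residual C k j j + 1) := by field_simp
  linarith

/-- The factorization `C = L Lᵀ`. -/
theorem sum_gaussFactor_mul {C : ℕ → ℕ → ℝ} (hC : (Matrix.of C).PosSemidef) (m n : ℕ) :
    ∑ k ∈ Finset.range (m + 1), gaussFactor C m k * gaussFactor C n k = C m n := by
  have hstep : ∀ k, gaussFactor C m k * gaussFactor C n k
      = residual C k m n - residual C (k + 1) m n := by
    intro k
    simp only [gaussFactor, residual]
    rw [div_mul_div_comm, Real.mul_self_sqrt (residual_diag_nonneg hC k k)]
    ring
  simp only [hstep]
  rw [Finset.sum_range_sub' (fun k => residual C k m n)]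
  have : residual C (m + 1) m n = 0 := by
    simp only [residual]
    by_cases h0 : residual C m m m = 0
    · simp [h0, residual_eq_zero hC h0 n]
    · rw [(residual_aux hC m).1 n m]
      field_simp
      ring
  rw [this]
  simp [residual]

/-- `gaussSeq C` is a Gaussian process. -/
theorem isGaussianProcess_gaussSeq (C : ℕ → ℕ → ℝ) :
    IsGaussianProcess (fun n g => gaussSeq C g n) stdNormalSeq := by
  have hcoord : IsGaussianProcess (fun (k : ℕ) (g : ℕ → ℝ) => g k) stdNormalSeq := by
    refine ⟨fun I => ?_⟩
    have hind : iIndepFun (fun (k : ℕ) (g : ℕ → ℝ) => g k) stdNormalSeq :=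
      iIndepFun_infinitePi (X := fun _ x => x) (by fun_prop)
    have h2 : iIndepFun (fun (k : I) (g : ℕ → ℝ) => g k) stdNormalSeq :=
      hind.precomp Subtype.val_injective
    refine iIndepFun.hasGaussianLaw (fun k => ⟨?_⟩) h2
    have : stdNormalSeq.map (fun g : ℕ → ℝ => g k) = gaussianReal 0 1 :=
      Measure.infinitePi_map_eval _ _
    change IsGaussian (stdNormalSeq.map (fun g : ℕ → ℝ => g k))
    rw [this]
    infer_instance
  refine hcoord.of_isGaussianProcess fun n => ⟨Finset.range (n + 1),
    ∑ k : Finset.range (n + 1), gaussFactor C n k • ContinuousLinearMap.proj k, fun g => ?_⟩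
  simp only [gaussSeq, sum_apply, smul_apply,
    ContinuousLinearMap.proj_apply, Finset.restrict, smul_eq_mul]
  exact (Finset.sum_coe_sort (Finset.range (n + 1)) (fun k => gaussFactor C n k * g k)).symm

theorem integral_coord (k : ℕ) : ∫ g, g k ∂stdNormalSeq = 0 := by
  have h := (measurePreserving_eval_infinitePi (fun _ : ℕ => gaussianReal 0 1) k).map_eq
  have h2 := integral_map (μ := stdNormalSeq) (φ := fun g : ℕ → ℝ => g k) (f := fun x : ℝ => x)
    (measurable_pi_apply k).aemeasurable (by fun_prop)
  have h' : stdNormalSeq.map (fun g : ℕ → ℝ => g k) = gaussianReal 0 1 := h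
  rw [h', integral_id_gaussianReal] at h2
  exact h2.symm

theorem memLp_coord (k : ℕ) : MemLp (fun g : ℕ → ℝ => g k) 2 stdNormalSeq := by
  have h' : stdNormalSeq.map (fun g : ℕ → ℝ => g k) = gaussianReal 0 1 :=
    (measurePreserving_eval_infinitePi (fun _ : ℕ => gaussianReal 0 1) k).map_eq
  have := memLp_id_gaussianReal (μ := 0) (v := 1) 2
  rw [← h'] at this
  exact this.comp_of_map (measurable_pi_apply k).aemeasurable

theorem integral_coord_mul (k l : ℕ) :
    ∫ g, g k * g l ∂stdNormalSeq = if k = l then 1 else 0 := by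
  have h' : ∀ k, stdNormalSeq.map (fun g : ℕ → ℝ => g k) = gaussianReal 0 1 := fun k =>
    (measurePreserving_eval_infinitePi (fun _ : ℕ => gaussianReal 0 1) k).map_eq
  split_ifs with h
  · subst h
    have h1 := variance_eq_sub (memLp_coord k)
    have h2 : Var[fun g : ℕ → ℝ => g k; stdNormalSeq] = 1 := by
      have := variance_map (μ := stdNormalSeq) (Y := fun g : ℕ → ℝ => g k) (X := id)
        (by fun_prop) (measurable_pi_apply k).aemeasurable
      rw [h', variance_id_gaussianReal] at this
      simpa using this.symm
    rw [h2, integral_coord] at h1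
    simp only [Pi.pow_apply] at h1
    simp only [← pow_two]
    linarith
  · have hind : iIndepFun (fun (k : ℕ) (g : ℕ → ℝ) => g k) stdNormalSeq :=
      iIndepFun_infinitePi (X := fun _ x => x) (by fun_prop)
    have := (hind.indepFun h).integral_mul_eq_mul_integral
      (measurable_pi_apply k).aestronglyMeasurable (measurable_pi_apply l).aestronglyMeasurable
    simpa [integral_coord] using this

/-- `gaussSeq C` is centered. -/
theorem integral_gaussSeq (C : ℕ → ℕ → ℝ) (n : ℕ) :
    ∫ g, gaussSeq C g n ∂stdNormalSeq = 0 := by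
  simp only [gaussSeq]
  rw [integral_finsetSum _ fun k _ =>
    ((memLp_coord k).integrable (by norm_num)).const_mul (gaussFactor C n k)]
  simp [integral_const_mul, integral_coord]

/-- `gaussSeq C` has covariance `C` if `C` is positive semidefinite. -/
theorem integral_gaussSeq_mul {C : ℕ → ℕ → ℝ} (hC : (Matrix.of C).PosSemidef) (m n : ℕ) :
    ∫ g, gaussSeq C g m * gaussSeq C g n ∂stdNormalSeq = C m n := by
  wlog hmn : m ≤ n generalizing m n
  · have h := this n m (by omega)
    have h2 : C m n = C n m := by simpa using (hC.1.apply m n).symm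
    rw [h2, ← h]
    simp only [mul_comm]
  have hint : ∀ k l, Integrable (fun g : ℕ → ℝ =>
      gaussFactor C m k * g k * (gaussFactor C n l * g l)) stdNormalSeq := by
    intro k l
    have := ((memLp_coord k).integrable_mul (memLp_coord l)).const_mul
      (gaussFactor C m k * gaussFactor C n l)
    refine this.congr (ae_of_all _ fun g => ?_)
    simp only [Pi.mul_apply]
    ring
  simp only [gaussSeq, Finset.sum_mul_sum]
  rw [integral_finsetSum _ fun k _ => integrable_finsetSum _ fun l _ => hint k l]
  rw [← sum_gaussFactor_mul hC m n]
  refine Finset.sum_congr rfl fun k hk => ?_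
  rw [integral_finsetSum _ fun l _ => hint k l]
  have : ∀ l, ∫ g, gaussFactor C m k * g k * (gaussFactor C n l * g l) ∂stdNormalSeq
      = if k = l then gaussFactor C m k * gaussFactor C n l else 0 := by
    intro l
    have e : ∀ g : ℕ → ℝ, gaussFactor C m k * g k * (gaussFactor C n l * g l)
        = gaussFactor C m k * gaussFactor C n l * (g k * g l) := fun g => by ring
    simp only [e, integral_const_mul, integral_coord_mul]
    split_ifs <;> simp
  simp only [this]
  rw [Finset.sum_ite_eq]
  have hk' := Finset.mem_range.1 hk
  rw [if_pos (Finset.mem_range.2 (by omega))]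

/-! ### The Sherrington-Kirkpatrick model -/

/-- Configurations of `N` spins with values `±1`. -/
abbrev Spins (N : ℕ) : Type := Fin N → ℤˣ

/-- The value of the spin at site `i`, as a real number. -/
def spin {N : ℕ} (σ : Spins N) (i : Fin N) : ℝ := ((σ i : ℤ) : ℝ)

/-- The total magnetization. -/
def magnetization {N : ℕ} (σ : Spins N) : ℝ := ∑ i, spin σ i

/-- The overlap of two spin configurations. -/
def overlap {N : ℕ} (σ σ' : Spins N) : ℝ := (∑ i, spin σ i * spin σ' i) / N

/-- The law of the couplings: independent standard normal variables. -/
def couplings (N : ℕ) : Measure (Fin N × Fin N → ℝ) := Measure.pi fun _ => gaussianReal 0 1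

/-- The interaction `K_N(σ)`, a centered Gaussian field with covariance
`(N / 2) * overlap σ σ' ^ 2`. -/
def interaction {N : ℕ} (J : Fin N × Fin N → ℝ) (σ : Spins N) : ℝ :=
  (∑ i, ∑ j, J (i, j) * spin σ i * spin σ j) / √(2 * N)

/-- The partition function, for `-H_N(σ) = K_N(σ) + h ∑ σ_i`. -/
def partition (β h : ℝ) {N : ℕ} (J : Fin N × Fin N → ℝ) : ℝ :=
  ∑ σ : Spins N, Real.exp (β * (interaction J σ + h * magnetization σ))

/-- The quenched pressure `P_N(β, h) = (1 / N) E ln Z_N`. -/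
def pressure (β h : ℝ) (N : ℕ) : ℝ :=
  1 / N * ∫ J, Real.log (partition β h J) ∂(couplings N)

/-! ### Random overlap structures -/

/-- A random overlap structure: random weights `ξ`, in nonincreasing order, and a random overlap
matrix `q` on a common probability space. -/
structure ROSt where
  /-- the probability space -/
  Ω : Type u
  [mΩ : MeasurableSpace Ω]
  /-- the probability measure -/
  μ : Measure Ω
  [isProb : IsProbabilityMeasure μ]
  /-- the weights -/
  ξ : ℕ → Ω → ℝ
  /-- the overlaps -/
  q : ℕ → ℕ → Ω → ℝ
  measurable_ξ : ∀ n, Measurable (ξ n)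
  measurable_q : ∀ n n', Measurable (q n n')
  antitone_ξ : ∀ᵐ ω ∂μ, Antitone fun n => ξ n ω
  nonneg_ξ : ∀ᵐ ω ∂μ, ∀ n, 0 ≤ ξ n ω
  summable_ξ : ∀ᵐ ω ∂μ, Summable fun n => ξ n ω
  tsum_pos_ξ : ∀ᵐ ω ∂μ, 0 < ∑' n, ξ n ω
  posSemidef_q : ∀ᵐ ω ∂μ, (Matrix.of fun n n' => q n n' ω).PosSemidef
  diag_q : ∀ᵐ ω ∂μ, ∀ n, q n n ω = 1

attribute [instance] ROSt.mΩ ROSt.isProb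

namespace ROSt

variable (R : ROSt.{u})

/-- Sample points for all the randomness at block size `N`: a point of the overlap structure, a
sequence driving `κ`, sequences driving `η¹, …, η^N`, and the couplings of the `N`-spin system. -/
abbrev Sample (N : ℕ) : Type u :=
  R.Ω × (ℕ → ℝ) × (Fin N → ℕ → ℝ) × (Fin N × Fin N → ℝ)

/-- The joint law: the overlap structure and the Gaussian variables are independent. -/
def law (N : ℕ) : Measure (R.Sample N) :=
  R.μ.prod (stdNormalSeq.prod ((Measure.pi fun _ => stdNormalSeq).prod (couplings N)))

/-- The field `κ_α`: given the overlaps, centered Gaussian with covariance `q ^ 2 / 2`. -/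
def kappa {N : ℕ} (s : R.Sample N) (α : ℕ) : ℝ :=
  gaussSeq (fun n n' => R.q n n' s.1 ^ 2 / 2) s.2.1 α

/-- The fields `η^i_α`: given the overlaps, centered Gaussian with covariance `q`, independent for
different `i`. -/
def eta {N : ℕ} (s : R.Sample N) (i : Fin N) (α : ℕ) : ℝ :=
  gaussSeq (fun n n' => R.q n n' s.1) (s.2.2.1 i) α

/-- The cavity field `V_{α,σ}`; given the overlaps, its covariance is
`N * q α α' * overlap σ σ'`. -/
def cavity {N : ℕ} (s : R.Sample N) (γ : ℕ × Spins N) : ℝ :=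
  ∑ i, R.eta s i γ.1 * spin γ.2 i

/-- The summands of the numerator in the incremental free energy functional. -/
def cavityWeight (β h : ℝ) {N : ℕ} (s : R.Sample N) (γ : ℕ × Spins N) : ℝ :=
  R.ξ γ.1 s.1 * Real.exp (β * (R.cavity s γ + h * magnetization γ.2))

/-- The summands of the denominator in the incremental free energy functional. -/
def vacancyWeight (β : ℝ) {N : ℕ} (s : R.Sample N) (α : ℕ) : ℝ :=
  R.ξ α s.1 * Real.exp (β * √N * R.kappa s α)

/-- The logarithm whose expectation is the incremental free energy. -/
def logIncrement (β h : ℝ) {N : ℕ} (s : R.Sample N) : ℝ :=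
  Real.log ((∑' γ, R.cavityWeight β h s γ) / ∑' α, R.vacancyWeight β s α)

/-- The incremental free energy functional `G_N(β, h; μ)`. -/
def G (β h : ℝ) (N : ℕ) : ℝ := 1 / N * ∫ s, R.logIncrement β h s ∂(R.law N)

/-- The interpolating Gaussian field
`X_γ(t) = √(1 - t) (K_N(σ) + √N κ_α) + √t V_{α,σ}` for `γ = (α, σ)`. -/
def interpField {N : ℕ} (t : ℝ) (s : R.Sample N) (γ : ℕ × Spins N) : ℝ :=
  √(1 - t) * (interaction s.2.2.2 γ.2 + √N * R.kappa s γ.1) + √t * R.cavity s γ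

/-- The unnormalized weights at interpolation time `t`. -/
def interpWeight (β h t : ℝ) {N : ℕ} (s : R.Sample N) (γ : ℕ × Spins N) : ℝ :=
  R.ξ γ.1 s.1 * Real.exp (β * (R.interpField t s γ + h * magnetization γ.2))

/-- The normalized (Gibbs) weights `ζ_t(γ)` at interpolation time `t`. -/
def gibbsWeight (β h t : ℝ) {N : ℕ} (s : R.Sample N) (γ : ℕ × Spins N) : ℝ :=
  R.interpWeight β h t s γ / ∑' γ', R.interpWeight β h t s γ'

/-- The average of `(q_{α,α'} - q_{σ,σ'}) ^ 2` over two replicas `γ = (α, σ)`, `γ' = (α', σ')`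
drawn independently with the weights `ζ_t`, for a fixed sample. -/
def replicaSum (β h t : ℝ) {N : ℕ} (s : R.Sample N) : ℝ :=
  ∑' γ : ℕ × Spins N, ∑' γ' : ℕ × Spins N,
    (R.q γ.1 γ'.1 s.1 - overlap γ.2 γ'.2) ^ 2 *
      (R.gibbsWeight β h t s γ * R.gibbsWeight β h t s γ')

/-- The two-replica expectation `E_t^{(2)} ((q_{α,α'} - q_{σ,σ'}) ^ 2)`. -/
def replicaMean (β h : ℝ) (N : ℕ) (t : ℝ) : ℝ := ∫ s, R.replicaSum β h t s ∂(R.law N)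

end ROSt

end

end SpinGlass

open SpinGlass

/-!
The heart of the matter is one interpolation formula. For a finite set of energies that are linear
in independent standard normal variables, let `logZ w a` be the expected logarithm of the partition
function with a priori weights `w` and covariance `a aᵀ`. Moving from one Gaussian field to an
independent second one along `√(1 - t) a + √t b`, Gaussian integration by parts expresses the time
derivative through the difference `D` of the two covariances, as half the Gibbs average of
`D γ γ - D γ γ'` over two replicas (`logZ_sub_logZ`). For `K_N + √N κ` against the cavity field `V`
the diagonal of `D` vanishes and `D γ γ' = -(N / 2) (q_{α,α'} - q_{σ,σ'}) ^ 2` (up to the factor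
`β ^ 2`), a perfect square. At time one the interpolating partition function is the numerator of the
incremental free energy; at time zero it factorizes into `Z_N` and the denominator. This gives the
gap formula, hence the bound.

The formula is proved for fixed weights and overlaps, first for finitely many weights
(`gap_truncate`), then by dominated convergence for a summable sequence (`gap_fixed`), and is finally
averaged over the overlap structure (`ROSt.G_sub_pressure`). All limits are controlled by a single
dominating factor (`envelope`), uniform in time and in the spin configuration, which has bounded
exponential moments because the overlap matrix has unit diagonal; the logarithm of the partition
function then differs from that of `∑ ξ` by at most a `ξ`-average of this factor
(`abs_log_pathSum_sub_le`).

The interpolation formula also compares two Gaussian fields through their covariances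
(`logZ_le_logZ_add`). Consequences are that `logZ` depends on the covariance only, that the free
energy `E ln Z_N` is superadditive (`freeEnergy_superadditive`, by convexity of the square), so that
`P_N` converges to `P = sup P_N` by Fekete's lemma, and that the bound is asymptotically attained. For
the last point, the structure made of the `2 ^ N` Boltzmann weights of the model itself, with an
interaction of strength `√(N / (N + M))`, has an incremental free energy for `M` spins equal to
`(E ln Z_{N+M} - E ln Z_N) / M` up to an error of order `M / (N + M)`, because the covariances on
both sides differ by that little (`gibbsROSt_G_le`). As `E ln Z_n ≤ n P` for all `n`, these increments
cannot stay above `M P` by a fixed amount, so `inf_μ G_M ≤ P` for every `M`, and `P_M ≤ inf_μ G_M`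
by the first part.
-/

namespace SpinGlass

noncomputable section

/-! ### Gaussian integration by parts -/

theorem hasDerivAt_gaussianPDFReal (x : ℝ) :
    HasDerivAt (gaussianPDFReal 0 1) (-(x * gaussianPDFReal 0 1 x)) x := by
  have h : HasDerivAt (fun x : ℝ => -(x - 0) ^ 2 / (2 * ((1 : NNReal) : ℝ))) (-x) x := by
    have := (((hasDerivAt_id x).sub_const (0 : ℝ)).pow 2).neg.div_const (2 * ((1 : NNReal) : ℝ))
    convert! this using 1
    simp
    ring
  have := h.exp.const_mul (√(2 * Real.pi * (1 : NNReal)))⁻¹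
  convert! this using 1
  simp only [gaussianPDFReal]
  ring

/-- Gaussian integration by parts in dimension one. -/
theorem integral_mul_gaussianReal {f f' : ℝ → ℝ} {C C' : ℝ} (hf : ∀ x, HasDerivAt f (f' x) x)
    (hb : ∀ x, |f x| ≤ C) (hb' : ∀ x, |f' x| ≤ C') :
    ∫ x, x * f x ∂(gaussianReal 0 1) = ∫ x, f' x ∂(gaussianReal 0 1) := by
  have hfm : Measurable f :=
    (continuous_iff_continuousAt.2 fun x => (hf x).continuousAt).measurable
  have hfm' : Measurable f' := by
    have : f' = deriv f := funext fun x => (hf x).deriv.symm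
    rw [this]; exact measurable_deriv f
  have hpdf : Integrable (gaussianPDFReal 0 1) := integrable_gaussianPDFReal 0 1
  have hid : Integrable (fun x => x * gaussianPDFReal 0 1 x) := by
    have h1 : Integrable (fun x : ℝ => x) (gaussianReal 0 1) :=
      (memLp_id_gaussianReal (μ := 0) (v := 1) 1).integrable (by norm_num)
    rw [gaussianReal_of_var_ne_zero _ one_ne_zero] at h1
    rw [integrable_withDensity_iff_integrable_smul' (measurable_gaussianPDF 0 1)
      (ae_of_all _ fun x => gaussianPDF_lt_top)] at h1
    refine h1.congr (ae_of_all _ fun x => ?_)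
    simp [mul_comm]
  rw [integral_gaussianReal_eq_integral_smul one_ne_zero,
    integral_gaussianReal_eq_integral_smul one_ne_zero]
  have key := integral_mul_deriv_eq_deriv_mul_of_integrable (u := f) (u' := f')
    (v := gaussianPDFReal 0 1) (v' := fun x => -(x * gaussianPDFReal 0 1 x)) (fun x _ => hf x)
    (fun x _ => hasDerivAt_gaussianPDFReal x) ?_ ?_ ?_
  · simp only [mul_neg, integral_neg, neg_inj] at key
    simp only [smul_eq_mul]
    rw [← integral_congr_ae (ae_of_all _ fun x => mul_comm (f' x) _), ← key]
    exact integral_congr_ae (ae_of_all _ fun x => by ring)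
  · exact hid.neg.bdd_mul hfm.aestronglyMeasurable (ae_of_all _ hb)
  · exact hpdf.bdd_mul hfm'.aestronglyMeasurable (ae_of_all _ hb')
  · exact hpdf.bdd_mul hfm.aestronglyMeasurable (ae_of_all _ hb)

section Pi

variable {κ : Type*} [Fintype κ]

/-- The law of a finite family of independent standard normal variables. -/
def stdNormal (κ : Type*) [Fintype κ] : Measure (κ → ℝ) := Measure.pi fun _ => gaussianReal 0 1

instance : IsProbabilityMeasure (stdNormal κ) := by unfold stdNormal; infer_instance

theorem measurePreserving_eval_stdNormal (k : κ) :
    MeasurePreserving (fun g : κ → ℝ => g k) (stdNormal κ) (gaussianReal 0 1) :=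
  measurePreserving_eval (fun _ : κ => gaussianReal 0 1) k

theorem integrable_eval_stdNormal (k : κ) : Integrable (fun g : κ → ℝ => g k) (stdNormal κ) :=
  (measurePreserving_eval_stdNormal k).integrable_comp_of_integrable
    ((memLp_id_gaussianReal (μ := 0) (v := 1) 1).integrable (by norm_num))

/-- Resampling one coordinate of a standard normal vector. -/
theorem measurePreserving_update [DecidableEq κ] (k : κ) :
    MeasurePreserving (fun p : (κ → ℝ) × ℝ => Function.update p.1 k p.2)
      ((stdNormal κ).prod (gaussianReal 0 1)) (stdNormal κ) := by
  have hm : Measurable (fun p : (κ → ℝ) × ℝ => Function.update p.1 k p.2) := by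
    refine measurable_pi_lambda _ fun j => ?_
    by_cases h : j = k
    · subst h; simpa using measurable_snd
    · simp only [Function.update_of_ne h]
      exact (measurable_pi_apply j).comp measurable_fst
  refine ⟨hm, ?_⟩
  symm
  refine Measure.pi_eq fun s hs => ?_
  rw [Measure.map_apply hm (MeasurableSet.univ_pi hs)]
  have : (fun p : (κ → ℝ) × ℝ => Function.update p.1 k p.2) ⁻¹' Set.univ.pi s
      = (Set.univ.pi (Function.update s k Set.univ)) ×ˢ s k := by
    ext ⟨x, y⟩
    simp only [Set.mem_preimage, Set.mem_univ_pi, Set.mem_prod]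
    constructor
    · refine fun h => ⟨fun j => ?_, by simpa using h k⟩
      by_cases hj : j = k
      · subst hj; simp
      · simpa [Function.update_of_ne hj] using h j
    · rintro ⟨h1, h2⟩ j
      by_cases hj : j = k
      · subst hj; simpa using h2
      · simpa [Function.update_of_ne hj] using h1 j
  rw [this, Measure.prod_prod, stdNormal, Measure.pi_pi, ← Finset.mul_prod_erase _ _
    (Finset.mem_univ k), ← Finset.mul_prod_erase (a := k) _ (fun i => gaussianReal 0 1 (s i))
    (Finset.mem_univ k)]
  rw [Finset.prod_congr rfl (g := fun i => gaussianReal 0 1 (s i))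
    fun j hj => by rw [Function.update_of_ne (Finset.ne_of_mem_erase hj)]]
  simp [mul_comm]

/-- Gaussian integration by parts for independent standard normal variables. -/
theorem integral_eval_mul_stdNormal [DecidableEq κ] (k : κ) {F F' : (κ → ℝ) → ℝ} {C C' : ℝ}
    (hF : ∀ g y, HasDerivAt (fun y => F (Function.update g k y)) (F' (Function.update g k y)) y)
    (hm : Measurable F) (hm' : Measurable F') (hb : ∀ g, |F g| ≤ C) (hb' : ∀ g, |F' g| ≤ C') :
    ∫ g, g k * F g ∂(stdNormal κ) = ∫ g, F' g ∂(stdNormal κ) := by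
  have hU := measurePreserving_update (κ := κ) k
  have i1 : Integrable (fun g : κ → ℝ => g k * F g) (stdNormal κ) :=
    (integrable_eval_stdNormal k).mul_bdd hm.aestronglyMeasurable (ae_of_all _ hb)
  have i2 : Integrable F' (stdNormal κ) :=
    Integrable.of_bound hm'.aestronglyMeasurable C' (ae_of_all _ hb')
  have e1 := hU.hasLaw.integral_comp i1.aestronglyMeasurable
  have e2 := hU.hasLaw.integral_comp i2.aestronglyMeasurable
  rw [← e1, ← e2]
  rw [integral_prod _ (hU.integrable_comp_of_integrable i1),
    integral_prod _ (hU.integrable_comp_of_integrable i2)]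
  refine integral_congr_ae (ae_of_all _ fun g => ?_)
  simp only [Function.comp_apply, Function.update_self]
  exact integral_mul_gaussianReal (hF g) (fun y => hb _) (fun y => hb' _)

end Pi

/-! ### Gibbs averages over a finite set -/

section Gibbs

variable {ι κ : Type*} [Fintype κ]

/-- The linear combinations `∑ k, a i k * g k`, for all `i`. -/
def linField (a : ι → κ → ℝ) (g : κ → ℝ) (i : ι) : ℝ := ∑ k, a i k * g k

theorem continuous_linField (a : ι → κ → ℝ) : Continuous (linField a) := by
  unfold linField; fun_prop

theorem integrable_linField (a : ι → κ → ℝ) (i : ι) :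
    Integrable (fun g => linField a g i) (stdNormal κ) :=
  integrable_finsetSum _ fun k _ => (integrable_eval_stdNormal k).const_mul _

variable [Fintype ι]

/-- The partition function of the energies `x` with a priori weights `w`. -/
def expSum (w x : ι → ℝ) : ℝ := ∑ i, w i * Real.exp (x i)

/-- The Gibbs weights of the energies `x` with a priori weights `w`. -/
def gibbs (w x : ι → ℝ) (i : ι) : ℝ := w i * Real.exp (x i) / expSum w x

/-- The expectation of the logarithm of the partition function, for the centered Gaussian
energies with covariance `a aᵀ`. -/
def logZ (w : ι → ℝ) (a : ι → κ → ℝ) : ℝ :=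
  ∫ g, Real.log (expSum w (linField a g)) ∂(stdNormal κ)

/-- Admissible a priori weights: nonnegative, not all zero. -/
def IsWeight (w : ι → ℝ) : Prop := (∀ i, 0 ≤ w i) ∧ 0 < ∑ i, w i

theorem expSum_pos {w : ι → ℝ} (hw : IsWeight w) (x : ι → ℝ) : 0 < expSum w x := by
  obtain ⟨i, hi, hpos⟩ := Finset.exists_lt_of_sum_lt (s := Finset.univ) (f := fun _ => (0 : ℝ))
    (g := w) (by simpa using hw.2)
  exact Finset.sum_pos' (fun i _ => mul_nonneg (hw.1 i) (Real.exp_pos _).le)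
    ⟨i, hi, mul_pos hpos (Real.exp_pos _)⟩

theorem gibbs_nonneg {w : ι → ℝ} (hw : IsWeight w) (x : ι → ℝ) (i : ι) : 0 ≤ gibbs w x i :=
  div_nonneg (mul_nonneg (hw.1 i) (Real.exp_pos _).le) (expSum_pos hw x).le

theorem sum_gibbs {w : ι → ℝ} (hw : IsWeight w) (x : ι → ℝ) : ∑ i, gibbs w x i = 1 := by
  simp only [gibbs, ← Finset.sum_div]
  exact div_self (expSum_pos hw x).ne'

theorem gibbs_le_one {w : ι → ℝ} (hw : IsWeight w) (x : ι → ℝ) (i : ι) : gibbs w x i ≤ 1 := by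
  rw [← sum_gibbs hw x]
  exact Finset.single_le_sum (fun j _ => gibbs_nonneg hw x j) (Finset.mem_univ i)

/-- A Gibbs average is bounded by the supremum. -/
theorem abs_sum_gibbs_mul_le {w : ι → ℝ} (hw : IsWeight w) (x : ι → ℝ) {v : ι → ℝ} {C : ℝ}
    (hv : ∀ i, |v i| ≤ C) : |∑ i, gibbs w x i * v i| ≤ C := by
  calc |∑ i, gibbs w x i * v i| ≤ ∑ i, gibbs w x i * C := by
        refine (Finset.abs_sum_le_sum_abs _ _).trans (Finset.sum_le_sum fun i _ => ?_)
        rw [abs_mul, abs_of_nonneg (gibbs_nonneg hw x i)]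
        exact mul_le_mul_of_nonneg_left (hv i) (gibbs_nonneg hw x i)
    _ = C := by rw [← Finset.sum_mul, sum_gibbs hw, one_mul]

theorem hasDerivAt_expSum (w : ι → ℝ) {u : ℝ → ι → ℝ} {v : ι → ℝ} {y : ℝ}
    (hu : ∀ i, HasDerivAt (fun y => u y i) (v i) y) :
    HasDerivAt (fun y => expSum w (u y)) (∑ i, w i * Real.exp (u y i) * v i) y := by
  have := HasDerivAt.fun_sum (u := Finset.univ) fun i _ => ((hu i).exp).const_mul (w i)
  simpa only [expSum, mul_assoc] using this

theorem hasDerivAt_log_expSum {w : ι → ℝ} (hw : IsWeight w) {u : ℝ → ι → ℝ} {v : ι → ℝ} {y : ℝ}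
    (hu : ∀ i, HasDerivAt (fun y => u y i) (v i) y) :
    HasDerivAt (fun y => Real.log (expSum w (u y))) (∑ i, gibbs w (u y) i * v i) y := by
  have := (hasDerivAt_expSum w hu).log (expSum_pos hw _).ne'
  convert! this using 1
  simp only [gibbs, Finset.sum_div]
  exact Finset.sum_congr rfl fun i _ => by ring

theorem hasDerivAt_gibbs {w : ι → ℝ} (hw : IsWeight w) {u : ℝ → ι → ℝ} {v : ι → ℝ} {y : ℝ}
    (hu : ∀ i, HasDerivAt (fun y => u y i) (v i) y) (i : ι) :
    HasDerivAt (fun y => gibbs w (u y) i)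
      (gibbs w (u y) i * (v i - ∑ j, gibbs w (u y) j * v j)) y := by
  have hZ := (expSum_pos hw (u y)).ne'
  have := (((hu i).exp).const_mul (w i)).div (hasDerivAt_expSum w hu) hZ
  convert! this using 1
  have e : ∑ j, gibbs w (u y) j * v j
      = (∑ j, w j * Real.exp (u y j) * v j) / expSum w (u y) := by
    simp only [gibbs, Finset.sum_div]
    exact Finset.sum_congr rfl fun i _ => by ring
  rw [e, gibbs]
  field_simp

theorem continuous_expSum (w : ι → ℝ) : Continuous (expSum w) := by
  unfold expSum; fun_prop

theorem continuous_gibbs {w : ι → ℝ} (hw : IsWeight w) (i : ι) :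
    Continuous fun x => gibbs w x i := by
  have := continuous_expSum w
  exact Continuous.div (by fun_prop) this fun x => (expSum_pos hw x).ne'

theorem continuous_log_expSum {w : ι → ℝ} (hw : IsWeight w) :
    Continuous fun x => Real.log (expSum w x) :=
  (continuous_expSum w).log fun x => (expSum_pos hw x).ne'

theorem abs_log_expSum_le {w : ι → ℝ} (hw : IsWeight w) (x : ι → ℝ) :
    |Real.log (expSum w x)| ≤ |Real.log (∑ i, w i)| + ∑ i, |x i| := by
  set S := ∑ i, |x i|
  have hx : ∀ i, |x i| ≤ S := fun i =>
    Finset.single_le_sum (f := fun i => |x i|) (fun j _ => abs_nonneg _) (Finset.mem_univ i)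
  have h1 : expSum w x ≤ (∑ i, w i) * Real.exp S := by
    rw [expSum, Finset.sum_mul]
    exact Finset.sum_le_sum fun i _ => mul_le_mul_of_nonneg_left
      (Real.exp_le_exp.2 ((le_abs_self _).trans (hx i))) (hw.1 i)
  have h2 : (∑ i, w i) * Real.exp (-S) ≤ expSum w x := by
    rw [expSum, Finset.sum_mul]
    exact Finset.sum_le_sum fun i _ => mul_le_mul_of_nonneg_left
      (Real.exp_le_exp.2 (by linarith [neg_abs_le (x i), hx i])) (hw.1 i)
  have h1' := Real.log_le_log (expSum_pos hw x) h1
  have h2' := Real.log_le_log (mul_pos hw.2 (Real.exp_pos _)) h2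
  rw [Real.log_mul hw.2.ne' (Real.exp_pos _).ne', Real.log_exp] at h1' h2'
  rw [abs_le]
  constructor
  · linarith [neg_abs_le (Real.log (∑ i, w i))]
  · linarith [le_abs_self (Real.log (∑ i, w i))]

theorem integrable_log_expSum {w : ι → ℝ} (hw : IsWeight w) (a : ι → κ → ℝ) :
    Integrable (fun g => Real.log (expSum w (linField a g))) (stdNormal κ) := by
  refine Integrable.mono' (g := fun g => |Real.log (∑ i, w i)| + ∑ i, |linField a g i|)
    ((integrable_const _).add (integrable_finsetSum _ fun i _ => (integrable_linField a i).abs))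
    ((continuous_log_expSum hw).comp (continuous_linField a)).aestronglyMeasurable
    (ae_of_all _ fun g => abs_log_expSum_le hw _)

/-- Gaussian integration by parts against a Gibbs weight. -/
theorem integral_eval_mul_gibbs {w : ι → ℝ} (hw : IsWeight w) (a : ι → κ → ℝ) (i : ι) (k : κ) :
    ∫ g, g k * gibbs w (linField a g) i ∂(stdNormal κ)
      = ∫ g, gibbs w (linField a g) i *
          (a i k - ∑ j, gibbs w (linField a g) j * a j k) ∂(stdNormal κ) := by
  classical
  have hc := continuous_linField a
  have hg : ∀ i, Continuous fun g => gibbs w (linField a g) i := fun i =>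
    (continuous_gibbs hw i).comp hc
  have hM : ∀ j, |a j k| ≤ ∑ j, |a j k| := fun j =>
    Finset.single_le_sum (f := fun j => |a j k|) (fun j _ => abs_nonneg _) (Finset.mem_univ j)
  have hp : ∀ g, |gibbs w (linField a g) i| ≤ 1 := fun g => by
    rw [abs_of_nonneg (gibbs_nonneg hw _ _)]
    exact gibbs_le_one hw _ _
  refine integral_eval_mul_stdNormal k (C := 1) (C' := 2 * ∑ j, |a j k|)
    (F' := fun g => gibbs w (linField a g) i *
      (a i k - ∑ j, gibbs w (linField a g) j * a j k)) ?_ (hg i).measurable ?_ hp ?_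
  · intro g y
    refine hasDerivAt_gibbs hw (u := fun y => linField a (Function.update g k y))
      (v := fun i => a i k) (fun i => ?_) i
    have : ∀ y, linField a (Function.update g k y) i
        = a i k * y + ∑ l ∈ Finset.univ.erase k, a i l * g l := by
      intro y
      rw [linField, ← Finset.add_sum_erase _ _ (Finset.mem_univ k), Function.update_self]
      congr 1
      exact Finset.sum_congr rfl fun l hl => by
        rw [Function.update_of_ne (Finset.ne_of_mem_erase hl)]
    simp only [this]
    simpa using ((hasDerivAt_id y).const_mul (a i k)).add_const
      (∑ l ∈ Finset.univ.erase k, a i l * g l)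
  · exact Continuous.measurable (by fun_prop)
  · intro g
    rw [abs_mul]
    have h1 := abs_sum_gibbs_mul_le hw (linField a g) hM
    have h2 : |a i k - ∑ j, gibbs w (linField a g) j * a j k| ≤ 2 * ∑ j, |a j k| := by
      have := hM i
      have := abs_sub (a i k) (∑ j, gibbs w (linField a g) j * a j k)
      linarith
    calc _ ≤ 1 * (2 * ∑ j, |a j k|) := mul_le_mul (hp g) h2 (abs_nonneg _) zero_le_one
      _ = _ := one_mul _

end Gibbs

/-! ### Gaussian interpolation -/

section Interpolation

variable {ι κ : Type*}

/-- The interpolating coefficients `√(1 - t) a + √t b`. -/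
def interpCoeff (a b : ι → κ → ℝ) (t : ℝ) (i : ι) (k : κ) : ℝ := √(1 - t) * a i k + √t * b i k

@[simp]
theorem interpCoeff_zero (a b : ι → κ → ℝ) : interpCoeff a b 0 = a := by
  ext i k; simp [interpCoeff]

@[simp]
theorem interpCoeff_one (a b : ι → κ → ℝ) : interpCoeff a b 1 = b := by
  ext i k; simp [interpCoeff]

variable [Fintype κ]

/-- The covariance `a aᵀ` of the Gaussian field with coefficients `a`. -/
def cov (a : ι → κ → ℝ) (i j : ι) : ℝ := ∑ k, a i k * a j k

/-- The difference `b bᵀ - a aᵀ` of the covariances of two linear Gaussian fields. -/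
def covDiff (a b : ι → κ → ℝ) (i j : ι) : ℝ := cov b i j - cov a i j

theorem continuous_linField_interpCoeff (a b : ι → κ → ℝ) :
    Continuous fun p : ℝ × (κ → ℝ) => linField (interpCoeff a b p.1) p.2 := by
  unfold linField interpCoeff
  fun_prop

variable [Fintype ι]

/-- The two-replica average that governs the derivative of the free energy along a Gaussian
interpolation; `D` is the difference of the covariances at the two ends. -/
def replicaForm (w x : ι → ℝ) (D : ι → ι → ℝ) : ℝ :=
  ∑ i, gibbs w x i * (D i i - ∑ j, gibbs w x j * D i j)

theorem abs_replicaForm_le {w : ι → ℝ} (hw : IsWeight w) (x : ι → ℝ) {D : ι → ι → ℝ} {C : ℝ}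
    (hD : ∀ i j, |D i j| ≤ C) : |replicaForm w x D| ≤ 2 * C := by
  refine abs_sum_gibbs_mul_le hw x fun i => ?_
  have h1 := abs_sum_gibbs_mul_le hw x (hD i)
  have h2 := hD i i
  have := abs_sub (D i i) (∑ j, gibbs w x j * D i j)
  linarith

theorem continuous_replicaForm {w : ι → ℝ} (hw : IsWeight w) (D : ι → ι → ℝ) :
    Continuous fun x => replicaForm w x D := by
  have := continuous_gibbs hw
  unfold replicaForm
  fun_prop

/-- The derivative in time of the free energy along the interpolation between two independent
Gaussian fields. -/
theorem hasDerivAt_logZ_interpCoeff {w : ι → ℝ} (hw : IsWeight w) {a b : ι → κ → ℝ}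
    (horth : ∀ i j, ∑ k, a i k * b j k = 0) {t : ℝ} (ht : t ∈ Set.Ioo (0 : ℝ) 1) :
    HasDerivAt (fun t => logZ w (interpCoeff a b t))
      (1 / 2 * ∫ g, replicaForm w (linField (interpCoeff a b t) g) (covDiff a b) ∂(stdNormal κ))
      t := by
  obtain ⟨h0, h1⟩ := ht
  -- the derivative of the coefficients
  set c : ℝ → ι → κ → ℝ := fun t i k => -(1 / (2 * √(1 - t))) * a i k + 1 / (2 * √t) * b i k
    with hc
  have hderiv : ∀ x ∈ Set.Ioo (0 : ℝ) 1, ∀ i k,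
      HasDerivAt (fun t => interpCoeff a b t i k) (c x i k) x := by
    intro x hx i k
    have d1 : HasDerivAt (fun t : ℝ => √(1 - t)) (-(1 / (2 * √(1 - x)))) x := by
      have := ((hasDerivAt_id x).const_sub 1).sqrt (by simp; linarith [hx.2])
      simpa [neg_div] using this
    have d2 := Real.hasDerivAt_sqrt hx.1.ne'
    exact (d1.mul_const _).add (d2.mul_const _)
  have hlin : ∀ x ∈ Set.Ioo (0 : ℝ) 1, ∀ g i,
      HasDerivAt (fun t => linField (interpCoeff a b t) g i) (linField (c x) g i) x := by
    intro x hx g i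
    exact HasDerivAt.fun_sum fun k _ => (hderiv x hx i k).mul_const _
  have hcc : ∀ t, Continuous fun g => linField (interpCoeff a b t) g := fun t =>
    continuous_linField _
  have hg : ∀ t i, Continuous fun g => gibbs w (linField (interpCoeff a b t) g) i := fun t i =>
    (continuous_gibbs hw i).comp (hcc t)
  -- a neighbourhood of `t` on which the derivative is dominated
  set s := Set.Ioo (t / 2) ((1 + t) / 2) with hs
  have hst : s ∈ 𝓝 t := Ioo_mem_nhds (by linarith) (by linarith)
  have hs01 : ∀ x ∈ s, x ∈ Set.Ioo (0 : ℝ) 1 := fun x hx =>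
    ⟨by linarith [hx.1], by linarith [hx.2]⟩
  set M := 1 / (2 * √((1 - t) / 2)) with hM
  set M' := 1 / (2 * √(t / 2)) with hM'
  have hcM : ∀ x ∈ s, ∀ i k, |c x i k| ≤ M * |a i k| + M' * |b i k| := by
    intro x hx i k
    have p1 : 0 < √((1 - t) / 2) := Real.sqrt_pos.2 (by linarith)
    have p2 : 0 < √(t / 2) := Real.sqrt_pos.2 (by linarith)
    have q1 : √((1 - t) / 2) ≤ √(1 - x) := Real.sqrt_le_sqrt (by linarith [hx.2])
    have q2 : √(t / 2) ≤ √x := Real.sqrt_le_sqrt (by linarith [hx.1])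
    refine (abs_add_le _ _).trans ?_
    rw [abs_mul, abs_mul, abs_neg, abs_of_nonneg (by positivity : 0 ≤ 1 / (2 * √(1 - x))),
      abs_of_nonneg (by positivity : 0 ≤ 1 / (2 * √x)), hM, hM']
    gcongr
  have key := hasDerivAt_integral_of_dominated_loc_of_deriv_le (μ := stdNormal κ)
    (F := fun t g => Real.log (expSum w (linField (interpCoeff a b t) g)))
    (F' := fun t g => ∑ i, gibbs w (linField (interpCoeff a b t) g) i * linField (c t) g i)
    (bound := fun g => ∑ i, ∑ k, (M * |a i k| + M' * |b i k|) * |g k|)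
    hst
    (Eventually.of_forall fun t => (integrable_log_expSum hw _).aestronglyMeasurable)
    (integrable_log_expSum hw _)
    (by
      refine Continuous.aestronglyMeasurable ?_
      have := continuous_linField (c t)
      have := hg t
      fun_prop)
    (by
      refine ae_of_all _ fun g x hx => ?_
      refine (Finset.abs_sum_le_sum_abs _ _).trans (Finset.sum_le_sum fun i _ => ?_)
      rw [abs_mul, abs_of_nonneg (gibbs_nonneg hw _ _)]
      refine (mul_le_of_le_one_left (abs_nonneg _) (gibbs_le_one hw _ _)).trans ?_
      refine (Finset.abs_sum_le_sum_abs _ _).trans (Finset.sum_le_sum fun k _ => ?_)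
      rw [abs_mul]
      exact mul_le_mul_of_nonneg_right (hcM x hx i k) (abs_nonneg _))
    (integrable_finsetSum _ fun i _ => integrable_finsetSum _ fun k _ =>
      (integrable_eval_stdNormal k).abs.const_mul _)
    (ae_of_all _ fun g x hx => hasDerivAt_log_expSum hw fun i => hlin x (hs01 x hx) g i)
  refine key.2.congr_deriv ?_
  -- integrate by parts
  have hint : ∀ i k, Integrable (fun g : κ → ℝ =>
      g k * gibbs w (linField (interpCoeff a b t) g) i) (stdNormal κ) := fun i k =>
    (integrable_eval_stdNormal k).mul_bdd (c := 1) (hg t i).aestronglyMeasurable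
      (ae_of_all _ fun g => by
        rw [Real.norm_eq_abs, abs_of_nonneg (gibbs_nonneg hw _ _)]
        exact gibbs_le_one hw _ _)
  have hbd : ∀ (i : ι) (v : ι → ℝ), Integrable (fun g : κ → ℝ =>
      gibbs w (linField (interpCoeff a b t) g) i *
        (v i - ∑ j, gibbs w (linField (interpCoeff a b t) g) j * v j)) (stdNormal κ) := by
    intro i v
    refine Integrable.of_bound (C := 2 * ∑ j, |v j|) (Continuous.aestronglyMeasurable ?_)
      (ae_of_all _ fun g => ?_)
    · have := hg t
      fun_prop
    · have hM : ∀ j, |v j| ≤ ∑ j, |v j| := fun j =>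
        Finset.single_le_sum (f := fun j => |v j|) (fun j _ => abs_nonneg _) (Finset.mem_univ j)
      rw [Real.norm_eq_abs, abs_mul, abs_of_nonneg (gibbs_nonneg hw _ _)]
      refine (mul_le_of_le_one_left (abs_nonneg _) (gibbs_le_one hw _ _)).trans ?_
      have h1 := abs_sum_gibbs_mul_le hw (linField (interpCoeff a b t) g) hM
      have := abs_sub (v i) (∑ j, gibbs w (linField (interpCoeff a b t) g) j * v j)
      linarith [hM i]
  have hcov : ∀ i j, ∑ k, c t i k * interpCoeff a b t j k = 1 / 2 * covDiff a b i j := by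
    intro i j
    have p1 : √(1 - t) ≠ 0 := (Real.sqrt_pos.2 (by linarith)).ne'
    have p2 : √t ≠ 0 := (Real.sqrt_pos.2 h0).ne'
    have e : ∀ k, c t i k * interpCoeff a b t j k
        = 1 / 2 * (b i k * b j k) - 1 / 2 * (a i k * a j k)
          - √t / (2 * √(1 - t)) * (a i k * b j k) + √(1 - t) / (2 * √t) * (a j k * b i k) := by
      intro k
      simp only [hc, interpCoeff]
      field_simp
      ring
    simp only [e, Finset.sum_add_distrib, Finset.sum_sub_distrib, ← Finset.mul_sum, horth,
      covDiff, cov]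
    ring
  calc ∫ g, ∑ i, gibbs w (linField (interpCoeff a b t) g) i * linField (c t) g i ∂(stdNormal κ)
      = ∑ i, ∑ k, c t i k *
          ∫ g, g k * gibbs w (linField (interpCoeff a b t) g) i ∂(stdNormal κ) := by
        have e : ∀ g : κ → ℝ,
            ∑ i, gibbs w (linField (interpCoeff a b t) g) i * linField (c t) g i
            = ∑ i, ∑ k, c t i k * (g k * gibbs w (linField (interpCoeff a b t) g) i) := by
          intro g
          refine Finset.sum_congr rfl fun i _ => ?_
          rw [linField, Finset.mul_sum]
          exact Finset.sum_congr rfl fun k _ => by ring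
        simp only [e]
        rw [integral_finsetSum _ fun i _ => integrable_finsetSum _ fun k _ =>
          (hint i k).const_mul _]
        refine Finset.sum_congr rfl fun i _ => ?_
        rw [integral_finsetSum _ fun k _ => (hint i k).const_mul _]
        simp only [integral_const_mul]
    _ = ∑ i, ∑ k, ∫ g, c t i k * (gibbs w (linField (interpCoeff a b t) g) i *
          (interpCoeff a b t i k - ∑ j, gibbs w (linField (interpCoeff a b t) g) j *
            interpCoeff a b t j k)) ∂(stdNormal κ) := by
        simp only [integral_eval_mul_gibbs hw, integral_const_mul]
    _ = ∫ g, 1 / 2 * replicaForm w (linField (interpCoeff a b t) g) (covDiff a b)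
          ∂(stdNormal κ) := by
        have hI : ∀ i k, Integrable (fun g : κ → ℝ => c t i k *
            (gibbs w (linField (interpCoeff a b t) g) i *
            (interpCoeff a b t i k - ∑ j, gibbs w (linField (interpCoeff a b t) g) j *
            interpCoeff a b t j k))) (stdNormal κ) := fun i k =>
          (hbd i fun j => interpCoeff a b t j k).const_mul _
        simp only [← integral_finsetSum _ fun k _ => hI _ k]
        rw [← integral_finsetSum _ fun i _ => integrable_finsetSum _ fun k _ => hI i k]
        refine integral_congr_ae (ae_of_all _ fun g => ?_)
        simp only [replicaForm]
        rw [Finset.mul_sum]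
        refine Finset.sum_congr rfl fun i _ => ?_
        generalize gibbs w (linField (interpCoeff a b t) g) = p
        calc ∑ k, c t i k * (p i * (interpCoeff a b t i k - ∑ j, p j * interpCoeff a b t j k))
            = p i * (∑ k, c t i k * interpCoeff a b t i k
                - ∑ j, p j * ∑ k, c t i k * interpCoeff a b t j k) := by
              simp only [Finset.mul_sum, mul_sub, Finset.sum_sub_distrib]
              rw [Finset.sum_comm (s := Finset.univ (α := κ))]
              congr 1
              · exact Finset.sum_congr rfl fun k _ => by ring
              · exact Finset.sum_congr rfl fun j _ => Finset.sum_congr rfl fun k _ => by ring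
          _ = 1 / 2 * (p i * (covDiff a b i i - ∑ j, p j * covDiff a b i j)) := by
              simp only [hcov]
              have : ∑ j, p j * (1 / 2 * covDiff a b i j) = 1 / 2 * ∑ j, p j * covDiff a b i j := by
                rw [Finset.mul_sum]
                exact Finset.sum_congr rfl fun j _ => by ring
              rw [this]
              ring
    _ = _ := by rw [integral_const_mul]

theorem continuousOn_logZ_interpCoeff {w : ι → ℝ} (hw : IsWeight w) (a b : ι → κ → ℝ) :
    ContinuousOn (fun t => logZ w (interpCoeff a b t)) (Set.Icc 0 1) := by
  have hc := (continuous_log_expSum hw).comp (continuous_linField_interpCoeff a b)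
  refine continuousOn_of_dominated (bound := fun g => |Real.log (∑ i, w i)| +
    ∑ i, ∑ k, (|a i k| + |b i k|) * |g k|) (fun t _ =>
      (integrable_log_expSum hw _).aestronglyMeasurable) ?_ ?_ ?_
  · refine fun t ht => ae_of_all _ fun g => (abs_log_expSum_le hw _).trans ?_
    gcongr with i
    refine (Finset.abs_sum_le_sum_abs _ _).trans (Finset.sum_le_sum fun k _ => ?_)
    rw [abs_mul]
    refine mul_le_mul_of_nonneg_right ((abs_add_le _ _).trans ?_) (abs_nonneg _)
    rw [abs_mul, abs_mul, abs_of_nonneg (Real.sqrt_nonneg _), abs_of_nonneg (Real.sqrt_nonneg _)]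
    have h1 : √(1 - t) ≤ 1 := Real.sqrt_le_one.2 (by linarith [ht.1])
    have h2 : √t ≤ 1 := Real.sqrt_le_one.2 ht.2
    exact add_le_add (mul_le_of_le_one_left (abs_nonneg _) h1)
      (mul_le_of_le_one_left (abs_nonneg _) h2)
  · exact (integrable_const _).add (integrable_finsetSum _ fun i _ => integrable_finsetSum _
      fun k _ => (integrable_eval_stdNormal k).abs.const_mul _)
  · exact ae_of_all _ fun g =>
      (hc.comp (by fun_prop : Continuous fun t : ℝ => (t, g))).continuousOn

/-- The interpolation formula for the free energies of two independent Gaussian fields. -/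
theorem logZ_sub_logZ {w : ι → ℝ} (hw : IsWeight w) {a b : ι → κ → ℝ}
    (horth : ∀ i j, ∑ k, a i k * b j k = 0) :
    logZ w b - logZ w a = 1 / 2 * ∫ t in (0 : ℝ)..1,
      ∫ g, replicaForm w (linField (interpCoeff a b t) g) (covDiff a b) ∂(stdNormal κ) := by
  set C := ∑ i, ∑ j, |covDiff a b i j| with hC
  have hD : ∀ i j, |covDiff a b i j| ≤ C := fun i j =>
    (Finset.single_le_sum (f := fun j => |covDiff a b i j|) (fun j _ => abs_nonneg _)
      (Finset.mem_univ j)).trans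
    (Finset.single_le_sum (f := fun i => ∑ j, |covDiff a b i j|)
      (fun j _ => Finset.sum_nonneg fun _ _ => abs_nonneg _) (Finset.mem_univ i))
  have hcont := (continuous_replicaForm hw (covDiff a b)).comp
    (continuous_linField_interpCoeff a b)
  have hmeas : StronglyMeasurable fun t : ℝ =>
      ∫ g, replicaForm w (linField (interpCoeff a b t) g) (covDiff a b) ∂(stdNormal κ) :=
    hcont.stronglyMeasurable.integral_prod_right'
  have hint : IntervalIntegrable (fun t : ℝ =>
      ∫ g, replicaForm w (linField (interpCoeff a b t) g) (covDiff a b) ∂(stdNormal κ))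
      volume 0 1 := by
    refine (intervalIntegrable_const (c := 2 * C)).mono_fun' hmeas.aestronglyMeasurable
      (ae_of_all _ fun t => ?_)
    refine (norm_integral_le_of_norm_le_const
      (ae_of_all _ fun g => abs_replicaForm_le hw _ hD)).trans ?_
    simp
  have := intervalIntegral.integral_eq_sub_of_hasDerivAt_of_le zero_le_one
    (continuousOn_logZ_interpCoeff hw a b) (fun t ht => hasDerivAt_logZ_interpCoeff hw horth ht)
    (hint.const_mul _)
  rw [intervalIntegral.integral_const_mul] at this
  rw [this, interpCoeff_zero, interpCoeff_one]

end Interpolation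

/-! ### Realizations of standard normal families -/

section Realization

variable {ι κ κ' Ω Ω' : Type*} [Fintype κ] [Fintype κ']
  [MeasurableSpace Ω] [MeasurableSpace Ω'] {P : Measure Ω} {Q : Measure Ω'}

theorem measurePreserving_sumElim [SFinite P] [SFinite Q] {g : Ω → κ → ℝ} {g' : Ω' → κ' → ℝ}
    (h : MeasurePreserving g P (stdNormal κ)) (h' : MeasurePreserving g' Q (stdNormal κ')) :
    MeasurePreserving (fun p : Ω × Ω' => (Sum.elim (g p.1) (g' p.2) : κ ⊕ κ' → ℝ)) (P.prod Q)
      (stdNormal (κ ⊕ κ')) := by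
  refine ⟨?_, ?_⟩
  · refine measurable_pi_lambda _ fun k => ?_
    rcases k with k | k
    · exact ((measurable_pi_apply k).comp h.measurable).comp measurable_fst
    · exact ((measurable_pi_apply k).comp h'.measurable).comp measurable_snd
  · symm
    refine Measure.pi_eq fun s hs => ?_
    rw [Measure.map_apply _ (MeasurableSet.univ_pi hs)]
    · have : (fun p : Ω × Ω' => (Sum.elim (g p.1) (g' p.2) : κ ⊕ κ' → ℝ)) ⁻¹' Set.univ.pi s
          = (g ⁻¹' Set.univ.pi fun k => s (Sum.inl k)) ×ˢ
            (g' ⁻¹' Set.univ.pi fun k => s (Sum.inr k)) := by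
        ext p
        simp [Set.mem_pi]
      rw [this, Measure.prod_prod, h.measure_preimage (MeasurableSet.univ_pi fun _ =>
        hs _).nullMeasurableSet, h'.measure_preimage (MeasurableSet.univ_pi fun _ =>
        hs _).nullMeasurableSet, stdNormal, stdNormal, Measure.pi_pi, Measure.pi_pi,
        Fintype.prod_sum_type]
    · refine measurable_pi_lambda _ fun k => ?_
      rcases k with k | k
      · exact ((measurable_pi_apply k).comp h.measurable).comp measurable_fst
      · exact ((measurable_pi_apply k).comp h'.measurable).comp measurable_snd

theorem measurePreserving_uncurry [SigmaFinite P] [Fintype ι] {g : Ω → κ → ℝ}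
    (h : MeasurePreserving g P (stdNormal κ)) :
    MeasurePreserving (fun (ω : ι → Ω) (p : ι × κ) => g (ω p.1) p.2) (Measure.pi fun _ => P)
      (stdNormal (ι × κ)) := by
  have hm : Measurable (fun (ω : ι → Ω) (p : ι × κ) => g (ω p.1) p.2) :=
    measurable_pi_lambda _ fun p =>
      ((measurable_pi_apply p.2).comp h.measurable).comp (measurable_pi_apply p.1)
  refine ⟨hm, ?_⟩
  symm
  refine Measure.pi_eq fun s hs => ?_
  rw [Measure.map_apply hm (MeasurableSet.univ_pi hs)]
  have : (fun (ω : ι → Ω) (p : ι × κ) => g (ω p.1) p.2) ⁻¹' Set.univ.pi s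
      = Set.univ.pi fun i => g ⁻¹' Set.univ.pi fun k => s (i, k) := by
    ext p
    simp [Set.mem_pi]
  rw [this, Measure.pi_pi, Fintype.prod_prod_type]
  refine Finset.prod_congr rfl fun i _ => ?_
  rw [h.measure_preimage (MeasurableSet.univ_pi fun _ => hs _).nullMeasurableSet, stdNormal,
    Measure.pi_pi]

/-- The first `n` terms of a sequence of independent standard normal variables. -/
theorem measurePreserving_stdNormalSeq (n : ℕ) :
    MeasurePreserving (fun (g : ℕ → ℝ) (k : Fin n) => g k) stdNormalSeq (stdNormal (Fin n)) := by
  have hm : Measurable (fun (g : ℕ → ℝ) (k : Fin n) => g k) :=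
    measurable_pi_lambda _ fun k => measurable_pi_apply _
  refine ⟨hm, ?_⟩
  symm
  refine Measure.pi_eq fun s hs => ?_
  rw [Measure.map_apply hm (MeasurableSet.univ_pi hs)]
  set t : ℕ → Set ℝ := fun k => if h : k < n then s ⟨k, h⟩ else Set.univ with ht
  have : (fun (g : ℕ → ℝ) (k : Fin n) => g k) ⁻¹' Set.univ.pi s
      = Set.pi (Finset.range n) t := by
    ext g
    simp only [Set.mem_preimage, Set.mem_pi, Set.mem_univ, forall_const, Finset.coe_range,
      Set.mem_Iio, ht]
    constructor
    · intro h k hk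
      simpa [hk] using h ⟨k, hk⟩
    · intro h k
      simpa using h k k.2
  rw [this, stdNormalSeq, Measure.infinitePi_pi, Finset.prod_range]
  · simp [ht]
  · intro k hk
    simp only [ht, Finset.mem_range.1 hk, dif_pos]
    exact hs _

theorem integral_log_expSum [Fintype ι] {w : ι → ℝ} (hw : IsWeight w) (a : ι → κ → ℝ)
    {g : Ω → κ → ℝ} (h : MeasurePreserving g P (stdNormal κ)) :
    ∫ ω, Real.log (expSum w (linField a (g ω))) ∂P = logZ w a :=
  h.hasLaw.integral_comp
    ((continuous_log_expSum hw).comp (continuous_linField a)).aestronglyMeasurable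

theorem measurePreserving_comp_inl :
    MeasurePreserving (fun (g : κ ⊕ κ' → ℝ) k => g (Sum.inl k)) (stdNormal (κ ⊕ κ'))
      (stdNormal κ) := by
  have h := measurePreserving_sumElim (MeasurePreserving.id (stdNormal κ))
    (MeasurePreserving.id (stdNormal κ'))
  refine ⟨measurable_pi_lambda _ fun k => measurable_pi_apply _, ?_⟩
  rw [← h.map_eq, Measure.map_map (measurable_pi_lambda _ fun k => measurable_pi_apply _)
    h.measurable]
  exact (measurePreserving_fst (μ := stdNormal κ) (ν := stdNormal κ')).map_eq

theorem measurePreserving_comp_inr :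
    MeasurePreserving (fun (g : κ ⊕ κ' → ℝ) k => g (Sum.inr k)) (stdNormal (κ ⊕ κ'))
      (stdNormal κ') := by
  have h := measurePreserving_sumElim (MeasurePreserving.id (stdNormal κ))
    (MeasurePreserving.id (stdNormal κ'))
  refine ⟨measurable_pi_lambda _ fun k => measurable_pi_apply _, ?_⟩
  rw [← h.map_eq, Measure.map_map (measurable_pi_lambda _ fun k => measurable_pi_apply _)
    h.measurable]
  exact (measurePreserving_snd (μ := stdNormal κ) (ν := stdNormal κ')).map_eq

/-- Comparison of the free energies of two Gaussian fields through their covariances. -/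
theorem logZ_le_logZ_add [Fintype ι] {w : ι → ℝ} (hw : IsWeight w) {a : ι → κ → ℝ}
    {b : ι → κ' → ℝ} {C : ℝ}
    (h : ∀ i j, (cov b i i - cov a i i) - (cov b i j - cov a i j) ≤ C) :
    logZ w b ≤ logZ w a + C / 2 := by
  set a' : ι → κ ⊕ κ' → ℝ := fun i => Sum.elim (a i) 0 with ha'
  set b' : ι → κ ⊕ κ' → ℝ := fun i => Sum.elim 0 (b i) with hb'
  have ea : logZ w a' = logZ w a := by
    rw [← integral_log_expSum hw a (measurePreserving_comp_inl (κ' := κ')), logZ]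
    refine integral_congr_ae (ae_of_all _ fun g => ?_)
    simp only
    congr 2
    ext i
    simp [linField, ha']
  have eb : logZ w b' = logZ w b := by
    rw [← integral_log_expSum hw b (measurePreserving_comp_inr (κ := κ)), logZ]
    refine integral_congr_ae (ae_of_all _ fun g => ?_)
    simp only
    congr 2
    ext i
    simp [linField, hb']
  have hD : ∀ i j, covDiff a' b' i j = cov b i j - cov a i j := fun i j => by
    simp [covDiff, cov, ha', hb']
  have key := logZ_sub_logZ hw (a := a') (b := b') (fun i j => by simp [ha', hb'])
  have hle : ∀ x, replicaForm w x (covDiff a' b') ≤ C := by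
    intro x
    have e : ∀ i, covDiff a' b' i i - ∑ j, gibbs w x j * covDiff a' b' i j
        = ∑ j, gibbs w x j * (covDiff a' b' i i - covDiff a' b' i j) := fun i => by
      simp only [mul_sub, Finset.sum_sub_distrib, ← Finset.sum_mul, sum_gibbs hw, one_mul]
    have hav : ∀ v : ι → ℝ, (∀ i, v i ≤ C) → ∑ i, gibbs w x i * v i ≤ C := fun v hv => by
      calc ∑ i, gibbs w x i * v i ≤ ∑ i, gibbs w x i * C :=
            Finset.sum_le_sum fun i _ => mul_le_mul_of_nonneg_left (hv i) (gibbs_nonneg hw x i)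
        _ = C := by rw [← Finset.sum_mul, sum_gibbs hw, one_mul]
    refine hav _ fun i => ?_
    rw [e]
    refine hav _ fun j => ?_
    rw [hD, hD]
    exact h i j
  have hb : ∀ x, |replicaForm w x (covDiff a' b')| ≤
      2 * ∑ i, ∑ j, |covDiff a' b' i j| := fun x => abs_replicaForm_le hw x fun i j =>
    (Finset.single_le_sum (f := fun j => |covDiff a' b' i j|) (fun j _ => abs_nonneg _)
      (Finset.mem_univ j)).trans
    (Finset.single_le_sum (f := fun i => ∑ j, |covDiff a' b' i j|)
      (fun j _ => Finset.sum_nonneg fun _ _ => abs_nonneg _) (Finset.mem_univ i))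
  have hcont := (continuous_replicaForm hw (covDiff a' b')).comp
    (continuous_linField_interpCoeff a' b')
  have hI : ∀ t, ∫ g, replicaForm w (linField (interpCoeff a' b' t) g) (covDiff a' b')
      ∂(stdNormal (κ ⊕ κ')) ≤ C := fun t => by
    have hi : Integrable (fun g => replicaForm w (linField (interpCoeff a' b' t) g)
        (covDiff a' b')) (stdNormal (κ ⊕ κ')) :=
      Integrable.of_bound ((continuous_replicaForm hw (covDiff a' b')).comp
        (continuous_linField _)).aestronglyMeasurable _ (ae_of_all _ fun g => hb _)
    have := integral_mono hi (integrable_const C) fun g => hle _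
    simpa using this
  have hint : IntervalIntegrable (fun t : ℝ => ∫ g, replicaForm w
      (linField (interpCoeff a' b' t) g) (covDiff a' b') ∂(stdNormal (κ ⊕ κ'))) volume 0 1 := by
    refine (intervalIntegrable_const (c := 2 * ∑ i, ∑ j, |covDiff a' b' i j|)).mono_fun'
      hcont.stronglyMeasurable.integral_prod_right'.aestronglyMeasurable
      (ae_of_all _ fun t => ?_)
    refine (norm_integral_le_of_norm_le_const (ae_of_all _ fun g => hb _)).trans ?_
    simp
  have h2 := intervalIntegral.integral_mono_on zero_le_one hint
    (intervalIntegrable_const (c := C)) fun t _ => hI t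
  simp at h2
  rw [ea, eb] at key
  linarith

/-- The free energy of a Gaussian field depends on the covariance only. -/
theorem logZ_congr_cov [Fintype ι] {w : ι → ℝ} (hw : IsWeight w) {a : ι → κ → ℝ}
    {b : ι → κ' → ℝ} (h : ∀ i j, cov a i j = cov b i j) : logZ w a = logZ w b := by
  refine le_antisymm ?_ ?_
  · simpa using logZ_le_logZ_add hw (a := b) (b := a) (C := 0) fun i j => by simp [h]
  · simpa using logZ_le_logZ_add hw (a := a) (b := b) (C := 0) fun i j => by simp [h]

end Realization

/-! ### Measurability -/

theorem measurable_residual {X : Type*} [MeasurableSpace X] {C : ℕ → ℕ → X → ℝ}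
    (hC : ∀ i j, Measurable (C i j)) (k i j : ℕ) :
    Measurable fun x => residual (fun i j => C i j x) k i j := by
  induction k generalizing i j with
  | zero => exact hC i j
  | succ k ih =>
    simp only [residual]
    exact (ih i j).sub (((ih i k).mul (ih j k)).div (ih k k))

theorem measurable_gaussSeq {X : Type*} [MeasurableSpace X] {C : ℕ → ℕ → X → ℝ} {g : X → ℕ → ℝ}
    (hC : ∀ i j, Measurable (C i j)) (hg : Measurable g) (n : ℕ) :
    Measurable fun x => gaussSeq (fun i j => C i j x) (g x) n := by
  simp only [gaussSeq, gaussFactor]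
  refine Finset.measurable_sum _ fun k _ => ?_
  exact ((measurable_residual hC k n k).div (measurable_residual hC k k k).sqrt).mul
    ((measurable_pi_apply k).comp hg)

/-! ### The interpolating system for fixed weights and overlaps -/

/-- Sample points of the Gaussian variables attached to an overlap structure. -/
abbrev Noise (N : ℕ) : Type := (ℕ → ℝ) × (Fin N → ℕ → ℝ) × (Fin N × Fin N → ℝ)

/-- The joint law of the Gaussian variables. -/
def noise (N : ℕ) : Measure (Noise N) :=
  stdNormalSeq.prod ((Measure.pi fun _ => stdNormalSeq).prod (couplings N))

instance (N : ℕ) : IsProbabilityMeasure (couplings N) := by unfold couplings; infer_instance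

instance (N : ℕ) : IsProbabilityMeasure (noise N) := by unfold noise; infer_instance

variable {N : ℕ}

/-- The exponent of the interpolating system, for a fixed overlap matrix `q`. -/
def pathField (β h t : ℝ) (q : ℕ → ℕ → ℝ) (g : Noise N) (γ : ℕ × Spins N) : ℝ :=
  β * (√(1 - t) * (interaction g.2.2 γ.2 + √N * gaussSeq (fun n n' => q n n' ^ 2 / 2) g.1 γ.1)
    + √t * ∑ i, gaussSeq q (g.2.1 i) γ.1 * spin γ.2 i + h * magnetization γ.2)

/-- The unnormalized weights of the interpolating system, for fixed `ξ` and `q`. -/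
def pathWeight (β h t : ℝ) (ξ : ℕ → ℝ) (q : ℕ → ℕ → ℝ) (g : Noise N) (γ : ℕ × Spins N) : ℝ :=
  ξ γ.1 * Real.exp (pathField β h t q g γ)

/-- The partition function of the interpolating system, for fixed `ξ` and `q`. -/
def pathSum (β h t : ℝ) (ξ : ℕ → ℝ) (q : ℕ → ℕ → ℝ) (g : Noise N) : ℝ :=
  ∑' γ, pathWeight β h t ξ q g γ

/-- The two-replica average of `(q_{α,α'} - q_{σ,σ'}) ^ 2`, for fixed `ξ` and `q`. -/
def pathReplica (β h t : ℝ) (ξ : ℕ → ℝ) (q : ℕ → ℕ → ℝ) (g : Noise N) : ℝ :=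
  ∑' γ : ℕ × Spins N, ∑' γ' : ℕ × Spins N, (q γ.1 γ'.1 - overlap γ.2 γ'.2) ^ 2 *
    (pathWeight β h t ξ q g γ / pathSum β h t ξ q g *
      (pathWeight β h t ξ q g γ' / pathSum β h t ξ q g))

theorem measurable_pathField {X : Type*} [MeasurableSpace X] {β h : ℝ} {t : X → ℝ}
    {q : ℕ → ℕ → X → ℝ} {g : X → Noise N} (ht : Measurable t)
    (hq : ∀ i j, Measurable (q i j)) (hg : Measurable g) (γ : ℕ × Spins N) :
    Measurable fun x => pathField β h (t x) (fun i j => q i j x) (g x) γ := by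
  have h1 : Measurable fun x => gaussSeq (fun n n' => q n n' x ^ 2 / 2) (g x).1 γ.1 :=
    measurable_gaussSeq (C := fun i j x => q i j x ^ 2 / 2)
      (fun i j => ((hq i j).pow_const 2).div_const 2) hg.fst γ.1
  have h2 : ∀ i, Measurable fun x => gaussSeq (fun n n' => q n n' x) ((g x).2.1 i) γ.1 :=
    fun i => measurable_gaussSeq hq ((measurable_pi_apply i).comp hg.snd.fst) γ.1
  have h3 : Measurable fun x => interaction (g x).2.2 γ.2 := by
    unfold interaction
    refine (Finset.measurable_sum _ fun i _ => Finset.measurable_sum _ fun j _ => ?_).div_const _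
    exact (((measurable_pi_apply (i, j)).comp hg.snd.snd).mul_const _).mul_const _
  unfold pathField
  have h4 : Measurable fun x => ∑ i, gaussSeq (fun n n' => q n n' x) ((g x).2.1 i) γ.1 *
      spin γ.2 i := Finset.measurable_sum _ fun i _ => (h2 i).mul_const _
  exact ((((measurable_const.sub ht).sqrt.mul (h3.add (h1.const_mul _))).add
    (ht.sqrt.mul h4)).add_const _).const_mul _

section

variable {X : Type*} [MeasurableSpace X] {β h : ℝ} {t : X → ℝ} {ξ : ℕ → X → ℝ}
  {q : ℕ → ℕ → X → ℝ} {g : X → Noise N}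

theorem measurable_pathWeight (ht : Measurable t) (hξ : ∀ i, Measurable (ξ i))
    (hq : ∀ i j, Measurable (q i j)) (hg : Measurable g) (γ : ℕ × Spins N) :
    Measurable fun x => pathWeight β h (t x) (fun i => ξ i x) (fun i j => q i j x) (g x) γ :=
  (hξ γ.1).mul (measurable_pathField ht hq hg γ).exp

theorem measurable_pathSum (ht : Measurable t) (hξ : ∀ i, Measurable (ξ i))
    (hq : ∀ i j, Measurable (q i j)) (hg : Measurable g) :
    Measurable fun x => pathSum β h (t x) (fun i => ξ i x) (fun i j => q i j x) (g x) :=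
  Measurable.tsum fun γ => measurable_pathWeight ht hξ hq hg γ

theorem measurable_pathReplica (ht : Measurable t) (hξ : ∀ i, Measurable (ξ i))
    (hq : ∀ i j, Measurable (q i j)) (hg : Measurable g) :
    Measurable fun x => pathReplica β h (t x) (fun i => ξ i x) (fun i j => q i j x) (g x) := by
  refine Measurable.tsum fun γ => Measurable.tsum fun γ' => ?_
  have h1 := measurable_pathSum (β := β) (h := h) ht hξ hq hg
  exact (((hq _ _).sub_const _).pow_const 2).mul
    (((measurable_pathWeight ht hξ hq hg γ).div h1).mul
      ((measurable_pathWeight ht hξ hq hg γ').div h1))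

end

/-! ### Exponential moments -/

/-- Overlap matrices: positive semidefinite with unit diagonal. -/
def IsOverlapMatrix (q : ℕ → ℕ → ℝ) : Prop := (Matrix.of q).PosSemidef ∧ ∀ n, q n n = 1

/-- Summable nonnegative weights with positive total mass. -/
def IsSummableWeight (ξ : ℕ → ℝ) : Prop := (∀ n, 0 ≤ ξ n) ∧ Summable ξ ∧ 0 < ∑' n, ξ n

/-- A Gram matrix is positive semidefinite. -/
theorem posSemidef_of_gram {ι κ : Type*} {C : ι → ι → ℝ} (hsymm : ∀ i j, C i j = C j i)
    (h : ∀ s : Finset ι, ∃ (K : Finset κ) (v : κ → ι → ℝ), ∀ i ∈ s, ∀ j ∈ s,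
      C i j = ∑ k ∈ K, v k i * v k j) : (Matrix.of C).PosSemidef := by
  refine ⟨Matrix.IsHermitian.ext fun i j => by simp [hsymm i j], fun x => ?_⟩
  obtain ⟨K, v, hv⟩ := h x.support
  have : (x.sum fun i xi => x.sum fun j xj => star xi * Matrix.of C i j * xj)
      = ∑ k ∈ K, (∑ i ∈ x.support, x i * v k i) ^ 2 := by
    simp only [Finsupp.sum, pow_two, Finset.sum_mul_sum]
    rw [Finset.sum_comm]
    rw [Finset.sum_comm (s := K)]
    rw [Finset.sum_comm]
    refine Finset.sum_congr rfl fun i hi => ?_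
    rw [Finset.sum_comm (s := K)]
    refine Finset.sum_congr rfl fun j hj => ?_
    simp only [Matrix.of_apply, hv i hi j hj, star_trivial, Finset.mul_sum, Finset.sum_mul]
    exact Finset.sum_congr rfl fun k _ => by ring
  rw [this]
  exact Finset.sum_nonneg fun k _ => sq_nonneg _

theorem gaussFactor_eq_zero {C : ℕ → ℕ → ℝ} (hC : (Matrix.of C).PosSemidef) {n k : ℕ}
    (h : n < k) : gaussFactor C n k = 0 := by
  have key : ∀ m j, n < m → residual C m n j = 0 := by
    intro m
    induction m with
    | zero => intro j hj; omega
    | succ m ih =>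
      intro j hm
      simp only [residual]
      rcases Nat.lt_succ_iff_lt_or_eq.1 hm with h' | rfl
      · rw [ih j h', ih m h']; simp
      · by_cases h0 : residual C n n n = 0
        · simp [h0, residual_eq_zero hC h0 j]
        · rw [(residual_aux hC n).1 j n]
          field_simp
          ring
  simp [gaussFactor, key k k h]

theorem gaussSeq_eq_sum {C : ℕ → ℕ → ℝ} (hC : (Matrix.of C).PosSemidef) {n m : ℕ} (h : n < m)
    (g : ℕ → ℝ) : gaussSeq C g n = ∑ k : Fin m, gaussFactor C n k * g k := by
  rw [gaussSeq, Fin.sum_univ_eq_sum_range (fun k => gaussFactor C n k * g k)]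
  refine Finset.sum_subset (Finset.range_subset_range.2 (by omega)) fun k _ hk => ?_
  rw [gaussFactor_eq_zero hC (by simpa using hk), zero_mul]

theorem sum_gaussFactor_mul_eq {C : ℕ → ℕ → ℝ} (hC : (Matrix.of C).PosSemidef) {n m : ℕ}
    (h : n < m) (n' : ℕ) : ∑ k : Fin m, gaussFactor C n k * gaussFactor C n' k = C n n' := by
  rw [← sum_gaussFactor_mul hC n n',
    Fin.sum_univ_eq_sum_range (fun k => gaussFactor C n k * gaussFactor C n' k)]
  symm
  refine Finset.sum_subset (Finset.range_subset_range.2 (by omega)) fun k _ hk => ?_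
  rw [gaussFactor_eq_zero hC (by simpa using hk), zero_mul]

/-- The entrywise square of a positive semidefinite matrix is positive semidefinite. -/
theorem posSemidef_sq_div_two {q : ℕ → ℕ → ℝ} (hq : (Matrix.of q).PosSemidef) :
    (Matrix.of fun n n' => q n n' ^ 2 / 2).PosSemidef := by
  have hs : ∀ i j, q i j = q j i := fun i j => by simpa using (hq.1.apply i j).symm
  refine posSemidef_of_gram (κ := ℕ × ℕ) (fun i j => by rw [hs]) fun s => ?_
  obtain ⟨m, hm⟩ : ∃ m, ∀ i ∈ s, i < m := ⟨s.sup id + 1, fun i hi =>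
    Nat.lt_succ_of_le (Finset.le_sup (f := id) hi)⟩
  refine ⟨Finset.range m ×ˢ Finset.range m, fun p i => gaussFactor q i p.1 * gaussFactor q i p.2
    / √2, fun i hi j hj => ?_⟩
  rw [← sum_gaussFactor_mul_eq hq (hm i hi) j,
    Fin.sum_univ_eq_sum_range (fun k => gaussFactor q i k * gaussFactor q j k), pow_two,
    Finset.sum_mul_sum, Finset.sum_product, Finset.sum_div]
  refine Finset.sum_congr rfl fun k _ => ?_
  rw [Finset.sum_div]
  refine Finset.sum_congr rfl fun l _ => ?_
  have : √(2 : ℝ) * √2 = 2 := Real.mul_self_sqrt (by norm_num)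
  rw [div_mul_div_comm, this]
  ring

theorem map_gaussSeq {C : ℕ → ℕ → ℝ} (hC : (Matrix.of C).PosSemidef) (n : ℕ) :
    stdNormalSeq.map (fun g => gaussSeq C g n) = gaussianReal 0 (C n n).toNNReal := by
  have hG := (isGaussianProcess_gaussSeq C).hasGaussianLaw_eval n
  rw [hG.map_eq_gaussianReal]
  have hm := integral_gaussSeq C n
  congr 1
  congr 1
  rw [variance_of_integral_eq_zero hG.aemeasurable hm]
  rw [← integral_gaussSeq_mul hC n n]
  simp [pow_two]

theorem lintegral_exp_abs_gaussianReal_le (c : ℝ) (v : NNReal) :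
    ∫⁻ x, ENNReal.ofReal (Real.exp (c * |x|)) ∂(gaussianReal 0 v)
      ≤ ENNReal.ofReal (2 * Real.exp (v * c ^ 2 / 2)) := by
  have hi : ∀ c, Integrable (fun x => Real.exp (c * x)) (gaussianReal 0 v) := fun c =>
    integrable_exp_mul_gaussianReal c
  have he : ∀ c, ∫ x, Real.exp (c * x) ∂(gaussianReal 0 v) = Real.exp (v * c ^ 2 / 2) := by
    intro c
    have := congrFun (mgf_fun_id_gaussianReal (μ := 0) (v := v)) c
    simpa [mgf] using this
  calc ∫⁻ x, ENNReal.ofReal (Real.exp (c * |x|)) ∂(gaussianReal 0 v)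
      ≤ ∫⁻ x, ENNReal.ofReal (Real.exp (c * x) + Real.exp (-c * x)) ∂(gaussianReal 0 v) := by
        refine lintegral_mono fun x => ENNReal.ofReal_le_ofReal ?_
        rcases abs_choice x with h | h <;> rw [h]
        · linarith [Real.exp_pos (-c * x)]
        · have : c * -x = -c * x := by ring
          rw [this]
          linarith [Real.exp_pos (c * x)]
    _ = ENNReal.ofReal (2 * Real.exp (v * c ^ 2 / 2)) := by
        rw [← ofReal_integral_eq_lintegral_ofReal
          (f := fun x => Real.exp (c * x) + Real.exp (-c * x)) ((hi c).add (hi (-c)))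
          (ae_of_all _ fun x => by positivity), integral_add (hi c) (hi (-c)), he, he]
        congr 1
        rw [neg_sq]
        ring

/-! ### Domination of the interpolating system -/

/-- A random factor that dominates all the interpolating weights with first index `α`, uniformly in
time and in the spin configuration. -/
def envelope (c : ℝ) (q : ℕ → ℕ → ℝ) (g : Noise N) (α : ℕ) : ℝ :=
  Real.exp (c * |gaussSeq (fun n n' => q n n' ^ 2 / 2) g.1 α|)
    + ∑ i, Real.exp (c * |gaussSeq q (g.2.1 i) α|) + ∑ p, Real.exp (c * |g.2.2 p|) + Real.exp c

/-- The exponent used in the dominating factor. -/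
def envConst (β h : ℝ) (N : ℕ) : ℝ := |β| * (N ^ 2 + 2 * N + |h| * N) + 1

theorem envConst_pos (β h : ℝ) (N : ℕ) : 0 < envConst β h N := by
  unfold envConst; positivity

theorem envelope_pos (c : ℝ) (q : ℕ → ℕ → ℝ) (g : Noise N) (α : ℕ) : 0 < envelope c q g α := by
  unfold envelope; positivity

theorem measurable_envelope {X : Type*} [MeasurableSpace X] (c : ℝ) {q : ℕ → ℕ → X → ℝ}
    {g : X → Noise N} (hq : ∀ i j, Measurable (q i j)) (hg : Measurable g) (α : ℕ) :
    Measurable fun x => envelope c (fun i j => q i j x) (g x) α := by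
  have h1 : Measurable fun x => gaussSeq (fun n n' => q n n' x ^ 2 / 2) (g x).1 α :=
    measurable_gaussSeq (C := fun i j x => q i j x ^ 2 / 2)
      (fun i j => ((hq i j).pow_const 2).div_const 2) hg.fst α
  have h2 : ∀ i, Measurable fun x => gaussSeq (fun n n' => q n n' x) ((g x).2.1 i) α :=
    fun i => measurable_gaussSeq hq ((measurable_pi_apply i).comp hg.snd.fst) α
  have h3 : ∀ p, Measurable fun x => (g x).2.2 p := fun p =>
    (measurable_pi_apply p).comp hg.snd.snd
  unfold envelope
  exact (((((measurable_abs.comp h1).const_mul c).exp).add (Finset.measurable_sum _ fun i _ =>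
    ((measurable_abs.comp (h2 i)).const_mul c).exp)).add (Finset.measurable_sum _ fun p _ =>
    ((measurable_abs.comp (h3 p)).const_mul c).exp)).add_const _

theorem exists_lintegral_envelope_le (c : ℝ) (N : ℕ) :
    ∃ K : ENNReal, K ≠ ⊤ ∧ ∀ q, IsOverlapMatrix q → ∀ α,
      ∫⁻ g, ENNReal.ofReal (envelope c q g α) ∂(noise N) ≤ K := by
  set B : ENNReal := ENNReal.ofReal (2 * Real.exp (c ^ 2 / 2)) with hB
  refine ⟨B + ∑ _i : Fin N, B + ∑ _p : Fin N × Fin N, B + ENNReal.ofReal (Real.exp c), ?_, ?_⟩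
  · simp [hB, ENNReal.mul_eq_top]
  intro q hq α
  have hmC : ∀ C : ℕ → ℕ → ℝ, Measurable fun g : ℕ → ℝ => gaussSeq C g α := fun C =>
    measurable_gaussSeq (C := fun i j _ => C i j) (fun _ _ => measurable_const) measurable_id α
  have hexp : Measurable fun x : ℝ => ENNReal.ofReal (Real.exp (c * |x|)) :=
    ((measurable_id.abs.const_mul c).exp).ennreal_ofReal
  have hgauss : ∀ v : NNReal, v ≤ 1 →
      ∫⁻ x, ENNReal.ofReal (Real.exp (c * |x|)) ∂(gaussianReal 0 v) ≤ B := by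
    intro v hv
    refine (lintegral_exp_abs_gaussianReal_le c v).trans (ENNReal.ofReal_le_ofReal ?_)
    have : (v : ℝ) ≤ 1 := by exact_mod_cast hv
    have := mul_le_of_le_one_left (sq_nonneg c) this
    gcongr
  have hseq : ∀ C : ℕ → ℕ → ℝ, (Matrix.of C).PosSemidef → C α α ≤ 1 →
      ∫⁻ g, ENNReal.ofReal (Real.exp (c * |gaussSeq C g α|)) ∂stdNormalSeq ≤ B := by
    intro C hC hC1
    rw [← lintegral_map (f := fun x => ENNReal.ofReal (Real.exp (c * |x|))) hexp (hmC C),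
      map_gaussSeq hC]
    exact hgauss _ (by simpa using hC1)
  have m1 : MeasurePreserving (fun g : Noise N => g.1) (noise N) stdNormalSeq :=
    measurePreserving_fst
  have m2 : ∀ i, MeasurePreserving (fun g : Noise N => g.2.1 i) (noise N) stdNormalSeq := fun i =>
    (measurePreserving_eval (fun _ : Fin N => stdNormalSeq) i).comp
      (measurePreserving_fst.comp measurePreserving_snd)
  have m3 : ∀ p, MeasurePreserving (fun g : Noise N => g.2.2 p) (noise N) (gaussianReal 0 1) :=
    fun p => (measurePreserving_eval (fun _ : Fin N × Fin N => gaussianReal 0 1) p).comp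
      (measurePreserving_snd.comp measurePreserving_snd)
  have e : ∀ g : Noise N, ENNReal.ofReal (envelope c q g α)
      = ENNReal.ofReal (Real.exp (c * |gaussSeq (fun n n' => q n n' ^ 2 / 2) g.1 α|))
        + ∑ i, ENNReal.ofReal (Real.exp (c * |gaussSeq q (g.2.1 i) α|))
        + ∑ p, ENNReal.ofReal (Real.exp (c * |g.2.2 p|)) + ENNReal.ofReal (Real.exp c) := by
    intro g
    rw [envelope, ENNReal.ofReal_add (by positivity) (by positivity),
      ENNReal.ofReal_add (by positivity) (by positivity),
      ENNReal.ofReal_add (by positivity) (by positivity),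
      ENNReal.ofReal_sum_of_nonneg fun _ _ => (Real.exp_pos _).le,
      ENNReal.ofReal_sum_of_nonneg fun _ _ => (Real.exp_pos _).le]
  simp only [e]
  have c1 : Measurable fun g : Noise N =>
      ENNReal.ofReal (Real.exp (c * |gaussSeq (fun n n' => q n n' ^ 2 / 2) g.1 α|)) :=
    hexp.comp ((hmC _).comp m1.measurable)
  have c2 : ∀ i, Measurable fun g : Noise N =>
      ENNReal.ofReal (Real.exp (c * |gaussSeq q (g.2.1 i) α|)) := fun i =>
    hexp.comp ((hmC _).comp (m2 i).measurable)
  have c3 : ∀ p, Measurable fun g : Noise N => ENNReal.ofReal (Real.exp (c * |g.2.2 p|)) :=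
    fun p => hexp.comp (m3 p).measurable
  rw [lintegral_add_right _ measurable_const,
    lintegral_add_right _ (Finset.measurable_fun_sum _ fun p _ => c3 p),
    lintegral_add_right _ (Finset.measurable_fun_sum _ fun i _ => c2 i),
    lintegral_finsetSum _ fun i _ => c2 i, lintegral_finsetSum _ fun p _ => c3 p]
  refine add_le_add (add_le_add (add_le_add ?_ (Finset.sum_le_sum fun i _ => ?_))
    (Finset.sum_le_sum fun p _ => ?_)) (by simp)
  · rw [m1.lintegral_comp (f := fun g => ENNReal.ofReal (Real.exp (c *
      |gaussSeq (fun n n' => q n n' ^ 2 / 2) g α|))) (hexp.comp (hmC _))]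
    exact hseq _ (posSemidef_sq_div_two hq.1) (by simp [hq.2]; norm_num)
  · rw [(m2 i).lintegral_comp (f := fun g => ENNReal.ofReal (Real.exp (c * |gaussSeq q g α|)))
      (hexp.comp (hmC _))]
    exact hseq _ hq.1 (by simp [hq.2])
  · rw [(m3 p).lintegral_comp hexp]
    exact hgauss 1 le_rfl

theorem abs_spin (σ : Spins N) (i : Fin N) : |spin σ i| = 1 := by
  rcases Int.units_eq_one_or (σ i) with h | h <;> simp [spin, h]

theorem spin_mul_self (σ : Spins N) (i : Fin N) : spin σ i * spin σ i = 1 := by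
  rcases Int.units_eq_one_or (σ i) with h | h <;> simp [spin, h]

theorem abs_magnetization_le (σ : Spins N) : |magnetization σ| ≤ N := by
  refine (Finset.abs_sum_le_sum_abs _ _).trans ?_
  simp [abs_spin]

theorem abs_interaction_le (J : Fin N × Fin N → ℝ) (σ : Spins N) :
    |interaction J σ| ≤ ∑ p, |J p| := by
  rcases Nat.eq_zero_or_pos N with rfl | hN
  · simp [interaction]
  have h1 : (1 : ℝ) ≤ √(2 * N) := by
    rw [Real.one_le_sqrt]
    have : (1 : ℝ) ≤ N := by exact_mod_cast hN
    linarith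
  rw [interaction, abs_div, abs_of_nonneg (Real.sqrt_nonneg _)]
  refine (div_le_self (abs_nonneg _) h1).trans ?_
  rw [Fintype.sum_prod_type]
  refine (Finset.abs_sum_le_sum_abs _ _).trans (Finset.sum_le_sum fun i _ => ?_)
  refine (Finset.abs_sum_le_sum_abs _ _).trans (Finset.sum_le_sum fun j _ => ?_)
  simp [abs_mul, abs_spin]

theorem sqrt_natCast_le (N : ℕ) : √(N : ℝ) ≤ N := by
  rcases Nat.eq_zero_or_pos N with rfl | hN
  · simp
  · have : (1 : ℝ) ≤ N := by exact_mod_cast hN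
    rw [Real.sqrt_le_left (by positivity)]
    nlinarith

section Envelope

variable (q : ℕ → ℕ → ℝ) (g : Noise N) (α : ℕ) (c : ℝ)

theorem mul_abs_kappa_le : c * |gaussSeq (fun n n' => q n n' ^ 2 / 2) g.1 α|
    ≤ Real.log (envelope c q g α) := by
  rw [Real.le_log_iff_exp_le (envelope_pos _ _ _ _)]
  unfold envelope
  have h2 : 0 ≤ ∑ i, Real.exp (c * |gaussSeq q (g.2.1 i) α|) := by positivity
  have h3 : 0 ≤ ∑ p, Real.exp (c * |g.2.2 p|) := by positivity
  have h4 := Real.exp_pos c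
  linarith

theorem mul_abs_eta_le (i : Fin N) : c * |gaussSeq q (g.2.1 i) α|
    ≤ Real.log (envelope c q g α) := by
  rw [Real.le_log_iff_exp_le (envelope_pos _ _ _ _)]
  unfold envelope
  have h1 := Real.exp_pos (c * |gaussSeq (fun n n' => q n n' ^ 2 / 2) g.1 α|)
  have h2 := Finset.single_le_sum (f := fun i => Real.exp (c * |gaussSeq q (g.2.1 i) α|))
    (fun i _ => (Real.exp_pos _).le) (Finset.mem_univ i)
  have h3 : 0 ≤ ∑ p, Real.exp (c * |g.2.2 p|) := by positivity
  have h4 := Real.exp_pos c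
  linarith

theorem mul_abs_coupling_le (p : Fin N × Fin N) : c * |g.2.2 p|
    ≤ Real.log (envelope c q g α) := by
  rw [Real.le_log_iff_exp_le (envelope_pos _ _ _ _)]
  unfold envelope
  have h1 := Real.exp_pos (c * |gaussSeq (fun n n' => q n n' ^ 2 / 2) g.1 α|)
  have h2 : 0 ≤ ∑ i, Real.exp (c * |gaussSeq q (g.2.1 i) α|) := by positivity
  have h3 := Finset.single_le_sum (f := fun p => Real.exp (c * |g.2.2 p|))
    (fun i _ => (Real.exp_pos _).le) (Finset.mem_univ p)
  have h4 := Real.exp_pos c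
  linarith

theorem le_log_envelope : c ≤ Real.log (envelope c q g α) := by
  rw [Real.le_log_iff_exp_le (envelope_pos _ _ _ _)]
  unfold envelope
  have h1 := Real.exp_pos (c * |gaussSeq (fun n n' => q n n' ^ 2 / 2) g.1 α|)
  have h2 : 0 ≤ ∑ i, Real.exp (c * |gaussSeq q (g.2.1 i) α|) := by positivity
  have h3 : 0 ≤ ∑ p, Real.exp (c * |g.2.2 p|) := by positivity
  linarith

end Envelope

/-- All the Gaussian fields of block size `N` are dominated by the envelope. -/
theorem abs_beta_mul_le (β h : ℝ) (q : ℕ → ℕ → ℝ) (g : Noise N) (α : ℕ) :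
    |β| * (∑ p, |g.2.2 p| + N * |gaussSeq (fun n n' => q n n' ^ 2 / 2) g.1 α|
      + ∑ i, |gaussSeq q (g.2.1 i) α| + |h| * N)
      ≤ Real.log (envelope (envConst β h N) q g α) := by
  set c := envConst β h N with hc
  have hcpos : 0 < c := envConst_pos β h N
  set l := Real.log (envelope c q g α) with hl
  have hl0 : c ≤ l := le_log_envelope q g α c
  have h1 : c * ∑ p, |g.2.2 p| ≤ N ^ 2 * l := by
    rw [Finset.mul_sum]
    refine (Finset.sum_le_sum fun p _ => mul_abs_coupling_le q g α c p).trans ?_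
    simp [← hl, pow_two]
  have h2 := mul_abs_kappa_le q g α c
  have h3 : c * ∑ i, |gaussSeq q (g.2.1 i) α| ≤ N * l := by
    rw [Finset.mul_sum]
    refine (Finset.sum_le_sum fun i _ => mul_abs_eta_le q g α c i).trans ?_
    simp [← hl]
  rw [← hl] at h2
  have h2' := mul_le_mul_of_nonneg_left h2 (Nat.cast_nonneg (α := ℝ) N)
  have h4 : |h| * N * c ≤ |h| * N * l := mul_le_mul_of_nonneg_left hl0 (by positivity)
  refine le_of_mul_le_mul_left ?_ hcpos
  calc c * (|β| * (∑ p, |g.2.2 p| + N * |gaussSeq (fun n n' => q n n' ^ 2 / 2) g.1 α|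
      + ∑ i, |gaussSeq q (g.2.1 i) α| + |h| * N))
      = |β| * (c * ∑ p, |g.2.2 p| + N * (c * |gaussSeq (fun n n' => q n n' ^ 2 / 2) g.1 α|)
      + c * ∑ i, |gaussSeq q (g.2.1 i) α| + |h| * N * c) := by ring
    _ ≤ |β| * (N ^ 2 * l + N * l + N * l + |h| * N * l) :=
        mul_le_mul_of_nonneg_left (by linarith) (abs_nonneg _)
    _ = (c - 1) * l := by rw [hc, envConst]; ring
    _ ≤ c * l := by linarith

theorem abs_pathField_le (β h : ℝ) {t : ℝ} (ht : t ∈ Set.Icc (0 : ℝ) 1) (q : ℕ → ℕ → ℝ)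
    (g : Noise N) (γ : ℕ × Spins N) :
    |pathField β h t q g γ| ≤ Real.log (envelope (envConst β h N) q g γ.1) := by
  refine le_trans ?_ (abs_beta_mul_le β h q g γ.1)
  rw [pathField, abs_mul]
  refine mul_le_mul_of_nonneg_left ?_ (abs_nonneg _)
  have s1 : √(1 - t) ≤ 1 := Real.sqrt_le_one.2 (by linarith [ht.1])
  have s2 : √t ≤ 1 := Real.sqrt_le_one.2 ht.2
  have a1 := abs_interaction_le g.2.2 γ.2
  have a2 : |√(N : ℝ) * gaussSeq (fun n n' => q n n' ^ 2 / 2) g.1 γ.1|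
      ≤ N * |gaussSeq (fun n n' => q n n' ^ 2 / 2) g.1 γ.1| := by
    rw [abs_mul, abs_of_nonneg (Real.sqrt_nonneg _)]
    exact mul_le_mul_of_nonneg_right (sqrt_natCast_le N) (abs_nonneg _)
  have a3 : |∑ i, gaussSeq q (g.2.1 i) γ.1 * spin γ.2 i| ≤ ∑ i, |gaussSeq q (g.2.1 i) γ.1| := by
    refine (Finset.abs_sum_le_sum_abs _ _).trans (Finset.sum_le_sum fun i _ => ?_)
    rw [abs_mul, abs_spin, mul_one]
  have a4 : |h * magnetization γ.2| ≤ |h| * N := by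
    rw [abs_mul]
    exact mul_le_mul_of_nonneg_left (abs_magnetization_le _) (abs_nonneg _)
  refine (abs_add_le _ _).trans (add_le_add ((abs_add_le _ _).trans (add_le_add ?_ ?_)) a4)
  · rw [abs_mul, abs_of_nonneg (Real.sqrt_nonneg _)]
    refine (mul_le_of_le_one_left (abs_nonneg _) s1).trans ((abs_add_le _ _).trans ?_)
    exact add_le_add a1 a2
  · rw [abs_mul, abs_of_nonneg (Real.sqrt_nonneg _)]
    exact (mul_le_of_le_one_left (abs_nonneg _) s2).trans a3

section Bounds

variable {β h t : ℝ} {ξ : ℕ → ℝ} {q : ℕ → ℕ → ℝ} {g : Noise N}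

theorem pathWeight_nonneg (hξ : ∀ n, 0 ≤ ξ n) (γ : ℕ × Spins N) :
    0 ≤ pathWeight β h t ξ q g γ := mul_nonneg (hξ _) (Real.exp_pos _).le

theorem pathWeight_le (ht : t ∈ Set.Icc (0 : ℝ) 1) (hξ : ∀ n, 0 ≤ ξ n) (γ : ℕ × Spins N) :
    pathWeight β h t ξ q g γ ≤ ξ γ.1 * envelope (envConst β h N) q g γ.1 := by
  refine mul_le_mul_of_nonneg_left ?_ (hξ _)
  rw [← Real.le_log_iff_exp_le (envelope_pos _ _ _ _)]
  exact (le_abs_self _).trans (abs_pathField_le β h ht q g γ)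

theorem le_pathWeight (ht : t ∈ Set.Icc (0 : ℝ) 1) (hξ : ∀ n, 0 ≤ ξ n) (γ : ℕ × Spins N) :
    ξ γ.1 / envelope (envConst β h N) q g γ.1 ≤ pathWeight β h t ξ q g γ := by
  rw [div_eq_mul_inv]
  refine mul_le_mul_of_nonneg_left ?_ (hξ _)
  rw [← Real.log_le_iff_le_exp (inv_pos.2 (envelope_pos _ _ _ _)), Real.log_inv]
  have := abs_pathField_le β h ht q g γ
  linarith [neg_abs_le (pathField β h t q g γ)]

theorem summable_comp_fst {f : ℕ → ℝ} (hf : Summable f) :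
    Summable fun γ : ℕ × Spins N => f γ.1 := by
  have := (hf.abs.mul_of_nonneg (g := fun _ : Spins N => (1 : ℝ)) Summable.of_finite
    (fun _ => abs_nonneg _) (fun _ => zero_le_one))
  refine Summable.of_norm_bounded this fun γ => by simp

theorem tsum_comp_fst {f : ℕ → ℝ} (hf : Summable f) :
    ∑' γ : ℕ × Spins N, f γ.1 = Fintype.card (Spins N) * ∑' n, f n := by
  rw [(summable_comp_fst hf).tsum_prod]
  simp [tsum_mul_left]

theorem summable_pathWeight (ht : t ∈ Set.Icc (0 : ℝ) 1) (hξ : ∀ n, 0 ≤ ξ n)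
    (hs : Summable fun n => ξ n * envelope (envConst β h N) q g n) :
    Summable (pathWeight β h t ξ q g) :=
  Summable.of_nonneg_of_le (pathWeight_nonneg hξ) (pathWeight_le ht hξ) (summable_comp_fst hs)

/-- The upper bound on the partition function is immediate; the lower bound is
Jensen's inequality for `x ↦ 1 / x`. -/
theorem abs_log_pathSum_sub_le (ht : t ∈ Set.Icc (0 : ℝ) 1) (hξ : IsSummableWeight ξ)
    (hs : Summable fun n => ξ n * envelope (envConst β h N) q g n) :
    0 < pathSum β h t ξ q g ∧
    |Real.log (pathSum β h t ξ q g)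
      - (Real.log (∑' n, ξ n) + Real.log (Fintype.card (Spins N)))|
      ≤ (∑' n, ξ n * envelope (envConst β h N) q g n) / ∑' n, ξ n := by
  obtain ⟨hξ0, hξs, hξp⟩ := hξ
  set E := envelope (envConst β h N) q g with hE
  have hE0 : ∀ n, 0 < E n := fun n => envelope_pos _ _ _ _
  set A := ∑' n, ξ n with hA
  set S := ∑' n, ξ n * E n with hS
  have hcard : (0 : ℝ) < Fintype.card (Spins N) := by exact_mod_cast Fintype.card_pos
  have hsum := summable_pathWeight ht hξ0 hs
  have up : pathSum β h t ξ q g ≤ Fintype.card (Spins N) * S := by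
    rw [hS, ← tsum_comp_fst hs]
    exact hsum.tsum_le_tsum (pathWeight_le ht hξ0) (summable_comp_fst hs)
  have hSpos : 0 < S := by
    obtain ⟨n, hn⟩ : ∃ n, ξ n ≠ 0 := by
      by_contra hcon
      push Not at hcon
      simp [hA, hcon] at hξp
    exact hs.tsum_pos (fun n => mul_nonneg (hξ0 n) (hE0 n).le) n
      (mul_pos (lt_of_le_of_ne (hξ0 n) (Ne.symm hn)) (hE0 n))
  have hdiv : Summable fun n => ξ n / E n := by
    have h1 : ∀ n, 1 ≤ E n := fun n => by
      have := le_log_envelope q g n (envConst β h N)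
      have h0 := envConst_pos β h N
      have := (Real.le_log_iff_exp_le (hE0 n)).1 this
      exact (Real.one_le_exp h0.le).trans this
    exact Summable.of_nonneg_of_le (fun n => div_nonneg (hξ0 n) (hE0 n).le)
      (fun n => div_le_self (hξ0 n) (h1 n)) hξs
  have low : A ^ 2 / S ≤ ∑' n, ξ n / E n := by
    -- `1 / E ≥ 2 c - c ^ 2 E` for every `c`; the best choice is `c = A / S`
    have hterm : ∀ n, 2 * (A / S) * ξ n - (A / S) ^ 2 * (ξ n * E n) ≤ ξ n / E n := by
      intro n
      have : 2 * (A / S) - (A / S) ^ 2 * E n ≤ 1 / E n := by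
        rw [le_div_iff₀ (hE0 n)]
        nlinarith [sq_nonneg (A / S * E n - 1)]
      have := mul_le_mul_of_nonneg_left this (hξ0 n)
      calc _ = ξ n * (2 * (A / S) - (A / S) ^ 2 * E n) := by ring
        _ ≤ _ := this
        _ = _ := by ring
    have := ((hξs.mul_left (2 * (A / S))).sub (hs.mul_left ((A / S) ^ 2))).tsum_le_tsum
      hterm hdiv
    rw [(hξs.mul_left (2 * (A / S))).tsum_sub (hs.mul_left ((A / S) ^ 2)), tsum_mul_left,
      tsum_mul_left, ← hA, ← hS] at this
    refine le_trans (le_of_eq ?_) this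
    field_simp
    ring
  have low' : Fintype.card (Spins N) * (A ^ 2 / S) ≤ pathSum β h t ξ q g := by
    refine (mul_le_mul_of_nonneg_left low hcard.le).trans ?_
    rw [← tsum_comp_fst hdiv]
    exact (summable_comp_fst hdiv).tsum_le_tsum (le_pathWeight ht hξ0) hsum
  have hlowpos : 0 < Fintype.card (Spins N) * (A ^ 2 / S) := by positivity
  have hpos := hlowpos.trans_le low'
  refine ⟨hpos, ?_⟩
  have l1 := Real.log_le_log hpos up
  have l2 := Real.log_le_log hlowpos low'
  rw [Real.log_mul hcard.ne' hSpos.ne'] at l1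
  rw [Real.log_mul hcard.ne' (by positivity), Real.log_div (by positivity) hSpos.ne',
    Real.log_pow] at l2
  have l3 : Real.log S - Real.log A ≤ S / A := by
    rw [← Real.log_div hSpos.ne' hξp.ne']
    exact (Real.log_le_sub_one_of_pos (by positivity)).trans (by linarith)
  rw [abs_le]
  push_cast at l2
  constructor <;> linarith

theorem abs_le_one_of_isOverlapMatrix (hq : IsOverlapMatrix q) (n m : ℕ) : |q n m| ≤ 1 := by
  have hsymm : q m n = q n m := by simpa using hq.1.1.apply n m
  have key : ∀ x : ℝ, 0 ≤ 1 + 2 * x * q n m + x ^ 2 := by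
    intro x
    rcases eq_or_ne n m with rfl | hnm
    · rw [hq.2]; nlinarith [sq_nonneg (1 + x)]
    have := (residual_aux hq.1 0).2 {n, m} (fun k => if k = n then 1 else x)
    rw [Finset.sum_pair hnm, Finset.sum_pair hnm, Finset.sum_pair hnm] at this
    simp only [residual, hq.2, hsymm, if_pos, if_neg hnm.symm] at this
    linarith
  rw [abs_le]
  constructor <;> linarith [key 1, key (-1)]

theorem abs_overlap_le (σ σ' : Spins N) : |overlap σ σ'| ≤ 1 := by
  rw [overlap, abs_div, Nat.abs_cast]
  refine div_le_one_of_le₀ ?_ (Nat.cast_nonneg _)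
  refine (Finset.abs_sum_le_sum_abs _ _).trans ?_
  simp [abs_mul, abs_spin]

theorem sq_sub_overlap_le (hq : IsOverlapMatrix q) (n m : ℕ) (σ σ' : Spins N) :
    (q n m - overlap σ σ') ^ 2 ≤ 4 := by
  have h1 := abs_le.1 (abs_le_one_of_isOverlapMatrix hq n m)
  have h2 := abs_le.1 (abs_overlap_le σ σ')
  nlinarith

end Bounds

/-! ### Integrability -/

theorem exists_lintegral_mass_le (c : ℝ) (N : ℕ) :
    ∃ K : ENNReal, K ≠ ⊤ ∧ ∀ ξ q, IsSummableWeight ξ → IsOverlapMatrix q →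
      ∫⁻ g, (∑' n, ENNReal.ofReal (ξ n * envelope c q g n)) / ENNReal.ofReal (∑' n, ξ n)
        ∂(noise N) ≤ K := by
  obtain ⟨K, hK, h⟩ := exists_lintegral_envelope_le c N
  refine ⟨K, hK, fun ξ q hξ hq => ?_⟩
  have hm : ∀ n, Measurable fun g : Noise N => envelope c q g n := fun n =>
    measurable_envelope c (q := fun i j _ => q i j) (fun _ _ => measurable_const) measurable_id n
  simp only [div_eq_mul_inv]
  rw [lintegral_mul_const _ (Measurable.tsum fun n => ((hm n).const_mul _).ennreal_ofReal),
    lintegral_tsum fun n => ((hm n).const_mul _).ennreal_ofReal.aemeasurable, ← div_eq_mul_inv]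
  refine ENNReal.div_le_of_le_mul ?_
  rw [ENNReal.ofReal_tsum_of_nonneg hξ.1 hξ.2.1, ← ENNReal.tsum_mul_left]
  refine ENNReal.tsum_le_tsum fun n => ?_
  simp only [ENNReal.ofReal_mul (hξ.1 n)]
  rw [lintegral_const_mul _ (hm n).ennreal_ofReal, mul_comm]
  exact mul_le_mul_left (h q hq n) _

/-- Finiteness of the dominating mass, in terms of real series. -/
theorem summable_and_integrable_mass {Y : Type*} [MeasurableSpace Y] {ν : Measure Y}
    {c : ℝ} {ξ : ℕ → Y → ℝ} {q : ℕ → ℕ → Y → ℝ} {g : Y → Noise N} (hξ : ∀ i, Measurable (ξ i))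
    (hq : ∀ i j, Measurable (q i j)) (hg : Measurable g)
    (hw : ∀ᵐ y ∂ν, IsSummableWeight fun n => ξ n y)
    (hfin : ∫⁻ y, (∑' n, ENNReal.ofReal (ξ n y * envelope c (fun i j => q i j y) (g y) n)) /
      ENNReal.ofReal (∑' n, ξ n y) ∂ν ≠ ⊤) :
    (∀ᵐ y ∂ν, Summable fun n => ξ n y * envelope c (fun i j => q i j y) (g y) n) ∧
      Integrable (fun y => (∑' n, ξ n y * envelope c (fun i j => q i j y) (g y) n) /
        ∑' n, ξ n y) ν := by
  have hm : ∀ n, Measurable fun y => ξ n y * envelope c (fun i j => q i j y) (g y) n := fun n =>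
    (hξ n).mul (measurable_envelope c hq hg n)
  have hM : Measurable fun y => (∑' n, ENNReal.ofReal
      (ξ n y * envelope c (fun i j => q i j y) (g y) n)) / ENNReal.ofReal (∑' n, ξ n y) :=
    (Measurable.tsum fun n => (hm n).ennreal_ofReal).div (Measurable.tsum hξ).ennreal_ofReal
  have hs : ∀ᵐ y ∂ν, Summable fun n => ξ n y * envelope c (fun i j => q i j y) (g y) n := by
    filter_upwards [hw, ae_lt_top hM hfin] with y hy hlt
    have h0 : ∀ n, 0 ≤ ξ n y * envelope c (fun i j => q i j y) (g y) n := fun n =>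
      mul_nonneg (hy.1 n) (envelope_pos _ _ _ _).le
    have : ∑' n, ENNReal.ofReal (ξ n y * envelope c (fun i j => q i j y) (g y) n) ≠ ⊤ := by
      intro htop
      rw [htop, ENNReal.top_div_of_ne_top ENNReal.ofReal_ne_top] at hlt
      exact lt_irrefl _ hlt
    have := ENNReal.summable_toReal this
    simpa [ENNReal.toReal_ofReal, h0] using this
  refine ⟨hs, (Measurable.tsum hm).div (Measurable.tsum hξ) |>.aestronglyMeasurable, ?_⟩
  rw [hasFiniteIntegral_iff_norm]
  refine lt_of_le_of_lt (lintegral_mono_ae ?_) (lt_top_iff_ne_top.2 hfin)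
  filter_upwards [hw, hs] with y hy hsy
  have h0 : ∀ n, 0 ≤ ξ n y * envelope c (fun i j => q i j y) (g y) n := fun n =>
    mul_nonneg (hy.1 n) (envelope_pos _ _ _ _).le
  rw [Real.norm_eq_abs, abs_of_nonneg (div_nonneg (tsum_nonneg h0) hy.2.2.le),
    ENNReal.ofReal_div_of_pos hy.2.2, ENNReal.ofReal_tsum_of_nonneg h0 hsy]

section Fixed

variable {β h : ℝ} {ξ : ℕ → ℝ} {q : ℕ → ℕ → ℝ}

theorem summable_and_integrable_mass_noise (c : ℝ) (hξ : IsSummableWeight ξ)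
    (hq : IsOverlapMatrix q) :
    (∀ᵐ g ∂(noise N), Summable fun n => ξ n * envelope c q g n) ∧
      Integrable (fun g => (∑' n, ξ n * envelope c q g n) / ∑' n, ξ n) (noise N) := by
  obtain ⟨K, hK, hle⟩ := exists_lintegral_mass_le c N
  exact summable_and_integrable_mass (ξ := fun n _ => ξ n) (q := fun i j _ => q i j) (g := id)
    (fun _ => measurable_const) (fun _ _ => measurable_const) measurable_id
    (ae_of_all _ fun _ => hξ) (ne_top_of_le_ne_top hK (hle ξ q hξ hq))

theorem measurable_pathSum_noise (t : ℝ) :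
    Measurable fun g : Noise N => pathSum β h t ξ q g :=
  measurable_pathSum (t := fun _ => t) (ξ := fun n _ => ξ n) (q := fun i j _ => q i j)
    measurable_const (fun _ => measurable_const) (fun _ _ => measurable_const) measurable_id

theorem integrable_log_pathSum (hξ : IsSummableWeight ξ) (hq : IsOverlapMatrix q) {t : ℝ}
    (ht : t ∈ Set.Icc (0 : ℝ) 1) :
    Integrable (fun g => Real.log (pathSum β h t ξ q g)) (noise N) := by
  obtain ⟨hs, hi⟩ := summable_and_integrable_mass_noise (N := N) (envConst β h N) hξ hq
  refine Integrable.mono' (hi.add (integrable_const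
    |Real.log (∑' n, ξ n) + Real.log (Fintype.card (Spins N))|))
    (measurable_pathSum_noise t).log.aestronglyMeasurable ?_
  filter_upwards [hs] with g hg
  have := (abs_log_pathSum_sub_le (β := β) (h := h) ht hξ hg).2
  have h2 := abs_sub_abs_le_abs_sub (Real.log (pathSum β h t ξ q g))
    (Real.log (∑' n, ξ n) + Real.log (Fintype.card (Spins N)))
  simp only [Real.norm_eq_abs, Pi.add_apply]
  linarith

/-- The Gibbs weights of the interpolating system sum to one. -/
theorem hasSum_pathWeight_div_pathSum {g : Noise N} {t : ℝ} (ht : t ∈ Set.Icc (0 : ℝ) 1)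
    (hξ : IsSummableWeight ξ)
    (hs : Summable fun n => ξ n * envelope (envConst β h N) q g n) :
    HasSum (fun γ => pathWeight β h t ξ q g γ / pathSum β h t ξ q g) 1 := by
  have h1 := (summable_pathWeight (β := β) (h := h) ht hξ.1 hs).hasSum.div_const
    (pathSum β h t ξ q g)
  have h2 := (abs_log_pathSum_sub_le (β := β) (h := h) ht hξ hs).1
  rwa [← pathSum, div_self h2.ne'] at h1

theorem abs_pathReplica_le {g : Noise N} {t : ℝ} (ht : t ∈ Set.Icc (0 : ℝ) 1)
    (hξ : IsSummableWeight ξ) (hq : IsOverlapMatrix q)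
    (hs : Summable fun n => ξ n * envelope (envConst β h N) q g n) :
    |pathReplica β h t ξ q g| ≤ 4 := by
  have hp := hasSum_pathWeight_div_pathSum ht hξ hs
  set p : ℕ × Spins N → ℝ := fun γ => pathWeight β h t ξ q g γ / pathSum β h t ξ q g with hpdef
  have hp0 : ∀ γ, 0 ≤ p γ := fun γ => div_nonneg (pathWeight_nonneg hξ.1 γ)
    (abs_log_pathSum_sub_le (β := β) (h := h) ht hξ hs).1.le
  have hin : ∀ γ, 0 ≤ ∑' γ' : ℕ × Spins N,
      (q γ.1 γ'.1 - overlap γ.2 γ'.2) ^ 2 * (p γ * p γ') ∧ ∑' γ' : ℕ × Spins N,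
      (q γ.1 γ'.1 - overlap γ.2 γ'.2) ^ 2 * (p γ * p γ') ≤ 4 * p γ := by
    intro γ
    have hb : ∀ γ' : ℕ × Spins N, (q γ.1 γ'.1 - overlap γ.2 γ'.2) ^ 2 * (p γ * p γ')
        ≤ 4 * p γ * p γ' := fun γ' => by
      rw [mul_assoc]
      exact mul_le_mul_of_nonneg_right (sq_sub_overlap_le hq _ _ _ _)
        (mul_nonneg (hp0 _) (hp0 _))
    have h0 : ∀ γ' : ℕ × Spins N, 0 ≤ (q γ.1 γ'.1 - overlap γ.2 γ'.2) ^ 2 * (p γ * p γ') :=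
      fun γ' => mul_nonneg (sq_nonneg _) (mul_nonneg (hp0 _) (hp0 _))
    refine ⟨tsum_nonneg h0, ?_⟩
    have hsum := hp.mul_left (4 * p γ)
    have := (Summable.of_nonneg_of_le h0 hb hsum.summable).tsum_le_tsum hb hsum.summable
    rwa [hsum.tsum_eq, mul_one] at this
  have h4 := hp.mul_left 4
  have := (Summable.of_nonneg_of_le (fun γ => (hin γ).1) (fun γ => (hin γ).2)
    h4.summable).tsum_le_tsum (fun γ => (hin γ).2) h4.summable
  rw [h4.tsum_eq, mul_one] at this
  rw [pathReplica, abs_of_nonneg (tsum_nonneg fun γ => (hin γ).1)]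
  exact this

/-! ### Truncation to finitely many weights -/

/-- The weights with all but the first `n` set to zero. -/
def truncate (n : ℕ) (ξ : ℕ → ℝ) (k : ℕ) : ℝ := if k < n then ξ k else 0

theorem truncate_nonneg (hξ : ∀ k, 0 ≤ ξ k) (n k : ℕ) : 0 ≤ truncate n ξ k := by
  unfold truncate; split_ifs <;> simp [hξ]

theorem truncate_le (hξ : ∀ k, 0 ≤ ξ k) (n k : ℕ) : truncate n ξ k ≤ ξ k := by
  unfold truncate; split_ifs <;> simp [hξ]

theorem isSummableWeight_truncate (hξ : IsSummableWeight ξ) {n k : ℕ} (hk : k < n)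
    (hpos : 0 < ξ k) : IsSummableWeight (truncate n ξ) := by
  have hs : Summable (truncate n ξ) :=
    Summable.of_nonneg_of_le (truncate_nonneg hξ.1 n) (truncate_le hξ.1 n) hξ.2.1
  refine ⟨truncate_nonneg hξ.1 n, hs, hs.tsum_pos (truncate_nonneg hξ.1 n) k ?_⟩
  simpa [truncate, hk] using hpos

theorem tsum_eq_sum_fin {f : ℕ × Spins N → ℝ} {n : ℕ} (hf : ∀ γ, n ≤ γ.1 → f γ = 0) :
    ∑' γ, f γ = ∑ γ : Fin n × Spins N, f ((γ.1 : ℕ), γ.2) := by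
  rw [tsum_eq_sum (s := Finset.range n ×ˢ Finset.univ)]
  · rw [Finset.sum_product, Fintype.sum_prod_type, Finset.sum_range]
  · intro γ hγ
    refine hf γ ?_
    by_contra hlt
    exact hγ (by simp; omega)

/-- The interaction as a linear function of the couplings. -/
def interCoeff (σ : Spins N) (p : Fin N × Fin N) : ℝ := spin σ p.1 * spin σ p.2 / √(2 * N)

theorem interaction_eq_sum (J : Fin N × Fin N → ℝ) (σ : Spins N) :
    interaction J σ = ∑ p, interCoeff σ p * J p := by
  rw [interaction, Fintype.sum_prod_type, Finset.sum_div]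
  refine Finset.sum_congr rfl fun i _ => ?_
  rw [Finset.sum_div]
  refine Finset.sum_congr rfl fun j _ => ?_
  rw [interCoeff]
  ring

theorem natCast_mul_overlap (σ σ' : Spins N) :
    N * overlap σ σ' = ∑ i, spin σ i * spin σ' i := by
  rcases Nat.eq_zero_or_pos N with rfl | hN
  · simp
  · rw [overlap]
    have : (N : ℝ) ≠ 0 := by positivity
    field_simp

theorem overlap_self (hN : 0 < N) (σ : Spins N) : overlap σ σ = 1 := by
  have : (N : ℝ) ≠ 0 := by positivity
  simp [overlap, spin_mul_self, this]

theorem sum_interCoeff_mul (σ σ' : Spins N) :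
    ∑ p, interCoeff σ p * interCoeff σ' p = N / 2 * overlap σ σ' ^ 2 := by
  rcases Nat.eq_zero_or_pos N with rfl | hN
  · simp
  have h2 : √(2 * (N : ℝ)) * √(2 * N) = 2 * N := Real.mul_self_sqrt (by positivity)
  have hN0 : (N : ℝ) ≠ 0 := by positivity
  have e : ∀ p, interCoeff σ p * interCoeff σ' p
      = (spin σ p.1 * spin σ' p.1) * (spin σ p.2 * spin σ' p.2) / (2 * N) := fun p => by
    rw [interCoeff, interCoeff, div_mul_div_comm, h2]
    ring
  simp only [e]
  rw [← Finset.sum_div, Fintype.sum_prod_type]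
  simp only
  rw [← Finset.sum_mul_sum, ← natCast_mul_overlap]
  field_simp

/-- The standard normal variables that drive the first `n` terms of the Gaussian fields. -/
def noiseVars (n : ℕ) (g : Noise N) : Fin n ⊕ (Fin N × Fin n) ⊕ (Fin N × Fin N) → ℝ :=
  Sum.elim (fun k => g.1 k) (Sum.elim (fun p => g.2.1 p.1 p.2) g.2.2)

theorem measurePreserving_noiseVars (n : ℕ) :
    MeasurePreserving (noiseVars (N := N) n) (noise N) (stdNormal _) :=
  measurePreserving_sumElim (measurePreserving_stdNormalSeq n)
    (measurePreserving_sumElim (measurePreserving_uncurry (measurePreserving_stdNormalSeq n))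
      (MeasurePreserving.id (couplings N)))

/-- Coefficients of the field `β (K_N(σ) + √N κ_α)`. -/
def startCoeff (β : ℝ) (q : ℕ → ℕ → ℝ) (n : ℕ) (γ : Fin n × Spins N) :
    Fin n ⊕ (Fin N × Fin n) ⊕ (Fin N × Fin N) → ℝ :=
  Sum.elim (fun k => β * (√N * gaussFactor (fun n n' => q n n' ^ 2 / 2) γ.1 k))
    (Sum.elim 0 fun p => β * interCoeff γ.2 p)

/-- Coefficients of the cavity field `β V_{α,σ}`. -/
def cavityCoeff (β : ℝ) (q : ℕ → ℕ → ℝ) (n : ℕ) (γ : Fin n × Spins N) :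
    Fin n ⊕ (Fin N × Fin n) ⊕ (Fin N × Fin N) → ℝ :=
  Sum.elim 0 (Sum.elim (fun p => β * (gaussFactor q γ.1 p.2 * spin γ.2 p.1)) 0)

/-- The a priori weights, which include the external field. -/
def fieldWeight (β h : ℝ) (ξ : ℕ → ℝ) (n : ℕ) (γ : Fin n × Spins N) : ℝ :=
  ξ γ.1 * Real.exp (β * (h * magnetization γ.2))

theorem isWeight_fieldWeight (hξ : ∀ k, 0 ≤ ξ k) {n k : ℕ} (hk : k < n) (hpos : 0 < ξ k) :
    IsWeight (fieldWeight (N := N) β h ξ n) :=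
  ⟨fun _ => mul_nonneg (hξ _) (Real.exp_pos _).le,
    Finset.sum_pos' (fun _ _ => mul_nonneg (hξ _) (Real.exp_pos _).le)
      ⟨(⟨k, hk⟩, 1), Finset.mem_univ _, mul_pos hpos (Real.exp_pos _)⟩⟩

theorem sum_startCoeff_mul_cavityCoeff (n : ℕ) (γ γ' : Fin n × Spins N) :
    ∑ k, startCoeff β q n γ k * cavityCoeff β q n γ' k = 0 := by
  simp [startCoeff, cavityCoeff]

theorem cov_startCoeff (hq : IsOverlapMatrix q) (n : ℕ) (γ γ' : Fin n × Spins N) :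
    cov (startCoeff β q n) γ γ'
      = β ^ 2 * (N / 2) * (q γ.1 γ'.1 ^ 2 + overlap γ.2 γ'.2 ^ 2) := by
  have h1 := sum_gaussFactor_mul_eq (posSemidef_sq_div_two hq.1) γ.1.2 γ'.1
  have h2 := sum_interCoeff_mul γ.2 γ'.2
  have h3 : √(N : ℝ) * √N = N := Real.mul_self_sqrt (Nat.cast_nonneg _)
  have e1 : ∀ k : Fin n, β * (√N * gaussFactor (fun n n' => q n n' ^ 2 / 2) γ.1 k) *
      (β * (√N * gaussFactor (fun n n' => q n n' ^ 2 / 2) γ'.1 k))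
      = β ^ 2 * (√N * √N) * (gaussFactor (fun n n' => q n n' ^ 2 / 2) γ.1 k *
        gaussFactor (fun n n' => q n n' ^ 2 / 2) γ'.1 k) := fun k => by ring
  have e2 : ∀ p, β * interCoeff γ.2 p * (β * interCoeff γ'.2 p)
      = β ^ 2 * (interCoeff γ.2 p * interCoeff γ'.2 p) := fun p => by ring
  simp only [cov, startCoeff, Fintype.sum_sum_type, Sum.elim_inl, Sum.elim_inr, Pi.zero_apply,
    mul_zero, Finset.sum_const_zero, zero_add, e1, e2, ← Finset.mul_sum, h1, h2, h3]
  ring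

theorem cov_cavityCoeff (hq : IsOverlapMatrix q) (n : ℕ) (γ γ' : Fin n × Spins N) :
    cov (cavityCoeff β q n) γ γ' = β ^ 2 * N * (q γ.1 γ'.1 * overlap γ.2 γ'.2) := by
  have h1 := sum_gaussFactor_mul_eq hq.1 γ.1.2 γ'.1
  have h2 := natCast_mul_overlap γ.2 γ'.2
  have e1 : ∀ (i : Fin N) (k : Fin n), β * (gaussFactor q γ.1 k * spin γ.2 i) *
      (β * (gaussFactor q γ'.1 k * spin γ'.2 i))
      = β ^ 2 * (spin γ.2 i * spin γ'.2 i) * (gaussFactor q γ.1 k * gaussFactor q γ'.1 k) :=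
    fun i k => by ring
  simp only [cov, cavityCoeff, Fintype.sum_sum_type, Sum.elim_inl, Sum.elim_inr, Pi.zero_apply,
    mul_zero, Finset.sum_const_zero, zero_add, add_zero, Fintype.sum_prod_type, e1,
    ← Finset.mul_sum, h1, ← Finset.sum_mul, ← h2]
  ring

theorem covDiff_startCoeff_cavityCoeff (hq : IsOverlapMatrix q) (n : ℕ)
    (γ γ' : Fin n × Spins N) : covDiff (startCoeff β q n) (cavityCoeff β q n) γ γ'
      = -(β ^ 2 * N / 2 * (q γ.1 γ'.1 - overlap γ.2 γ'.2) ^ 2) := by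
  rw [covDiff, cov_startCoeff hq, cov_cavityCoeff hq]
  ring

theorem pathWeight_truncate (hq : IsOverlapMatrix q) (t : ℝ) (n : ℕ) (g : Noise N)
    (γ : Fin n × Spins N) :
    pathWeight β h t (truncate n ξ) q g ((γ.1 : ℕ), γ.2)
      = fieldWeight β h ξ n γ * Real.exp (linField
        (interpCoeff (startCoeff β q n) (cavityCoeff β q n) t) (noiseVars n g) γ) := by
  have e : pathField β h t q g ((γ.1 : ℕ), γ.2) = β * (h * magnetization γ.2) + linField
        (interpCoeff (startCoeff β q n) (cavityCoeff β q n) t) (noiseVars n g) γ := by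
    have s1 : ∀ i, gaussSeq q (g.2.1 i) γ.1 * spin γ.2 i
        = ∑ k : Fin n, gaussFactor q γ.1 k * g.2.1 i k * spin γ.2 i := fun i => by
      rw [gaussSeq_eq_sum hq.1 γ.1.2, Finset.sum_mul]
    simp only [pathField, s1]
    rw [gaussSeq_eq_sum (posSemidef_sq_div_two hq.1) γ.1.2, interaction_eq_sum]
    simp only [linField, interpCoeff, startCoeff, cavityCoeff, noiseVars, Fintype.sum_sum_type,
      Sum.elim_inl, Sum.elim_inr, Pi.zero_apply, mul_zero, add_zero, zero_add,
      Fintype.sum_prod_type, Finset.mul_sum, mul_add]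
    have r1 : ∀ k : Fin n, √(1 - t) * (β * (√N * gaussFactor (fun n n' => q n n' ^ 2 / 2) γ.1 k))
        * g.1 k = β * (√(1 - t) * (√N * (gaussFactor (fun n n' => q n n' ^ 2 / 2) γ.1 k * g.1 k)))
        := fun k => by ring
    have r2 : ∀ (i : Fin N) (k : Fin n), √t * (β * (gaussFactor q γ.1 k * spin γ.2 i)) * g.2.1 i k
        = β * (√t * (gaussFactor q γ.1 k * g.2.1 i k * spin γ.2 i)) := fun i k => by ring
    have r3 : ∀ p, √(1 - t) * (β * interCoeff γ.2 p) * g.2.2 p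
        = β * (√(1 - t) * (interCoeff γ.2 p * g.2.2 p)) := fun p => by ring
    simp only [r1, r2, r3]
    ring
  rw [pathWeight, e, Real.exp_add, fieldWeight]
  simp only [truncate, Fin.is_lt, if_true]
  ring

theorem pathSum_truncate (hq : IsOverlapMatrix q) (t : ℝ) (n : ℕ) (g : Noise N) :
    pathSum β h t (truncate n ξ) q g = expSum (fieldWeight β h ξ n) (linField
        (interpCoeff (startCoeff β q n) (cavityCoeff β q n) t) (noiseVars n g)) := by
  rw [pathSum, tsum_eq_sum_fin (n := n)]
  · exact Finset.sum_congr rfl fun γ _ => pathWeight_truncate hq t n g γ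
  · intro γ hγ
    simp [pathWeight, truncate, not_lt.2 hγ]

theorem replicaForm_truncate (hN : 0 < N) (hq : IsOverlapMatrix q) (t : ℝ) (n : ℕ)
    (g : Noise N) :
    replicaForm (fieldWeight β h ξ n) (linField
        (interpCoeff (startCoeff β q n) (cavityCoeff β q n) t) (noiseVars n g))
        (covDiff (startCoeff β q n) (cavityCoeff β q n))
      = β ^ 2 * N / 2 * pathReplica β h t (truncate n ξ) q g := by
  have hz : ∀ γ : ℕ × Spins N, n ≤ γ.1 → pathWeight β h t (truncate n ξ) q g γ = 0 := by
    intro γ hγ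
    simp [pathWeight, truncate, not_lt.2 hγ]
  rw [pathReplica, tsum_eq_sum_fin (n := n), replicaForm, Finset.mul_sum]
  · refine Finset.sum_congr rfl fun γ _ => ?_
    rw [tsum_eq_sum_fin (n := n), Finset.mul_sum, mul_sub, Finset.mul_sum]
    · simp only [covDiff_startCoeff_cavityCoeff hq, hq.2, overlap_self hN, gibbs,
        pathWeight_truncate hq, pathSum_truncate hq]
      rw [sub_self, zero_pow two_ne_zero, mul_zero, neg_zero, mul_zero, zero_sub,
        ← Finset.sum_neg_distrib]
      exact Finset.sum_congr rfl fun γ' _ => by ring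
    · intro γ' hγ'
      simp [hz γ' hγ']
  · intro γ hγ
    simp [hz γ hγ]

/-- The gap formula for finitely many fixed weights. -/
theorem gap_truncate (hN : 0 < N) (hξ : ∀ k, 0 ≤ ξ k) (hq : IsOverlapMatrix q) {n k : ℕ}
    (hk : k < n) (hpos : 0 < ξ k) :
    ∫ g, Real.log (pathSum β h 1 (truncate n ξ) q g) ∂(noise N)
      - ∫ g, Real.log (pathSum β h 0 (truncate n ξ) q g) ∂(noise N)
      = β ^ 2 * N / 4 * ∫ t in (0 : ℝ)..1,
        ∫ g, pathReplica β h t (truncate n ξ) q g ∂(noise N) := by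
  have hw : IsWeight (fieldWeight (N := N) β h ξ n) := isWeight_fieldWeight hξ hk hpos
  have hG := measurePreserving_noiseVars (N := N) n
  have key := logZ_sub_logZ hw (sum_startCoeff_mul_cavityCoeff (β := β) (q := q) n)
  have er : ∀ t : ℝ, ∫ g, replicaForm (fieldWeight (N := N) β h ξ n) (linField
        (interpCoeff (startCoeff β q n) (cavityCoeff β q n) t) g)
        (covDiff (startCoeff β q n) (cavityCoeff β q n)) ∂(stdNormal _)
      = β ^ 2 * N / 2 * ∫ g, pathReplica β h t (truncate n ξ) q g ∂(noise N) := by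
    intro t
    rw [← integral_const_mul]
    simp only [← replicaForm_truncate hN hq]
    exact (hG.hasLaw.integral_comp ((continuous_replicaForm hw _).comp
      (continuous_linField _)).aestronglyMeasurable).symm
  simp only [pathSum_truncate hq, interpCoeff_one, interpCoeff_zero, integral_log_expSum hw _ hG, key, er]
  rw [intervalIntegral.integral_const_mul]
  ring

end Fixed

/-! ### Removal of the truncation -/

section Fixed

variable {β h : ℝ} {ξ : ℕ → ℝ} {q : ℕ → ℕ → ℝ}

theorem exists_pos_of_isSummableWeight (hξ : IsSummableWeight ξ) : ∃ k, 0 < ξ k := by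
  by_contra hcon
  push Not at hcon
  have : ∀ k, ξ k = 0 := fun k => le_antisymm (hcon k) (hξ.1 k)
  have := hξ.2.2
  simp_all

theorem pathWeight_truncate_le (hξ : ∀ k, 0 ≤ ξ k) (t : ℝ) (n : ℕ) (g : Noise N)
    (γ : ℕ × Spins N) : pathWeight β h t (truncate n ξ) q g γ ≤ pathWeight β h t ξ q g γ :=
  mul_le_mul_of_nonneg_right (truncate_le hξ n γ.1) (Real.exp_pos _).le

theorem truncate_mono (hξ : ∀ k, 0 ≤ ξ k) {m n : ℕ} (hmn : m ≤ n) (k : ℕ) :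
    truncate m ξ k ≤ truncate n ξ k := by
  unfold truncate
  split_ifs with h1 h2
  · exact le_rfl
  · omega
  · exact hξ k
  · exact le_rfl

theorem tendsto_pathWeight_truncate (t : ℝ) (g : Noise N) (γ : ℕ × Spins N) :
    Tendsto (fun n => pathWeight β h t (truncate n ξ) q g γ) atTop
      (𝓝 (pathWeight β h t ξ q g γ)) := by
  refine tendsto_const_nhds.congr' ?_
  filter_upwards [eventually_gt_atTop γ.1] with n hn
  simp [pathWeight, truncate, hn]

section Pointwise

variable {g : Noise N} {t : ℝ}

theorem summable_truncate_mul_envelope (hξ : ∀ k, 0 ≤ ξ k) {c : ℝ}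
    (hs : Summable fun n => ξ n * envelope c q g n) (n : ℕ) :
    Summable fun k => truncate n ξ k * envelope c q g k :=
  Summable.of_nonneg_of_le
    (fun k => mul_nonneg (truncate_nonneg hξ n k) (envelope_pos _ _ _ _).le)
    (fun k => mul_le_mul_of_nonneg_right (truncate_le hξ n k) (envelope_pos _ _ _ _).le) hs

theorem tendsto_pathSum_truncate (ht : t ∈ Set.Icc (0 : ℝ) 1) (hξ : ∀ k, 0 ≤ ξ k)
    (hs : Summable fun n => ξ n * envelope (envConst β h N) q g n) :
    Tendsto (fun n => pathSum β h t (truncate n ξ) q g) atTop (𝓝 (pathSum β h t ξ q g)) := by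
  refine tendsto_tsum_of_dominated_convergence (summable_pathWeight ht hξ hs)
    (tendsto_pathWeight_truncate t g) (Eventually.of_forall fun n γ => ?_)
  rw [Real.norm_eq_abs, abs_of_nonneg (pathWeight_nonneg (truncate_nonneg hξ n) γ)]
  exact pathWeight_truncate_le hξ t n g γ

theorem pathSum_truncate_mono (ht : t ∈ Set.Icc (0 : ℝ) 1) (hξ : ∀ k, 0 ≤ ξ k)
    (hs : Summable fun n => ξ n * envelope (envConst β h N) q g n) {m n : ℕ} (hmn : m ≤ n) :
    pathSum β h t (truncate m ξ) q g ≤ pathSum β h t (truncate n ξ) q g :=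
  (summable_pathWeight ht (truncate_nonneg hξ m)
    (summable_truncate_mul_envelope hξ hs m)).tsum_le_tsum
    (fun _ => mul_le_mul_of_nonneg_right (truncate_mono hξ hmn _) (Real.exp_pos _).le)
    (summable_pathWeight ht (truncate_nonneg hξ n) (summable_truncate_mul_envelope hξ hs n))

theorem pathSum_truncate_le (ht : t ∈ Set.Icc (0 : ℝ) 1) (hξ : ∀ k, 0 ≤ ξ k)
    (hs : Summable fun n => ξ n * envelope (envConst β h N) q g n) (n : ℕ) :
    pathSum β h t (truncate n ξ) q g ≤ pathSum β h t ξ q g :=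
  (summable_pathWeight ht (truncate_nonneg hξ n)
    (summable_truncate_mul_envelope hξ hs n)).tsum_le_tsum
    (pathWeight_truncate_le hξ t n g) (summable_pathWeight ht hξ hs)

theorem tendsto_pathReplica_truncate (ht : t ∈ Set.Icc (0 : ℝ) 1) (hξ : IsSummableWeight ξ)
    (hq : IsOverlapMatrix q)
    (hs : Summable fun n => ξ n * envelope (envConst β h N) q g n) :
    Tendsto (fun n => pathReplica β h t (truncate n ξ) q g) atTop
      (𝓝 (pathReplica β h t ξ q g)) := by
  obtain ⟨k, hk⟩ := exists_pos_of_isSummableWeight hξ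
  set z := pathSum β h t (truncate (k + 1) ξ) q g with hz
  have hz0 : 0 < z := (abs_log_pathSum_sub_le ht
    (isSummableWeight_truncate hξ (Nat.lt_succ_self k) hk)
    (summable_truncate_mul_envelope hξ.1 hs _)).1
  set w : ℕ × Spins N → ℝ := pathWeight β h t ξ q g with hw
  have hw0 : ∀ γ, 0 ≤ w γ := pathWeight_nonneg hξ.1
  have hws : Summable w := summable_pathWeight ht hξ.1 hs
  have hpos := (abs_log_pathSum_sub_le (β := β) (h := h) ht hξ hs).1
  set p : ℕ → ℕ × Spins N → ℝ := fun n γ =>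
    pathWeight β h t (truncate n ξ) q g γ / pathSum β h t (truncate n ξ) q g with hp
  have hlim : ∀ γ, Tendsto (fun n => p n γ) atTop (𝓝 (w γ / pathSum β h t ξ q g)) := fun γ =>
    (tendsto_pathWeight_truncate t g γ).div (tendsto_pathSum_truncate ht hξ.1 hs) hpos.ne'
  have hp0 : ∀ n γ, 0 ≤ p n γ := fun n γ => div_nonneg
    (pathWeight_nonneg (truncate_nonneg hξ.1 n) γ)
    (tsum_nonneg (pathWeight_nonneg (truncate_nonneg hξ.1 n)))
  have hple : ∀ n, k + 1 ≤ n → ∀ γ, p n γ ≤ w γ / z := fun n hn γ =>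
    div_le_div₀ (hw0 γ) (pathWeight_truncate_le hξ.1 t n g γ) hz0
      (pathSum_truncate_mono ht hξ.1 hs hn)
  have hterm : ∀ n, k + 1 ≤ n → ∀ γ γ' : ℕ × Spins N,
      0 ≤ (q γ.1 γ'.1 - overlap γ.2 γ'.2) ^ 2 * (p n γ * p n γ') ∧
      (q γ.1 γ'.1 - overlap γ.2 γ'.2) ^ 2 * (p n γ * p n γ') ≤ 4 * (w γ / z) * (w γ' / z) := by
    intro n hn γ γ'
    refine ⟨mul_nonneg (sq_nonneg _) (mul_nonneg (hp0 _ _) (hp0 _ _)), ?_⟩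
    rw [mul_assoc]
    exact mul_le_mul (sq_sub_overlap_le hq _ _ _ _)
      (mul_le_mul (hple n hn γ) (hple n hn γ') (hp0 _ _) (div_nonneg (hw0 _) hz0.le))
      (mul_nonneg (hp0 _ _) (hp0 _ _)) (by norm_num)
  have hsz : Summable fun γ => w γ / z := hws.div_const z
  refine tendsto_tsum_of_dominated_convergence
    (bound := fun γ => 4 * (w γ / z) * ∑' γ', w γ' / z) ((hsz.mul_left 4).mul_right _)
    (fun γ => tendsto_tsum_of_dominated_convergence
      (bound := fun γ' => 4 * (w γ / z) * (w γ' / z)) (hsz.mul_left _)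
      (fun γ' => ((hlim γ).mul (hlim γ')).const_mul _) ?_) ?_
  · filter_upwards [eventually_ge_atTop (k + 1)] with n hn γ'
    rw [Real.norm_eq_abs, abs_of_nonneg (hterm n hn γ γ').1]
    exact (hterm n hn γ γ').2
  · filter_upwards [eventually_ge_atTop (k + 1)] with n hn γ
    rw [Real.norm_eq_abs, abs_of_nonneg (tsum_nonneg fun γ' => (hterm n hn γ γ').1),
      ← tsum_mul_left]
    exact (Summable.of_nonneg_of_le (fun γ' => (hterm n hn γ γ').1)
      (fun γ' => (hterm n hn γ γ').2) (hsz.mul_left _)).tsum_le_tsum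
      (fun γ' => (hterm n hn γ γ').2) (hsz.mul_left _)

end Pointwise

theorem measurable_pathReplica_uncurry (β h : ℝ) (ξ : ℕ → ℝ) (q : ℕ → ℕ → ℝ) :
    Measurable fun p : ℝ × Noise N => pathReplica β h p.1 ξ q p.2 :=
  measurable_pathReplica (ξ := fun n _ => ξ n) (q := fun i j _ => q i j)
    measurable_fst (fun _ => measurable_const) (fun _ _ => measurable_const) measurable_snd

theorem tendsto_integral_log_pathSum_truncate (hξ : IsSummableWeight ξ) (hq : IsOverlapMatrix q)
    {t : ℝ} (ht : t ∈ Set.Icc (0 : ℝ) 1) :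
    Tendsto (fun n => ∫ g, Real.log (pathSum β h t (truncate n ξ) q g) ∂(noise N)) atTop
      (𝓝 (∫ g, Real.log (pathSum β h t ξ q g) ∂(noise N))) := by
  obtain ⟨k, hk⟩ := exists_pos_of_isSummableWeight hξ
  have hξk := isSummableWeight_truncate hξ (Nat.lt_succ_self k) hk
  obtain ⟨hs, -⟩ := summable_and_integrable_mass_noise (N := N) (envConst β h N) hξ hq
  refine tendsto_integral_filter_of_dominated_convergence
    (fun g => |Real.log (pathSum β h t (truncate (k + 1) ξ) q g)|
      + |Real.log (pathSum β h t ξ q g)|)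
    (Eventually.of_forall fun n => (measurable_pathSum_noise t).log.aestronglyMeasurable) ?_
    ((integrable_log_pathSum hξk hq ht).abs.add (integrable_log_pathSum hξ hq ht).abs) ?_
  · filter_upwards [eventually_ge_atTop (k + 1)] with n hn
    filter_upwards [hs] with g hg
    have h0 := (abs_log_pathSum_sub_le (β := β) (h := h) ht hξk
      (summable_truncate_mul_envelope hξ.1 hg _)).1
    have h1 := pathSum_truncate_mono (β := β) (h := h) ht hξ.1 hg hn
    have h2 := pathSum_truncate_le (β := β) (h := h) ht hξ.1 hg n
    have l1 := Real.log_le_log h0 h1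
    have l2 := Real.log_le_log (h0.trans_le h1) h2
    rw [Real.norm_eq_abs, abs_le]
    have a1 := neg_abs_le (Real.log (pathSum β h t (truncate (k + 1) ξ) q g))
    have a2 := le_abs_self (Real.log (pathSum β h t ξ q g))
    have a3 := abs_nonneg (Real.log (pathSum β h t ξ q g))
    have a4 := abs_nonneg (Real.log (pathSum β h t (truncate (k + 1) ξ) q g))
    constructor <;> linarith
  · filter_upwards [hs] with g hg
    exact (tendsto_pathSum_truncate ht hξ.1 hg).log
      (abs_log_pathSum_sub_le (β := β) (h := h) ht hξ hg).1.ne'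

theorem tendsto_integral_pathReplica_truncate (hξ : IsSummableWeight ξ)
    (hq : IsOverlapMatrix q) {t : ℝ} (ht : t ∈ Set.Icc (0 : ℝ) 1) :
    Tendsto (fun n => ∫ g, pathReplica β h t (truncate n ξ) q g ∂(noise N)) atTop
      (𝓝 (∫ g, pathReplica β h t ξ q g ∂(noise N))) := by
  obtain ⟨k, hk⟩ := exists_pos_of_isSummableWeight hξ
  obtain ⟨hs, -⟩ := summable_and_integrable_mass_noise (N := N) (envConst β h N) hξ hq
  refine tendsto_integral_filter_of_dominated_convergence (fun _ => 4)
    (Eventually.of_forall fun n => ((measurable_pathReplica_uncurry β h (truncate n ξ) q).comp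
      measurable_prodMk_left).aestronglyMeasurable) ?_ (integrable_const _) ?_
  · filter_upwards [eventually_ge_atTop (k + 1)] with n hn
    filter_upwards [hs] with g hg
    exact abs_pathReplica_le ht (isSummableWeight_truncate hξ hn hk) hq
      (summable_truncate_mul_envelope hξ.1 hg _)
  · filter_upwards [hs] with g hg
    exact tendsto_pathReplica_truncate ht hξ hq hg

theorem abs_integral_pathReplica_le (hξ : IsSummableWeight ξ) (hq : IsOverlapMatrix q) {t : ℝ}
    (ht : t ∈ Set.Icc (0 : ℝ) 1) : |∫ g, pathReplica β h t ξ q g ∂(noise N)| ≤ 4 := by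
  obtain ⟨hs, -⟩ := summable_and_integrable_mass_noise (N := N) (envConst β h N) hξ hq
  have hb : ∀ᵐ g ∂(noise N), ‖pathReplica β h t ξ q g‖ ≤ 4 := by
    filter_upwards [hs] with g hg
    exact abs_pathReplica_le ht hξ hq hg
  simpa using norm_integral_le_of_norm_le_const hb

/-- The gap formula for fixed weights and overlaps. -/
theorem gap_fixed (hN : 0 < N) (hξ : IsSummableWeight ξ) (hq : IsOverlapMatrix q) :
    ∫ g, Real.log (pathSum β h 1 ξ q g) ∂(noise N)
      - ∫ g, Real.log (pathSum β h 0 ξ q g) ∂(noise N)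
      = β ^ 2 * N / 4 * ∫ t in (0 : ℝ)..1, ∫ g, pathReplica β h t ξ q g ∂(noise N) := by
  obtain ⟨k, hk⟩ := exists_pos_of_isSummableWeight hξ
  have hL := (tendsto_integral_log_pathSum_truncate (N := N) (β := β) (h := h) hξ hq
    (t := 1) (by simp)).sub (tendsto_integral_log_pathSum_truncate (N := N) (β := β) (h := h) hξ hq
    (t := 0) (by simp))
  have hR : Tendsto (fun n => ∫ t in (0 : ℝ)..1,
      ∫ g, pathReplica β h t (truncate n ξ) q g ∂(noise N)) atTop
      (𝓝 (∫ t in (0 : ℝ)..1, ∫ g, pathReplica β h t ξ q g ∂(noise N))) := by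
    refine intervalIntegral.tendsto_integral_filter_of_dominated_convergence (fun _ => 4)
      (Eventually.of_forall fun n => ((measurable_pathReplica_uncurry β h
        (truncate n ξ) q).stronglyMeasurable.integral_prod_right').aestronglyMeasurable) ?_
        intervalIntegrable_const ?_
    · filter_upwards [eventually_ge_atTop (k + 1)] with n hn
      refine ae_of_all _ fun t ht => ?_
      rw [Set.uIoc_of_le zero_le_one] at ht
      exact abs_integral_pathReplica_le (isSummableWeight_truncate hξ hn hk) hq ⟨ht.1.le, ht.2⟩
    · refine ae_of_all _ fun t ht => ?_
      rw [Set.uIoc_of_le zero_le_one] at ht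
      exact tendsto_integral_pathReplica_truncate hξ hq ⟨ht.1.le, ht.2⟩
  refine tendsto_nhds_unique (hL.congr' ?_) (hR.const_mul _)
  filter_upwards [eventually_ge_atTop (k + 1)] with n hn
  exact gap_truncate hN hξ.1 hq hn hk

end Fixed

/-! ### The partition function -/

/-- The weights due to the external field. -/
def spinWeight (β h : ℝ) (σ : Spins N) : ℝ := Real.exp (β * (h * magnetization σ))

theorem isWeight_spinWeight (β h : ℝ) : IsWeight (spinWeight (N := N) β h) :=
  ⟨fun _ => (Real.exp_pos _).le, Finset.sum_pos (fun _ _ => Real.exp_pos _) Finset.univ_nonempty⟩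

theorem partition_eq_expSum (β h : ℝ) (J : Fin N × Fin N → ℝ) :
    partition β h J = expSum (spinWeight β h) (linField (fun σ p => β * interCoeff σ p) J) := by
  refine Finset.sum_congr rfl fun σ _ => ?_
  rw [spinWeight, ← Real.exp_add, linField, interaction_eq_sum, mul_add, add_comm,
    Finset.mul_sum]
  simp only [mul_assoc]

theorem partition_pos (β h : ℝ) (J : Fin N × Fin N → ℝ) : 0 < partition β h J := by
  rw [partition_eq_expSum]
  exact expSum_pos (isWeight_spinWeight β h) _

theorem integrable_log_partition (β h : ℝ) (N : ℕ) :
    Integrable (fun J => Real.log (partition β h J)) (couplings N) := by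
  simp only [partition_eq_expSum]
  exact integrable_log_expSum (isWeight_spinWeight β h) _

theorem integral_log_partition (β h : ℝ) (N : ℕ) :
    ∫ J, Real.log (partition β h J) ∂(couplings N)
      = logZ (spinWeight (N := N) β h) (fun σ p => β * interCoeff σ p) := by
  simp only [partition_eq_expSum]
  rfl

/-! ### The gap formula for random overlap structures -/

namespace ROSt

variable (R : ROSt.{u}) {β h : ℝ}

theorem interpWeight_eq (t : ℝ) (s : R.Sample N) :
    R.interpWeight β h t s = pathWeight β h t (fun n => R.ξ n s.1) (fun n m => R.q n m s.1) s.2 :=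
  rfl

theorem replicaSum_eq (t : ℝ) (s : R.Sample N) :
    R.replicaSum β h t s
      = pathReplica β h t (fun n => R.ξ n s.1) (fun n m => R.q n m s.1) s.2 :=
  rfl

theorem law_eq (N : ℕ) : R.law N = R.μ.prod (noise N) := rfl

instance (N : ℕ) : IsProbabilityMeasure (R.law N) := by
  rw [law_eq]; infer_instance

theorem ae_regular : ∀ᵐ ω ∂(R.μ), IsSummableWeight (fun n => R.ξ n ω) ∧
    IsOverlapMatrix (fun n m => R.q n m ω) := by
  filter_upwards [R.nonneg_ξ, R.summable_ξ, R.tsum_pos_ξ, R.posSemidef_q, R.diag_q]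
    with ω h1 h2 h3 h4 h5
  exact ⟨⟨h1, h2, h3⟩, h4, h5⟩

theorem ae_regular_law (N : ℕ) : ∀ᵐ s ∂(R.law N), IsSummableWeight (fun n => R.ξ n s.1) ∧
    IsOverlapMatrix (fun n m => R.q n m s.1) :=
  Measure.quasiMeasurePreserving_fst.ae R.ae_regular

theorem summable_and_integrable_mass_law (c : ℝ) (N : ℕ) :
    (∀ᵐ s ∂(R.law N), Summable fun n => R.ξ n s.1 * envelope c (fun i j => R.q i j s.1) s.2 n) ∧
      Integrable (fun s : R.Sample N => (∑' n, R.ξ n s.1 *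
        envelope c (fun i j => R.q i j s.1) s.2 n) / ∑' n, R.ξ n s.1) (R.law N) := by
  obtain ⟨K, hK, hle⟩ := exists_lintegral_mass_le c N
  have hξ : ∀ i, Measurable fun s : R.Sample N => R.ξ i s.1 := fun i =>
    (R.measurable_ξ i).comp measurable_fst
  have hq : ∀ i j, Measurable fun s : R.Sample N => R.q i j s.1 := fun i j =>
    (R.measurable_q i j).comp measurable_fst
  refine summable_and_integrable_mass (ν := R.law N) (c := c) (ξ := fun n s => R.ξ n s.1) (q := fun i j s => R.q i j s.1)
    (g := fun s : R.Sample N => s.2) hξ hq measurable_snd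
    ((R.ae_regular_law N).mono fun s hs => hs.1) ?_
  have hM : Measurable fun s : R.Sample N => (∑' n, ENNReal.ofReal
      (R.ξ n s.1 * envelope c (fun i j => R.q i j s.1) s.2 n)) /
      ENNReal.ofReal (∑' n, R.ξ n s.1) :=
    (Measurable.tsum fun n => ((hξ n).mul (measurable_envelope c hq
      measurable_snd n)).ennreal_ofReal).div (Measurable.tsum hξ).ennreal_ofReal
  rw [law_eq]
  rw [lintegral_prod _ hM.aemeasurable]
  refine ne_top_of_le_ne_top hK ?_
  calc _ ≤ ∫⁻ _, K ∂(R.μ) := lintegral_mono_ae (by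
        filter_upwards [R.ae_regular] with ω hω
        exact hle (fun n => R.ξ n ω) (fun n m => R.q n m ω) hω.1 hω.2)
    _ = K := by simp

theorem measurable_pathSum_law (t : ℝ) : Measurable fun s : R.Sample N =>
    pathSum β h t (fun n => R.ξ n s.1) (fun n m => R.q n m s.1) s.2 :=
  measurable_pathSum (ξ := fun n (s : R.Sample N) => R.ξ n s.1)
    (q := fun i j (s : R.Sample N) => R.q i j s.1) measurable_const
    (fun i => (R.measurable_ξ i).comp measurable_fst)
    (fun i j => (R.measurable_q i j).comp measurable_fst) measurable_snd

theorem ae_summable_interpWeight (β h : ℝ) (N : ℕ) : ∀ᵐ s ∂(R.law N), ∀ t ∈ Set.Icc (0 : ℝ) 1,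
    Summable (R.interpWeight β h t s) := by
  filter_upwards [R.ae_regular_law N, (R.summable_and_integrable_mass_law (envConst β h N) N).1]
    with s h1 h2 t ht
  rw [interpWeight_eq]
  exact summable_pathWeight ht h1.1.1 h2

theorem cavityWeight_eq (s : R.Sample N) : R.cavityWeight β h s = R.interpWeight β h 1 s := by
  ext γ
  simp [cavityWeight, interpWeight, interpField]

theorem interpWeight_zero (s : R.Sample N) (γ : ℕ × Spins N) : R.interpWeight β h 0 s γ
    = R.vacancyWeight β s γ.1 *
      Real.exp (β * (interaction s.2.2.2 γ.2 + h * magnetization γ.2)) := by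
  simp only [interpWeight, interpField, vacancyWeight, sub_zero, Real.sqrt_one, one_mul,
    Real.sqrt_zero, zero_mul, add_zero]
  rw [mul_assoc, ← Real.exp_add]
  congr 2
  ring

theorem ae_summable_vacancyWeight (β : ℝ) (N : ℕ) :
    ∀ᵐ s ∂(R.law N), Summable (R.vacancyWeight (N := N) β s) := by
  filter_upwards [R.ae_summable_interpWeight β 0 N] with s hs
  have h0 := hs 0 (by simp)
  have h1 : Summable fun α => R.interpWeight β 0 0 s (α, 1) :=
    h0.comp_injective (i := fun α => (α, 1)) fun a b hab => (Prod.ext_iff.1 hab).1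
  have e : (fun α => R.interpWeight β 0 0 s (α, 1)) = fun α => R.vacancyWeight β s α *
      Real.exp (β * (interaction s.2.2.2 1 + 0 * magnetization 1)) :=
    funext fun α => R.interpWeight_zero s _
  rw [e, summable_mul_right_iff (Real.exp_pos _).ne'] at h1
  exact h1

/-- At time zero the interpolating system splits into the two independent systems whose
free energies are compared. -/
theorem tsum_interpWeight_zero {s : R.Sample N} (h0 : Summable (R.interpWeight β h 0 s)) :
    ∑' γ, R.interpWeight β h 0 s γ
      = (∑' α, R.vacancyWeight β s α) * partition β h s.2.2.2 := by
  rw [h0.tsum_prod]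
  simp only [interpWeight_zero, tsum_fintype, ← Finset.mul_sum]
  rw [tsum_mul_right]
  rfl

theorem ae_logIncrement_eq (β h : ℝ) (N : ℕ) : ∀ᵐ s ∂(R.law N), R.logIncrement β h s
    = Real.log (pathSum β h 1 (fun n => R.ξ n s.1) (fun n m => R.q n m s.1) s.2)
      - Real.log (pathSum β h 0 (fun n => R.ξ n s.1) (fun n m => R.q n m s.1) s.2)
      + Real.log (partition β h s.2.2.2) := by
  filter_upwards [R.ae_regular_law N, (R.summable_and_integrable_mass_law (envConst β h N) N).1,
    R.ae_summable_interpWeight β h N] with s h1 h2 h3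
  have p1 := (abs_log_pathSum_sub_le (β := β) (h := h) (t := 1) (by simp) h1.1 h2).1
  have p0 := (abs_log_pathSum_sub_le (β := β) (h := h) (t := 0) (by simp) h1.1 h2).1
  have e0 := R.tsum_interpWeight_zero (h3 0 (by simp))
  have hZ := partition_pos β h s.2.2.2
  rw [interpWeight_eq, ← pathSum] at e0
  have hV : ∑' α, R.vacancyWeight β s α ≠ 0 := by
    intro hV
    rw [hV, zero_mul] at e0
    exact p0.ne' e0
  rw [e0, Real.log_mul hV hZ.ne', logIncrement, cavityWeight_eq, interpWeight_eq, ← pathSum,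
    Real.log_div p1.ne' hV]
  ring

theorem integrable_log_pathSum_sub (β h : ℝ) (N : ℕ) : Integrable (fun s : R.Sample N =>
    Real.log (pathSum β h 1 (fun n => R.ξ n s.1) (fun n m => R.q n m s.1) s.2)
      - Real.log (pathSum β h 0 (fun n => R.ξ n s.1) (fun n m => R.q n m s.1) s.2)) (R.law N) := by
  obtain ⟨hs, hi⟩ := R.summable_and_integrable_mass_law (envConst β h N) N
  refine Integrable.mono' (hi.const_mul 2) ((R.measurable_pathSum_law 1).log.sub
    (R.measurable_pathSum_law 0).log).aestronglyMeasurable ?_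
  filter_upwards [R.ae_regular_law N, hs] with s h1 h2
  have p1 := (abs_log_pathSum_sub_le (β := β) (h := h) (t := 1) (by simp) h1.1 h2).2
  have p0 := (abs_log_pathSum_sub_le (β := β) (h := h) (t := 0) (by simp) h1.1 h2).2
  rw [abs_le] at p0 p1
  rw [Real.norm_eq_abs, abs_le]
  constructor <;> linarith [p0.1, p0.2, p1.1, p1.2]

theorem measurePreserving_couplings (N : ℕ) :
    MeasurePreserving (fun s : R.Sample N => s.2.2.2) (R.law N) (couplings N) :=
  measurePreserving_snd.comp (measurePreserving_snd.comp measurePreserving_snd)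

theorem integrable_log_partition_law (β h : ℝ) (N : ℕ) :
    Integrable (fun s : R.Sample N => Real.log (partition β h s.2.2.2)) (R.law N) :=
  (R.measurePreserving_couplings N).integrable_comp_of_integrable (integrable_log_partition β h N)

theorem integrable_logIncrement (β h : ℝ) (N : ℕ) :
    Integrable (fun s => R.logIncrement β h s) (R.law N) :=
  ((R.integrable_log_pathSum_sub β h N).add (R.integrable_log_partition_law β h N)).congr
    ((R.ae_logIncrement_eq β h N).mono fun _ hs => hs.symm)

theorem integral_logIncrement (β h : ℝ) (N : ℕ) :
    ∫ s, R.logIncrement β h s ∂(R.law N)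
      = ∫ ω, (∫ g, Real.log (pathSum β h 1 (fun n => R.ξ n ω) (fun n m => R.q n m ω) g) ∂(noise N)
          - ∫ g, Real.log (pathSum β h 0 (fun n => R.ξ n ω) (fun n m => R.q n m ω) g) ∂(noise N))
          ∂(R.μ) + ∫ J, Real.log (partition β h J) ∂(couplings N) := by
  rw [integral_congr_ae (R.ae_logIncrement_eq β h N),
    integral_add (R.integrable_log_pathSum_sub β h N) (R.integrable_log_partition_law β h N)]
  congr 1
  · have hi := R.integrable_log_pathSum_sub β h N
    rw [law_eq] at hi ⊢
    rw [integral_prod _ hi]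
    refine integral_congr_ae ?_
    filter_upwards [R.ae_regular] with ω hω
    exact integral_sub (integrable_log_pathSum hω.1 hω.2 (by simp))
      (integrable_log_pathSum hω.1 hω.2 (by simp))
  · exact (R.measurePreserving_couplings N).hasLaw.integral_comp
      (integrable_log_partition β h N).aestronglyMeasurable

theorem measurable_replicaSum (β h : ℝ) (N : ℕ) :
    Measurable fun p : ℝ × R.Sample N => R.replicaSum β h p.1 p.2 :=
  measurable_pathReplica (ξ := fun n (p : ℝ × R.Sample N) => R.ξ n p.2.1)
    (q := fun i j (p : ℝ × R.Sample N) => R.q i j p.2.1) measurable_fst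
    (fun i => (R.measurable_ξ i).comp measurable_snd.fst)
    (fun i j => (R.measurable_q i j).comp measurable_snd.fst) measurable_snd.snd

theorem ae_abs_replicaSum_le (β h : ℝ) (N : ℕ) :
    ∀ᵐ s ∂(R.law N), ∀ t ∈ Set.Icc (0 : ℝ) 1, |R.replicaSum β h t s| ≤ 4 := by
  filter_upwards [R.ae_regular_law N, (R.summable_and_integrable_mass_law (envConst β h N) N).1]
    with s h1 h2 t ht
  rw [replicaSum_eq]
  exact abs_pathReplica_le ht h1.1 h1.2 h2

theorem integrable_replicaSum (β h : ℝ) (N : ℕ) {t : ℝ} (ht : t ∈ Set.Icc (0 : ℝ) 1) :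
    Integrable (fun s => R.replicaSum β h t s) (R.law N) :=
  Integrable.of_bound ((R.measurable_replicaSum β h N).comp
    measurable_prodMk_left).aestronglyMeasurable 4
    ((R.ae_abs_replicaSum_le β h N).mono fun _ hs => hs t ht)

theorem abs_replicaMean_le (β h : ℝ) (N : ℕ) {t : ℝ} (ht : t ∈ Set.Icc (0 : ℝ) 1) :
    |R.replicaMean β h N t| ≤ 4 := by
  have hb : ∀ᵐ s ∂(R.law N), ‖R.replicaSum β h t s‖ ≤ 4 :=
    (R.ae_abs_replicaSum_le β h N).mono fun s hs => hs t ht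
  simpa [replicaMean] using norm_integral_le_of_norm_le_const hb

theorem intervalIntegrable_replicaMean (β h : ℝ) (N : ℕ) :
    IntervalIntegrable (R.replicaMean β h N) volume 0 1 := by
  refine (intervalIntegrable_const (c := (4 : ℝ))).mono_fun'
    (R.measurable_replicaSum β h N).stronglyMeasurable.integral_prod_right'.aestronglyMeasurable ?_
  rw [Set.uIoc_of_le zero_le_one]
  filter_upwards [ae_restrict_mem measurableSet_Ioc] with t ht
  exact R.abs_replicaMean_le β h N ⟨ht.1.le, ht.2⟩

theorem integral_replicaMean (β h : ℝ) (N : ℕ) :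
    ∫ t in (0 : ℝ)..1, R.replicaMean β h N t = ∫ ω, (∫ t in (0 : ℝ)..1,
      ∫ g, pathReplica β h t (fun n => R.ξ n ω) (fun n m => R.q n m ω) g ∂(noise N)) ∂(R.μ) := by
  simp only [intervalIntegral.integral_of_le zero_le_one]
  have e : ∀ t ∈ Set.Ioc (0 : ℝ) 1, R.replicaMean β h N t
      = ∫ ω, ∫ g, pathReplica β h t (fun n => R.ξ n ω) (fun n m => R.q n m ω) g ∂(noise N)
        ∂(R.μ) := by
    intro t ht
    have hi := R.integrable_replicaSum β h N ⟨ht.1.le, ht.2⟩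
    rw [law_eq] at hi
    rw [replicaMean, law_eq, integral_prod _ hi]
    rfl
  rw [setIntegral_congr_fun measurableSet_Ioc e]
  refine integral_integral_swap ?_
  have hm : Measurable fun p : (ℝ × R.Ω) × Noise N =>
      pathReplica β h p.1.1 (fun n => R.ξ n p.1.2) (fun n m => R.q n m p.1.2) p.2 :=
    measurable_pathReplica (ξ := fun n (p : (ℝ × R.Ω) × Noise N) => R.ξ n p.1.2)
      (q := fun i j (p : (ℝ × R.Ω) × Noise N) => R.q i j p.1.2) measurable_fst.fst
      (fun i => (R.measurable_ξ i).comp measurable_fst.snd)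
      (fun i j => (R.measurable_q i j).comp measurable_fst.snd) measurable_snd
  refine Integrable.of_bound (C := 4)
    hm.stronglyMeasurable.integral_prod_right'.aestronglyMeasurable ?_
  filter_upwards [Measure.quasiMeasurePreserving_fst.ae (ae_restrict_mem measurableSet_Ioc),
    Measure.quasiMeasurePreserving_snd.ae R.ae_regular] with p h1 h2
  exact abs_integral_pathReplica_le h2.1 h2.2 ⟨h1.1.le, h1.2⟩

/-- The gap formula. -/
theorem G_sub_pressure (β h : ℝ) (hN : 0 < N) :
    R.G β h N - pressure β h N = β ^ 2 / 4 * ∫ t in (0 : ℝ)..1, R.replicaMean β h N t := by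
  have hN0 : (N : ℝ) ≠ 0 := by positivity
  rw [G, pressure, integral_logIncrement, integral_replicaMean]
  have : ∫ ω, (∫ g, Real.log (pathSum β h 1 (fun n => R.ξ n ω) (fun n m => R.q n m ω) g) ∂(noise N)
          - ∫ g, Real.log (pathSum β h 0 (fun n => R.ξ n ω) (fun n m => R.q n m ω) g) ∂(noise N))
          ∂(R.μ) = ∫ ω, β ^ 2 * N / 4 * (∫ t in (0 : ℝ)..1, ∫ g, pathReplica β h t
            (fun n => R.ξ n ω) (fun n m => R.q n m ω) g ∂(noise N)) ∂(R.μ) := by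
    refine integral_congr_ae ?_
    filter_upwards [R.ae_regular] with ω hω
    exact gap_fixed hN hω.1 hω.2
  rw [this, integral_const_mul]
  field_simp
  ring

theorem replicaMean_nonneg (β h t : ℝ) (N : ℕ) : 0 ≤ R.replicaMean β h N t := by
  refine integral_nonneg_of_ae ?_
  filter_upwards [R.ae_regular_law N] with s hs
  have hw : ∀ γ, 0 ≤ R.gibbsWeight β h t s γ := fun γ => by
    rw [gibbsWeight, interpWeight_eq]
    exact div_nonneg (pathWeight_nonneg hs.1.1 _) (tsum_nonneg (pathWeight_nonneg hs.1.1))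
  exact tsum_nonneg fun γ => tsum_nonneg fun γ' =>
    mul_nonneg (sq_nonneg _) (mul_nonneg (hw _) (hw _))

theorem pressure_le_G (β h : ℝ) (hN : 0 < N) : pressure β h N ≤ R.G β h N := by
  have := R.G_sub_pressure β h hN
  have h0 : 0 ≤ ∫ t in (0 : ℝ)..1, R.replicaMean β h N t :=
    intervalIntegral.integral_nonneg zero_le_one fun t _ => R.replicaMean_nonneg β h t N
  have : 0 ≤ β ^ 2 / 4 * ∫ t in (0 : ℝ)..1, R.replicaMean β h N t := by positivity
  linarith

end ROSt

/-! ### Superadditivity of the free energy -/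

section LogZ

variable {ι ι' κ κ' : Type*} [Fintype ι] [Fintype ι'] [Fintype κ] [Fintype κ']

theorem logZ_comp_equiv (e : ι' ≃ ι) (w : ι → ℝ) (a : ι → κ → ℝ) :
    logZ w a = logZ (fun i => w (e i)) (fun i => a (e i)) := by
  unfold logZ expSum
  refine integral_congr_ae (ae_of_all _ fun g => ?_)
  simp only
  rw [← e.sum_comp]
  rfl

/-- The free energy is additive for independent systems. -/
theorem logZ_prod {w : ι → ℝ} {w' : ι' → ℝ} (hw : IsWeight w) (hw' : IsWeight w')
    (a : ι → κ → ℝ) (b : ι' → κ' → ℝ) :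
    logZ (fun i : ι × ι' => w i.1 * w' i.2) (fun i => (Sum.elim (a i.1) (b i.2) : κ ⊕ κ' → ℝ))
      = logZ w a + logZ w' b := by
  rw [← integral_log_expSum hw a (measurePreserving_comp_inl (κ' := κ')),
    ← integral_log_expSum hw' b (measurePreserving_comp_inr (κ := κ)), logZ]
  refine Eq.trans ?_ (integral_add
    ((measurePreserving_comp_inl (κ' := κ')).integrable_comp_of_integrable
      (integrable_log_expSum hw a))
    ((measurePreserving_comp_inr (κ := κ)).integrable_comp_of_integrable
      (integrable_log_expSum hw' b)))
  refine integral_congr_ae (ae_of_all _ fun g => ?_)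
  simp only
  rw [← Real.log_mul (expSum_pos hw _).ne' (expSum_pos hw' _).ne']
  congr 1
  rw [expSum, expSum, expSum, Finset.sum_mul_sum, Fintype.sum_prod_type]
  refine Finset.sum_congr rfl fun i _ => Finset.sum_congr rfl fun j _ => ?_
  simp only [linField, Fintype.sum_sum_type, Sum.elim_inl, Sum.elim_inr, Real.exp_add]
  ring

/-- Averaging over Gaussian weights adds independent Gaussian energies. -/
theorem integral_logZ {w : ι → ℝ} (hw : IsWeight w) (a : ι → κ → ℝ) (b : ι → κ' → ℝ) :
    Integrable (fun g => logZ (fun i => w i * Real.exp (linField a g i)) b) (stdNormal κ) ∧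
    ∫ g, logZ (fun i => w i * Real.exp (linField a g i)) b ∂(stdNormal κ)
      = logZ w (fun i => (Sum.elim (a i) (b i) : κ ⊕ κ' → ℝ)) := by
  have hp := measurePreserving_sumElim (MeasurePreserving.id (stdNormal κ))
    (MeasurePreserving.id (stdNormal κ'))
  have hi := hp.integrable_comp_of_integrable
    (integrable_log_expSum hw fun i => (Sum.elim (a i) (b i) : κ ⊕ κ' → ℝ))
  have e : ∀ g, logZ (fun i => w i * Real.exp (linField a g i)) b
      = ∫ g', Real.log (expSum w (linField (fun i => Sum.elim (a i) (b i)) (Sum.elim g g')))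
        ∂(stdNormal κ') := fun g => by
    simp only [logZ, expSum, linField, Fintype.sum_sum_type, Sum.elim_inl, Sum.elim_inr,
      Real.exp_add, mul_assoc]
  simp only [e]
  refine ⟨hi.integral_prod_left, ?_⟩
  rw [← integral_log_expSum hw _ hp]
  exact (integral_prod _ hi).symm

end LogZ

/-- The free energy `E ln Z_N`. -/
def freeEnergy (β h : ℝ) (N : ℕ) : ℝ := ∫ J, Real.log (partition β h J) ∂(couplings N)

variable {M : ℕ}

theorem cov_interCoeff (β : ℝ) (σ σ' : Spins N) :
    cov (fun (σ : Spins N) p => β * interCoeff σ p) σ σ' = β ^ 2 * (N / 2 * overlap σ σ' ^ 2) := by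
  rw [← sum_interCoeff_mul, cov, Finset.mul_sum]
  exact Finset.sum_congr rfl fun p _ => by ring

theorem spin_append (σ : Spins N) (τ : Spins M) :
    (∀ i, spin (Fin.append σ τ) (Fin.castAdd M i) = spin σ i) ∧
    ∀ j, spin (Fin.append σ τ) (Fin.natAdd N j) = spin τ j := by
  simp [spin]

theorem magnetization_append (σ : Spins N) (τ : Spins M) :
    magnetization (Fin.append σ τ) = magnetization σ + magnetization τ := by
  simp [magnetization, Fin.sum_univ_add, spin_append]

theorem overlap_append (σ σ' : Spins N) (τ τ' : Spins M) :
    ((N + M : ℕ) : ℝ) * overlap (Fin.append σ τ) (Fin.append σ' τ')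
      = N * overlap σ σ' + M * overlap τ τ' := by
  simp only [natCast_mul_overlap, Fin.sum_univ_add, spin_append]

/-- The free energy of `N + M` spins, indexed by pairs of configurations. -/
theorem freeEnergy_add_eq (β h : ℝ) (N M : ℕ) :
    freeEnergy β h (N + M)
      = logZ (fun γ : Spins N × Spins M => spinWeight β h γ.1 * spinWeight β h γ.2)
        (fun γ p => β * interCoeff (Fin.append γ.1 γ.2) p) := by
  rw [freeEnergy, integral_log_partition, logZ_comp_equiv (Fin.appendEquiv N M)]
  congr 1
  ext γ
  simp only [spinWeight, ← Real.exp_add]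
  change Real.exp (β * (h * magnetization (Fin.append γ.1 γ.2))) = _
  rw [magnetization_append]
  congr 1
  ring

theorem isWeight_spinWeight_mul (β h : ℝ) (N M : ℕ) :
    IsWeight (fun γ : Spins N × Spins M => spinWeight β h γ.1 * spinWeight β h γ.2) :=
  ⟨fun _ => (mul_pos (Real.exp_pos _) (Real.exp_pos _)).le,
    Finset.sum_pos (fun _ _ => mul_pos (Real.exp_pos _) (Real.exp_pos _)) Finset.univ_nonempty⟩

theorem freeEnergy_add_freeEnergy (β h : ℝ) (N M : ℕ) :
    freeEnergy β h N + freeEnergy β h M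
      = logZ (fun γ : Spins N × Spins M => spinWeight β h γ.1 * spinWeight β h γ.2)
        (fun γ => Sum.elim (fun p => β * interCoeff γ.1 p) (fun p => β * interCoeff γ.2 p)) := by
  rw [freeEnergy, freeEnergy, integral_log_partition, integral_log_partition,
    ← logZ_prod (isWeight_spinWeight β h) (isWeight_spinWeight β h)]

theorem cov_sumElim_interCoeff (β : ℝ) (γ γ' : Spins N × Spins M) :
    cov (fun γ : Spins N × Spins M =>
      (Sum.elim (fun p => β * interCoeff γ.1 p) (fun p => β * interCoeff γ.2 p) :
        (Fin N × Fin N) ⊕ (Fin M × Fin M) → ℝ)) γ γ'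
      = β ^ 2 * (N / 2 * overlap γ.1 γ'.1 ^ 2 + M / 2 * overlap γ.2 γ'.2 ^ 2) := by
  rw [mul_add, ← cov_interCoeff, ← cov_interCoeff, cov, cov, cov, Fintype.sum_sum_type]
  simp only [Sum.elim_inl, Sum.elim_inr]

theorem cov_interCoeff_append (β : ℝ) (hN : 0 < N) (γ γ' : Spins N × Spins M) :
    cov (fun (γ : Spins N × Spins M) p => β * interCoeff (Fin.append γ.1 γ.2) p) γ γ'
      = β ^ 2 * ((N * overlap γ.1 γ'.1 + M * overlap γ.2 γ'.2) ^ 2 / (2 * (N + M))) := by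
  have h1 := cov_interCoeff β (Fin.append γ.1 γ.2) (Fin.append γ'.1 γ'.2)
  have h2 := overlap_append γ.1 γ'.1 γ.2 γ'.2
  have h3 : (N : ℝ) + M ≠ 0 := by positivity
  rw [← h2]
  push_cast at h1 ⊢
  refine Eq.trans h1 ?_
  field_simp

/-- Superadditivity: the overlap of the joint system is a convex combination of the overlaps of its
parts, and `q ↦ q ^ 2` is convex. -/
theorem freeEnergy_superadditive (β h : ℝ) (N M : ℕ) :
    freeEnergy β h N + freeEnergy β h M ≤ freeEnergy β h (N + M) := by
  have hzero : freeEnergy β h 0 = 0 := by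
    simp [freeEnergy, partition, magnetization, interaction]
  rcases Nat.eq_zero_or_pos N with rfl | hN
  · simp [hzero]
  rcases Nat.eq_zero_or_pos M with rfl | hM
  · simp [hzero]
  rw [freeEnergy_add_freeEnergy, freeEnergy_add_eq]
  have key := logZ_le_logZ_add (isWeight_spinWeight_mul β h N M)
    (a := fun γ p => β * interCoeff (Fin.append γ.1 γ.2) p)
    (b := fun γ => Sum.elim (fun p => β * interCoeff γ.1 p) (fun p => β * interCoeff γ.2 p))
    (C := 0) ?_
  · simpa using key
  intro γ γ'
  rw [cov_sumElim_interCoeff, cov_sumElim_interCoeff, cov_interCoeff_append β hN,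
    cov_interCoeff_append β hN, overlap_self hN, overlap_self hM]
  set x := overlap γ.1 γ'.1
  set y := overlap γ.2 γ'.2
  have hN' : (0 : ℝ) < N := by exact_mod_cast hN
  have hM' : (0 : ℝ) < M := by exact_mod_cast hM
  have e : β ^ 2 * (N / 2 * 1 ^ 2 + M / 2 * 1 ^ 2) - β ^ 2 * ((N * 1 + M * 1) ^ 2 / (2 * (N + M))) -
      (β ^ 2 * (N / 2 * x ^ 2 + M / 2 * y ^ 2) - β ^ 2 * ((N * x + M * y) ^ 2 / (2 * (N + M))))
      = -(β ^ 2 * (N * M * (x - y) ^ 2 / (2 * (N + M)))) := by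
    field_simp
    ring
  rw [e, neg_nonpos]
  positivity

/-- The free energy grows at most linearly. -/
theorem freeEnergy_le (β h : ℝ) (N : ℕ) :
    freeEnergy β h N ≤ N * (Real.log 2 + |β * h| + β ^ 2) := by
  have hw := isWeight_spinWeight (N := N) β h
  have key := logZ_le_logZ_add hw (a := fun (_ : Spins N) (_ : Fin 0) => (0 : ℝ))
    (b := fun σ p => β * interCoeff σ p) (C := β ^ 2 * N) ?_
  · have h0 : logZ (spinWeight (N := N) β h) (fun (_ : Spins N) (_ : Fin 0) => (0 : ℝ))
        ≤ N * (Real.log 2 + |β * h|) := by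
      have : logZ (spinWeight (N := N) β h) (fun (_ : Spins N) (_ : Fin 0) => (0 : ℝ))
          = Real.log (∑ σ : Spins N, spinWeight β h σ) := by
        simp [logZ, expSum, linField]
      rw [this]
      have hle : ∑ σ : Spins N, spinWeight β h σ ≤ 2 ^ N * Real.exp (N * |β * h|) := by
        calc ∑ σ : Spins N, spinWeight β h σ ≤ ∑ _σ : Spins N, Real.exp (N * |β * h|) := by
              refine Finset.sum_le_sum fun σ _ => Real.exp_le_exp.2 ?_
              rw [← mul_assoc, mul_comm]
              refine (le_abs_self _).trans ?_
              rw [abs_mul]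
              exact mul_le_mul_of_nonneg_right (abs_magnetization_le σ) (abs_nonneg _)
          _ = _ := by simp [Fintype.card_pi]
      refine (Real.log_le_log hw.2 hle).trans (le_of_eq ?_)
      rw [Real.log_mul (by positivity) (Real.exp_pos _).ne', Real.log_exp, Real.log_pow]
      ring
    have hf : freeEnergy β h N = logZ (spinWeight (N := N) β h) (fun σ p => β * interCoeff σ p) :=
      integral_log_partition β h N
    have : 0 ≤ β ^ 2 * N := by positivity
    rw [hf]
    linarith
  · intro σ σ'
    rw [cov_interCoeff, cov_interCoeff]
    have h1 := (abs_le.1 (abs_overlap_le σ σ))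
    have h2 : overlap σ σ ^ 2 ≤ 1 := by nlinarith
    simp only [cov, mul_zero, Finset.sum_const_zero, sub_zero]
    have h3 : β ^ 2 * (N / 2 * overlap σ σ ^ 2) ≤ β ^ 2 * (N / 2 * 1) := by gcongr
    have h4 : 0 ≤ β ^ 2 * (N / 2 * overlap σ σ' ^ 2) := by positivity
    have h5 : 0 ≤ β ^ 2 * (N : ℝ) := by positivity
    linarith

/-- The thermodynamic limit of the pressure exists, and it is an upper bound for the free energies
per spin. -/
theorem exists_tendsto_pressure (β h : ℝ) : ∃ P : ℝ,
    Tendsto (fun N => pressure β h N) atTop (𝓝 P) ∧ ∀ N, freeEnergy β h N ≤ N * P := by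
  have hsub : Subadditive fun N => -freeEnergy β h N := fun N M => by
    have := freeEnergy_superadditive β h N M
    linarith
  have hbdd : BddBelow (Set.range fun n : ℕ => -freeEnergy β h n / n) := by
    refine ⟨-(Real.log 2 + |β * h| + β ^ 2), ?_⟩
    rintro _ ⟨N, rfl⟩
    rcases Nat.eq_zero_or_pos N with rfl | hN
    · have : 0 ≤ Real.log 2 := Real.log_nonneg (by norm_num)
      simp only [Nat.cast_zero, div_zero]
      have := abs_nonneg (β * h)
      nlinarith [sq_nonneg β]
    · have hN' : (0 : ℝ) < N := by exact_mod_cast hN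
      simp only
      rw [le_div_iff₀ hN']
      have := freeEnergy_le β h N
      linarith
  refine ⟨-hsub.lim, ?_, fun N => ?_⟩
  · refine ((hsub.tendsto_lim hbdd).neg).congr fun N => ?_
    rw [pressure, freeEnergy]
    ring
  · rcases Nat.eq_zero_or_pos N with rfl | hN
    · simp [freeEnergy, partition, magnetization, interaction]
    · have hN' : (0 : ℝ) < N := by exact_mod_cast hN
      have := hsub.lim_le_div hbdd hN.ne'
      rw [le_div_iff₀ hN'] at this
      linarith

/-! ### The overlap structure of the Sherrington-Kirkpatrick model -/

/-- Evaluation at a measurable selector with finitely many values preserves measurability. -/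
theorem measurable_of_finite_selector {X Y S : Type*} [MeasurableSpace X] [MeasurableSpace Y]
    [Finite S] {P : X → S} (hP : ∀ p, MeasurableSet {x | P x = p}) {F : S → X → Y}
    (hF : ∀ p, Measurable (F p)) : Measurable fun x => F (P x) x := by
  intro A hA
  have : (fun x => F (P x) x) ⁻¹' A = ⋃ p, {x | P x = p} ∩ F p ⁻¹' A := by
    ext x
    simp
  rw [this]
  exact MeasurableSet.iUnion fun p => (hP p).inter (hF p hA)

theorem measurableSet_sort_eq {X : Type*} [MeasurableSpace X] {n : ℕ} {f : X → Fin n → ℝ}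
    (hf : ∀ i, Measurable fun x => f x i) (π : Equiv.Perm (Fin n)) :
    MeasurableSet {x | Tuple.sort (f x) = π} := by
  have : {x | Tuple.sort (f x) = π} =
      (⋂ i, ⋂ j, {x | i ≤ j → f x (π i) ≤ f x (π j)}) ∩
        ⋂ i, ⋂ j, {x | i < j → f x (π i) = f x (π j) → π i < π j} := by
    ext x
    rw [Set.mem_ofPred_eq, eq_comm, Tuple.eq_sort_iff]
    simp [Monotone]
  rw [this]
  refine (MeasurableSet.iInter fun i => MeasurableSet.iInter fun j => ?_).inter
    (MeasurableSet.iInter fun i => MeasurableSet.iInter fun j => ?_)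
  · by_cases h : i ≤ j
    · simpa [h] using measurableSet_le (hf (π i)) (hf (π j))
    · simp [h]
  · by_cases h : i < j
    · by_cases h' : π i < π j
      · simp [h']
      · simp only [h, h', forall_const, imp_false]
        exact (measurableSet_eq_fun (hf (π i)) (hf (π j))).compl
    · simp [h]

/-- The weight of a configuration, for an interaction of strength `r`. -/
def configWeight (β h r : ℝ) (J : Fin N × Fin N → ℝ) (σ : Spins N) : ℝ :=
  spinWeight β h σ * Real.exp (linField (fun σ p => β * r * interCoeff σ p) J σ)

theorem configWeight_pos (β h r : ℝ) (J : Fin N × Fin N → ℝ) (σ : Spins N) :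
    0 < configWeight β h r J σ := mul_pos (Real.exp_pos _) (Real.exp_pos _)

theorem measurable_configWeight (β h r : ℝ) (σ : Spins N) :
    Measurable fun J => configWeight β h r J σ := by
  have := (continuous_pi_iff.1 (continuous_linField
    (fun (σ : Spins N) p => β * r * interCoeff σ p))) σ
  exact (Real.continuous_exp.comp this).measurable.const_mul _

/-- A fixed enumeration of the configurations. -/
def enumSpins (N : ℕ) : Fin (Fintype.card (Spins N)) ≃ Spins N := (Fintype.equivFin _).symm

/-- The permutation that puts the weights in nonincreasing order. -/
def weightSort (β h r : ℝ) (J : Fin N × Fin N → ℝ) :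
    Equiv.Perm (Fin (Fintype.card (Spins N))) :=
  Tuple.sort fun k => -configWeight β h r J (enumSpins N k)

theorem measurableSet_weightSort_eq (β h r : ℝ) (π : Equiv.Perm (Fin (Fintype.card (Spins N)))) :
    MeasurableSet {J | weightSort β h r J = π} :=
  measurableSet_sort_eq (fun _ => (measurable_configWeight β h r _).neg) π

/-- The sequence of configurations obtained from a permutation, continued arbitrarily beyond the
number of configurations. -/
def configSeq (π : Equiv.Perm (Fin (Fintype.card (Spins N)))) (n : ℕ) : Spins N :=
  if hn : n < Fintype.card (Spins N) then enumSpins N (π ⟨n, hn⟩) else 1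

/-- The sequence of weights obtained from a permutation, extended by zero. -/
def weightSeq (β h r : ℝ) (π : Equiv.Perm (Fin (Fintype.card (Spins N))))
    (J : Fin N × Fin N → ℝ) (n : ℕ) : ℝ :=
  if n < Fintype.card (Spins N) then configWeight β h r J (configSeq π n) else 0

theorem weightSeq_nonneg (β h r : ℝ) (π : Equiv.Perm (Fin (Fintype.card (Spins N))))
    (J : Fin N × Fin N → ℝ) (n : ℕ) : 0 ≤ weightSeq β h r π J n := by
  unfold weightSeq
  split_ifs
  · exact (configWeight_pos _ _ _ _ _).le
  · exact le_rfl

theorem antitone_weightSeq (β h r : ℝ) (J : Fin N × Fin N → ℝ) :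
    Antitone (weightSeq β h r (weightSort β h r J) J) := by
  intro m n hmn
  by_cases hn : n < Fintype.card (Spins N)
  · have hm : m < Fintype.card (Spins N) := by omega
    have := Tuple.monotone_sort (fun k => -configWeight β h r J (enumSpins N k))
      (show (⟨m, hm⟩ : Fin _) ≤ ⟨n, hn⟩ from hmn)
    simp only [Function.comp_apply, neg_le_neg_iff] at this
    simpa only [weightSeq, configSeq, hm, hn, if_pos, dif_pos, weightSort] using this
  · have : weightSeq β h r (weightSort β h r J) J n = 0 := if_neg hn
    rw [this]
    exact weightSeq_nonneg _ _ _ _ _ _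

theorem isSummableWeight_weightSeq (β h r : ℝ) (π : Equiv.Perm (Fin (Fintype.card (Spins N))))
    (J : Fin N × Fin N → ℝ) : IsSummableWeight (weightSeq β h r π J) := by
  have hs : Summable (weightSeq β h r π J) :=
    summable_of_ne_finset_zero (s := Finset.range (Fintype.card (Spins N))) fun n hn =>
      if_neg (Finset.mem_range.not.1 hn)
  refine ⟨weightSeq_nonneg _ _ _ _ _, hs, hs.tsum_pos (weightSeq_nonneg _ _ _ _ _) 0 ?_⟩
  rw [weightSeq, if_pos Fintype.card_pos]
  exact configWeight_pos _ _ _ _ _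

theorem isOverlapMatrix_overlap (hN : 0 < N) (c : ℕ → Spins N) :
    IsOverlapMatrix fun n m => overlap (c n) (c m) := by
  refine ⟨posSemidef_of_gram (κ := Fin N) (fun n m => ?_) fun s => ⟨Finset.univ,
    fun i n => spin (c n) i / √N, fun n _ m _ => ?_⟩, fun n => overlap_self hN _⟩
  · simp only [overlap, mul_comm]
  · have h : √(N : ℝ) * √N = N := Real.mul_self_sqrt (Nat.cast_nonneg _)
    simp only [overlap, Finset.sum_div, div_mul_div_comm, h]

/-- The overlap structure of the Sherrington-Kirkpatrick model with `N` spins: the Boltzmann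
weights in nonincreasing order, for an interaction of strength `r`, and the overlaps of the
configurations that carry them. The random permutation that orders the weights is a function of the
couplings. -/
def gibbsROSt (hN : 0 < N) (β h r : ℝ) : ROSt.{u} where
  Ω := ULift.{u} (Fin N × Fin N → ℝ)
  μ := (couplings N).map ULift.up
  isProb := Measure.isProbabilityMeasure_map measurable_up.aemeasurable
  ξ n ω := weightSeq β h r (weightSort β h r ω.down) ω.down n
  q n m ω := overlap (configSeq (weightSort β h r ω.down) n)
    (configSeq (weightSort β h r ω.down) m)
  measurable_ξ n := by
    have hF : ∀ π : Equiv.Perm (Fin (Fintype.card (Spins N))),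
        Measurable fun J => weightSeq β h r π J n := by
      intro π
      unfold weightSeq
      split_ifs
      · exact measurable_configWeight _ _ _ _
      · exact measurable_const
    exact (measurable_of_finite_selector (measurableSet_weightSort_eq β h r) hF).comp
      measurable_down
  measurable_q n m :=
    (measurable_of_finite_selector (measurableSet_weightSort_eq β h r)
      (F := fun π _ => overlap (configSeq π n) (configSeq π m)) fun _ => measurable_const).comp
      measurable_down
  antitone_ξ := ae_of_all _ fun ω => antitone_weightSeq β h r ω.down
  nonneg_ξ := ae_of_all _ fun ω => (isSummableWeight_weightSeq β h r _ ω.down).1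
  summable_ξ := ae_of_all _ fun ω => (isSummableWeight_weightSeq β h r _ ω.down).2.1
  tsum_pos_ξ := ae_of_all _ fun ω => (isSummableWeight_weightSeq β h r _ ω.down).2.2
  posSemidef_q := ae_of_all _ fun _ => (isOverlapMatrix_overlap hN _).1
  diag_q := ae_of_all _ fun _ => (isOverlapMatrix_overlap hN _).2

instance : Nonempty ROSt.{u} := ⟨gibbsROSt (N := 1) one_pos 0 0 0⟩

/-- For finitely many weights attached to the configurations of `N` spins, the Gaussian average can
be computed with any field of the same covariance. -/
theorem integral_log_pathSum_weightSeq (β h r : ℝ) (hN : 0 < N)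
    (π : Equiv.Perm (Fin (Fintype.card (Spins N)))) (J : Fin N × Fin N → ℝ) {t : ℝ}
    {κ : Type*} [Fintype κ] (c : Spins N × Spins M → κ → ℝ)
    (hc : ∀ γ γ', cov (interpCoeff (startCoeff β (fun n m => overlap (configSeq π n)
      (configSeq π m)) (Fintype.card (Spins N))) (cavityCoeff β (fun n m => overlap
      (configSeq π n) (configSeq π m)) (Fintype.card (Spins N))) t) γ γ'
      = cov c (configSeq π γ.1, γ.2) (configSeq π γ'.1, γ'.2)) :
    ∫ g, Real.log (pathSum β h t (weightSeq β h r π J)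
        (fun n m => overlap (configSeq π n) (configSeq π m)) g) ∂(noise M)
      = logZ (fun γ : Spins N × Spins M => configWeight β h r J γ.1 * spinWeight β h γ.2) c := by
  have hq := isOverlapMatrix_overlap hN (configSeq π)
  have hξ := isSummableWeight_weightSeq β h r π J
  have htr : truncate (Fintype.card (Spins N)) (weightSeq β h r π J) = weightSeq β h r π J := by
    ext n
    by_cases hn : n < (Fintype.card (Spins N))
    · exact if_pos hn
    · rw [truncate, weightSeq, if_neg hn, if_neg hn]
  have hpos : 0 < weightSeq β h r π J 0 := by
    rw [weightSeq, if_pos Fintype.card_pos]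
    exact configWeight_pos _ _ _ _ _
  have hw : IsWeight (fieldWeight (N := M) β h (weightSeq β h r π J) (Fintype.card (Spins N))) :=
    isWeight_fieldWeight hξ.1 Fintype.card_pos hpos
  have hG := measurePreserving_noiseVars (N := M) (Fintype.card (Spins N))
  have e : ∀ g : Noise M, pathSum β h t (weightSeq β h r π J)
      (fun n m => overlap (configSeq π n) (configSeq π m)) g
      = expSum (fieldWeight β h (weightSeq β h r π J) (Fintype.card (Spins N))) (linField (interpCoeff
        (startCoeff β (fun n m => overlap (configSeq π n) (configSeq π m)) (Fintype.card (Spins N)))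
        (cavityCoeff β (fun n m => overlap (configSeq π n) (configSeq π m)) (Fintype.card (Spins N))) t)
        (noiseVars (Fintype.card (Spins N)) g)) := fun g => by
    conv_lhs => rw [← htr]
    exact pathSum_truncate hq t (Fintype.card (Spins N)) g
  rw [integral_congr_ae (ae_of_all _ fun g => congrArg Real.log (e g)),
    integral_log_expSum hw _ hG]
  have hconf : ∀ k : Fin (Fintype.card (Spins N)), configSeq π k = enumSpins N (π k) := fun k =>
    dif_pos k.2
  rw [logZ_comp_equiv ((π.trans (enumSpins N)).prodCongr (Equiv.refl (Spins M)))]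
  have hw' : fieldWeight (N := M) β h (weightSeq β h r π J) (Fintype.card (Spins N)) = fun i =>
      configWeight β h r J (((π.trans (enumSpins N)).prodCongr (Equiv.refl (Spins M))) i).1 *
        spinWeight β h (((π.trans (enumSpins N)).prodCongr (Equiv.refl (Spins M))) i).2 := by
    ext i
    rw [fieldWeight, weightSeq, if_pos i.1.2, hconf]
    rfl
  rw [← hw']
  refine logZ_congr_cov hw fun γ γ' => ?_
  rw [hc, hconf, hconf]
  rfl

/-- The incremental free energy of the `N`-spin structure, in terms of the free energies of Gaussian
fields on pairs of configurations. -/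
theorem gibbsROSt_G (hN : 0 < N) (β h r : ℝ) (hM : 0 < M) {κ κ' : Type*} [Fintype κ] [Fintype κ']
    (c : Spins N × Spins M → κ → ℝ) (c' : Spins N × Spins M → κ' → ℝ)
    (hc : ∀ γ γ', cov c γ γ' = β ^ 2 * M * (overlap γ.1 γ'.1 * overlap γ.2 γ'.2))
    (hc' : ∀ γ γ', cov c' γ γ'
      = β ^ 2 * (M / 2) * (overlap γ.1 γ'.1 ^ 2 + overlap γ.2 γ'.2 ^ 2)) :
    M * (gibbsROSt.{u} hN β h r).G β h M
      = logZ (fun γ : Spins N × Spins M => spinWeight β h γ.1 * spinWeight β h γ.2)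
          (fun γ => Sum.elim (fun p => β * r * interCoeff γ.1 p) (c γ))
        - logZ (fun γ : Spins N × Spins M => spinWeight β h γ.1 * spinWeight β h γ.2)
          (fun γ => Sum.elim (fun p => β * r * interCoeff γ.1 p) (c' γ))
        + freeEnergy β h M := by
  have hM0 : (M : ℝ) ≠ 0 := by positivity
  have hw := isWeight_spinWeight_mul β h N M
  rw [ROSt.G, ROSt.integral_logIncrement, ← mul_assoc, mul_one_div_cancel hM0, one_mul]
  have hmp : MeasurePreserving (β := (gibbsROSt.{u} hN β h r).Ω) ULift.up (couplings N)
      (gibbsROSt.{u} hN β h r).μ := ⟨measurable_up, rfl⟩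
  have hemb : MeasurableEmbedding (β := (gibbsROSt.{u} hN β h r).Ω)
      (ULift.up : (Fin N × Fin N → ℝ) → _) := MeasurableEquiv.ulift.symm.measurableEmbedding
  have e : ∀ J : Fin N × Fin N → ℝ,
      ∫ g, Real.log (pathSum β h 1 (fun n => (gibbsROSt.{u} hN β h r).ξ n (ULift.up J))
        (fun n m => (gibbsROSt.{u} hN β h r).q n m (ULift.up J)) g) ∂(noise M)
      - ∫ g, Real.log (pathSum β h 0 (fun n => (gibbsROSt.{u} hN β h r).ξ n (ULift.up J))
        (fun n m => (gibbsROSt.{u} hN β h r).q n m (ULift.up J)) g) ∂(noise M)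
      = logZ (fun γ : Spins N × Spins M => configWeight β h r J γ.1 * spinWeight β h γ.2) c
      - logZ (fun γ : Spins N × Spins M => configWeight β h r J γ.1 * spinWeight β h γ.2) c'
      := by
    intro J
    have hq := isOverlapMatrix_overlap hN (configSeq (weightSort β h r J))
    congr 1
    · refine integral_log_pathSum_weightSeq β h r hN (weightSort β h r J) J c ?_
      intro γ γ'
      rw [hc, interpCoeff_one, cov_cavityCoeff hq]
    · refine integral_log_pathSum_weightSeq β h r hN (weightSort β h r J) J c' ?_
      intro γ γ'
      rw [hc', interpCoeff_zero, cov_startCoeff hq]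
  have hconf : ∀ (J : Fin N × Fin N → ℝ) (γ : Spins N × Spins M),
      configWeight β h r J γ.1 * spinWeight β h γ.2 = spinWeight β h γ.1 * spinWeight β h γ.2 *
        Real.exp (linField (fun (γ : Spins N × Spins M) p => β * r * interCoeff γ.1 p) J γ) := by
    intro J γ
    rw [configWeight, mul_right_comm]
    rfl
  have h1 := integral_logZ hw (fun (γ : Spins N × Spins M) p => β * r * interCoeff γ.1 p) c
  have h2 := integral_logZ hw (fun (γ : Spins N × Spins M) p => β * r * interCoeff γ.1 p) c'
  rw [← hmp.integral_comp hemb,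
    integral_congr_ae (ae_of_all _ e)]
  simp only [hconf]
  rw [← h1.2, ← h2.2, ← integral_sub h1.1 h2.1]
  rfl

/-- The cavity computation: for an interaction of slightly reduced strength, the incremental free
energy of the `N`-spin structure is the increment of the free energy from `N` to `N + M` spins, up
to an error that vanishes as `N` grows. -/
theorem gibbsROSt_G_le (hN : 0 < N) (hM : 0 < M) (β h : ℝ) :
    M * (gibbsROSt.{u} hN β h √(N / (N + M))).G β h M
      ≤ freeEnergy β h (N + M) - freeEnergy β h N + β ^ 2 * M ^ 2 / (N + M) := by
  set r := √((N : ℝ) / (N + M)) with hr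
  have hN' : (0 : ℝ) < N := by exact_mod_cast hN
  have hM' : (0 : ℝ) < M := by exact_mod_cast hM
  have hr2 : r * r = N / (N + M) := Real.mul_self_sqrt (by positivity)
  have hw := isWeight_spinWeight_mul β h N M
  -- explicit fields with the covariances of `V` and of `K_M + √M κ`
  set c : Spins N × Spins M → Fin N × Fin M → ℝ := fun γ p =>
    β * (spin γ.1 p.1 * spin γ.2 p.2 / √N) with hcdef
  set c' : Spins N × Spins M → (Fin N × Fin N) ⊕ (Fin M × Fin M) → ℝ := fun γ =>
    Sum.elim (fun p => β * √(M / N) * interCoeff γ.1 p) (fun p => β * interCoeff γ.2 p) with hcdef'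
  have hinter : ∀ (b : ℝ) (σ σ' : Spins N), ∑ p, b * interCoeff σ p * (b * interCoeff σ' p)
      = b ^ 2 * (N / 2 * overlap σ σ' ^ 2) := fun b σ σ' => cov_interCoeff b σ σ'
  have hinter' : ∀ (b : ℝ) (σ σ' : Spins M), ∑ p, b * interCoeff σ p * (b * interCoeff σ' p)
      = b ^ 2 * (M / 2 * overlap σ σ' ^ 2) := fun b σ σ' => cov_interCoeff b σ σ'
  have hc : ∀ γ γ', cov c γ γ' = β ^ 2 * M * (overlap γ.1 γ'.1 * overlap γ.2 γ'.2) := by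
    intro γ γ'
    have hs : √(N : ℝ) * √N = N := Real.mul_self_sqrt hN'.le
    have e : ∀ i j, c γ (i, j) * c γ' (i, j) = β ^ 2 / N *
        ((spin γ.1 i * spin γ'.1 i) * (spin γ.2 j * spin γ'.2 j)) := fun i j => by
      calc c γ (i, j) * c γ' (i, j) = β ^ 2 / (√(N : ℝ) * √N) *
          ((spin γ.1 i * spin γ'.1 i) * (spin γ.2 j * spin γ'.2 j)) := by
            simp only [hcdef]
            field_simp
        _ = _ := by rw [hs]
    rw [cov, Fintype.sum_prod_type]
    simp only [e]
    simp only [← Finset.mul_sum, ← Finset.sum_mul, ← natCast_mul_overlap]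
    field_simp
  have hc' : ∀ γ γ', cov c' γ γ'
      = β ^ 2 * (M / 2) * (overlap γ.1 γ'.1 ^ 2 + overlap γ.2 γ'.2 ^ 2) := by
    intro γ γ'
    have hs : √((M : ℝ) / N) ^ 2 = M / N := Real.sq_sqrt (by positivity)
    rw [cov, Fintype.sum_sum_type]
    simp only [hcdef', Sum.elim_inl, Sum.elim_inr]
    rw [hinter, hinter', mul_pow, hs]
    field_simp
  rw [gibbsROSt_G hN β h r hM c c' hc hc']
  have hsum : ∀ {κ : Type} [Fintype κ] (d : Spins N × Spins M → κ → ℝ) (γ γ'),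
      cov (fun γ : Spins N × Spins M =>
        (Sum.elim (fun p => β * r * interCoeff γ.1 p) (d γ) : (Fin N × Fin N) ⊕ κ → ℝ)) γ γ'
      = β ^ 2 * (N / (N + M)) * (N / 2 * overlap γ.1 γ'.1 ^ 2) + cov d γ γ' := by
    intro κ _ d γ γ'
    rw [cov, Fintype.sum_sum_type]
    simp only [Sum.elim_inl, Sum.elim_inr]
    rw [hinter, mul_pow, pow_two r, hr2, cov]
  have hov : ∀ {L : ℕ} (σ σ' : Spins L), -1 ≤ overlap σ σ' ∧ overlap σ σ' ≤ 1 := fun σ σ' =>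
    abs_le.1 (abs_overlap_le σ σ')
  have hnum : logZ (fun γ : Spins N × Spins M => spinWeight β h γ.1 * spinWeight β h γ.2)
      (fun γ => Sum.elim (fun p => β * r * interCoeff γ.1 p) (c γ))
      ≤ freeEnergy β h (N + M) + β ^ 2 * M ^ 2 / (N + M) := by
    rw [freeEnergy_add_eq]
    have := logZ_le_logZ_add hw (a := fun γ p => β * interCoeff (Fin.append γ.1 γ.2) p)
      (b := fun γ => (Sum.elim (fun p => β * r * interCoeff γ.1 p) (c γ) :
        (Fin N × Fin N) ⊕ (Fin N × Fin M) → ℝ)) (C := 2 * (β ^ 2 * M ^ 2 / (N + M))) ?_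
    · linarith
    intro γ γ'
    rw [hsum, hsum, hc, hc, cov_interCoeff_append β hN, cov_interCoeff_append β hN,
      overlap_self hN, overlap_self hM]
    obtain ⟨x1, x2⟩ := hov γ.1 γ'.1
    obtain ⟨y1, y2⟩ := hov γ.2 γ'.2
    set x := overlap γ.1 γ'.1
    set y := overlap γ.2 γ'.2
    have e : β ^ 2 * (N / (N + M)) * (N / 2 * 1 ^ 2) + β ^ 2 * M * (1 * 1) -
        β ^ 2 * ((N * 1 + M * 1) ^ 2 / (2 * (N + M))) -
        (β ^ 2 * (N / (N + M)) * (N / 2 * x ^ 2) + β ^ 2 * M * (x * y) -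
        β ^ 2 * ((N * x + M * y) ^ 2 / (2 * (N + M))))
        = β ^ 2 * M ^ 2 / (N + M) * ((1 + y ^ 2) / 2 - x * y) := by
      field_simp
      ring
    rw [e, mul_comm (2 : ℝ)]
    refine mul_le_mul_of_nonneg_left ?_ (by positivity)
    nlinarith
  have hden : freeEnergy β h N + freeEnergy β h M
      ≤ logZ (fun γ : Spins N × Spins M => spinWeight β h γ.1 * spinWeight β h γ.2)
      (fun γ => Sum.elim (fun p => β * r * interCoeff γ.1 p) (c' γ)) := by
    rw [freeEnergy_add_freeEnergy]
    have := logZ_le_logZ_add hw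
      (b := fun γ => (Sum.elim (fun p => β * interCoeff γ.1 p) (fun p => β * interCoeff γ.2 p) :
        (Fin N × Fin N) ⊕ (Fin M × Fin M) → ℝ))
      (a := fun γ => (Sum.elim (fun p => β * r * interCoeff γ.1 p) (c' γ) :
        (Fin N × Fin N) ⊕ (Fin N × Fin N) ⊕ (Fin M × Fin M) → ℝ)) (C := 0) ?_
    · simpa using this
    intro γ γ'
    rw [hsum, hsum, hc', hc', cov_sumElim_interCoeff, cov_sumElim_interCoeff,
      overlap_self hN, overlap_self hM]
    obtain ⟨x1, x2⟩ := hov γ.1 γ'.1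
    set x := overlap γ.1 γ'.1
    set y := overlap γ.2 γ'.2
    have e : β ^ 2 * (N / 2 * 1 ^ 2 + M / 2 * 1 ^ 2) -
        (β ^ 2 * (N / (N + M)) * (N / 2 * 1 ^ 2) + β ^ 2 * (M / 2) * (1 ^ 2 + 1 ^ 2)) -
        (β ^ 2 * (N / 2 * x ^ 2 + M / 2 * y ^ 2) -
        (β ^ 2 * (N / (N + M)) * (N / 2 * x ^ 2) + β ^ 2 * (M / 2) * (x ^ 2 + y ^ 2)))
        = -(β ^ 2 * M ^ 2 / (2 * (N + M)) * (1 - x ^ 2)) := by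
      field_simp
      ring
    rw [e, neg_nonpos]
    exact mul_nonneg (by positivity) (by nlinarith)
  linarith

/-! ### The variational principle -/

theorem bddBelow_G (β h : ℝ) (hM : 0 < M) :
    BddBelow (Set.range fun R : ROSt.{u} => R.G β h M) :=
  ⟨pressure β h M, by rintro _ ⟨R, rfl⟩; exact R.pressure_le_G β h hM⟩

theorem pressure_le_iInf_G (β h : ℝ) (hM : 0 < M) :
    pressure β h M ≤ ⨅ R : ROSt.{u}, R.G β h M :=
  le_ciInf fun R => R.pressure_le_G β h hM

/-- The incremental free energies of the `N`-spin structures are at least the infimum, so if the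
infimum exceeded `P`, the free energy would grow by more than `M P + δ` over every step of length
`M` from some point on, against the bound by `n P`. -/
theorem iInf_G_le (β h : ℝ) (hM : 0 < M) {P : ℝ} (hP : ∀ N, freeEnergy β h N ≤ N * P) :
    ⨅ R : ROSt.{u}, R.G β h M ≤ P := by
  set x := ⨅ R : ROSt.{u}, R.G β h M with hx
  have hM' : (0 : ℝ) < M := by exact_mod_cast hM
  by_contra! hlt
  set δ := M * (x - P) / 2 with hδ
  have hδ0 : 0 < δ := by have := sub_pos.2 hlt; positivity
  have hstep : ∀ N : ℕ, 0 < N →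
      M * x ≤ freeEnergy β h (N + M) - freeEnergy β h N + β ^ 2 * M ^ 2 / (N + M) := by
    intro N hN
    refine le_trans ?_ (gibbsROSt_G_le.{u} hN hM β h)
    exact mul_le_mul_of_nonneg_left (ciInf_le (bddBelow_G β h hM) _) hM'.le
  obtain ⟨N₀, hN₀⟩ := exists_nat_gt (β ^ 2 * M ^ 2 / δ)
  have hN₀pos : 0 < N₀ := by
    have : (0 : ℝ) < N₀ := lt_of_le_of_lt (by positivity) hN₀
    exact_mod_cast this
  have hgrow : ∀ k : ℕ, freeEnergy β h N₀ + k * (M * P + δ) ≤ freeEnergy β h (N₀ + k * M) := by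
    intro k
    induction k with
    | zero => simp
    | succ k ih =>
      have h1 := hstep (N₀ + k * M) (by omega)
      have h2 : β ^ 2 * M ^ 2 / (((N₀ + k * M : ℕ) : ℝ) + M) ≤ δ := by
        have hpos : (0 : ℝ) < N₀ := by exact_mod_cast hN₀pos
        rw [div_lt_iff₀ hδ0] at hN₀
        push_cast
        rw [div_le_iff₀ (by positivity)]
        have : 0 ≤ δ * (k * M + M) := by positivity
        linarith
      have h3 : N₀ + (k + 1) * M = N₀ + k * M + M := by ring
      rw [h3]
      push_cast
      have h4 : M * x = M * P + 2 * δ := by rw [hδ]; ring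
      linarith
  obtain ⟨k, hk⟩ := exists_nat_gt ((N₀ * P - freeEnergy β h N₀) / δ)
  rw [div_lt_iff₀ hδ0] at hk
  have h1 := hgrow k
  have h2 := hP (N₀ + k * M)
  push_cast at h2
  linarith

end

end SpinGlass

open SpinGlass

theorem theorem4p1 (β h : ℝ) :
    (∀ N : ℕ, 0 < N → ∀ R : ROSt.{u},
      -- all the quantities in the claim are well defined
      Integrable (fun J => Real.log (partition β h J)) (couplings N) ∧
      (∀ᵐ s ∂(R.law N), Summable (R.cavityWeight β h s) ∧ Summable (R.vacancyWeight β s)) ∧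
      Integrable (fun s => R.logIncrement β h s) (R.law N) ∧
      (∀ t ∈ Set.Icc (0 : ℝ) 1,
        (∀ᵐ s ∂(R.law N), Summable (R.interpWeight β h t s)) ∧
        Integrable (fun s => R.replicaSum β h t s) (R.law N)) ∧
      IntervalIntegrable (R.replicaMean β h N) volume 0 1 ∧
      -- the bound, and the formula for the gap
      pressure β h N ≤ R.G β h N ∧
      R.G β h N - pressure β h N = β ^ 2 / 4 * ∫ t in (0 : ℝ)..1, R.replicaMean β h N t) ∧
    -- the variational principle
    ∃ P : ℝ,
      Tendsto (fun N => pressure β h N) atTop (𝓝 P) ∧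
      Tendsto (fun M => ⨅ R : ROSt.{u}, R.G β h M) atTop (𝓝 P) ∧
      IsLUB {x | ∃ M : ℕ, 0 < M ∧ x = ⨅ R : ROSt.{u}, R.G β h M} P := by
  refine ⟨fun N hN R => ⟨integrable_log_partition β h N, ?_, R.integrable_logIncrement β h N,
    fun t ht => ⟨(R.ae_summable_interpWeight β h N).mono fun s hs => hs t ht,
      R.integrable_replicaSum β h N ht⟩, R.intervalIntegrable_replicaMean β h N,
    R.pressure_le_G β h hN, R.G_sub_pressure β h hN⟩, ?_⟩
  · filter_upwards [R.ae_summable_interpWeight β h N, R.ae_summable_vacancyWeight β N]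
      with s h1 h2
    exact ⟨R.cavityWeight_eq s ▸ h1 1 (by simp), h2⟩
  · obtain ⟨P, hP, hle⟩ := exists_tendsto_pressure β h
    refine ⟨P, hP, ?_, ?_, ?_⟩
    · refine tendsto_of_tendsto_of_tendsto_of_le_of_le' hP tendsto_const_nhds ?_ ?_
      · filter_upwards [eventually_gt_atTop 0] with M hM using pressure_le_iInf_G β h hM
      · filter_upwards [eventually_gt_atTop 0] with M hM using iInf_G_le β h hM hle
    · rintro _ ⟨M, hM, rfl⟩
      exact iInf_G_le β h hM hle
    · intro b hb
      refine le_of_tendsto hP ?_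
      filter_upwards [eventually_gt_atTop 0] with M hM
      exact (pressure_le_iInf_G β h hM).trans (hb ⟨M, hM, rfl⟩)
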